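/- **Setting.** Let $F$ be a non-archimedean local field of odd residue characteristic $p$, $E/F$ the unramified quadratic extension with non-trivial automorphism $x\mapsto\bar x$, and $\varpi\in F$ a uniformizer of $E$; write $\mathfrak o=\mathfrak o_E$, $\mathfrak p=\mathfrak p_E$. Let $\beta=\begin{pmatrix}0&0&1\\0&1&0\\1&0&0\end{pmatrix}$ and let $G=U(2,1)(E/F)$ be the group of $g\in GL_3(E)$ preserving the Hermitian form $(v,w)\mapsto v^{T}\beta\bar w$. Let $K$ be one of the two maximal compact open subgroups $$K_0=GL_3(\mathfrak o)\cap G,\qquad K_1=\begin{pmatrix}\mathfrak o&\mathfrak o&\mathfrak p^{-1}\\ \mathfrak p&\mathfrak o&\mathfrak o\\ \mathfrak p&\mathfrak p&\mathfrak o\end{pmatrix}\cap G .$$ Put $\alpha=\mathrm{diag}(\varpi^{-1},1,\varpi)\in G$, and let $\beta_K=\beta$ if $K=K_0$, $\beta_K=\beta\alpha^{-1}$ if $K=K_1$. Let $K^1$ be the maximal normal pro-$p$ subgroup of $K$ and $\Gamma_K=K/K^1$ (the group $U(2,1)(k_E/k_F)$, resp. $(U(1,1)\times U(1))(k_E/k_F)$,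 over the residue fields). Let $I_K$ and $I_{1,K}$ (resp. $I'_{1,K}$) be the preimages in $K$ of the upper triangular subgroup of $\Gamma_K$ and of its unipotent radical (resp. of the unipotent radical of the lower triangular subgroup). Let $\sigma$ be an irreducible smooth representation of $K$ over $\overline{\mathbf F}_p$ and $v_0\neq 0$ a vector of $\sigma^{I_{1,K}}$. Let $\mathrm{ind}_K^G\sigma$ be the space of locally constant, compactly supported $f:G\to\sigma$ with $f(kg)=\sigma(k)f(g)$ for $k\in K$, on which $G$ acts by right translation. The natural map $\sigma^{I_{1,K}}\hookrightarrow\sigma\twoheadrightarrow\sigma_{I'_{1,K}}$ is an isomorphism; let $j_\sigma\in\mathrm{End}(\sigma)$ be the composition of $\sigma\twoheadrightarrow\sigma_{I'_{1,K}}$, its inverse, and $\sigma^{I_{1,K}}\hookrightarrow\sigma$. Let $\varphi:G\to\mathrm{End}(\sigma)$ be the function supported on $K\alpha K$ with $\varphi(k\alpha k')=\sigma(k)j_\sigma\sigma(k')$, and let $T\in\mathrm{End}_G(\mathrm{ind}_K^G\sigma)$ be the Hecke operator $(Tf)(g)=\sum_{yK\in G/K}\varphi(y)f(y^{-1}g)$.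 For $n\in\mathbf Z$ let $f_n\in\mathrm{ind}_K^G\sigma$ be the $I_{1,K}$-invariant function supported on $K\alpha^{-n}I_{1,K}$ with $f_n(\alpha^{-n})=\beta_Kv_0$ if $n>0$ and $f_n(\alpha^{-n})=v_0$ if $n\le 0$. For $n\ge 0$ let $R_n^+(\sigma)$ (resp. $R_n^-(\sigma)$) be the space of functions in $\mathrm{ind}_K^G\sigma$ supported in $K\alpha^nI_K$ (resp. $K\alpha^{-(n+1)}I_K$), and let $I^{\pm}(\sigma)=\sum_{n\ge0}R_n^{\pm}(\sigma)$. **Proposition 3.1.** Let $\pi$ be a smooth $\overline{\mathbf F}_p$-representation of $G$ containing $\sigma$, and let $\iota:\mathrm{ind}_K^G\sigma\to\pi$ be a corresponding (by Frobenius reciprocity) non-zero $G$-map. Write $I^{\pm}(\sigma,\pi)=\iota(I^{\pm}(\sigma))$. Suppose that $\iota$ is surjective and factors through $\mathrm{ind}_K^G\sigma/P(T)(\mathrm{ind}_K^G\sigma)$ for some polynomial $P\in\overline{\mathbf F}_p[x]$ of degree $\ge 1$. Then 1. $\iota(f_0)\in I^-(\sigma,\pi)$; 2. $\iota(f_1)\in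 I^+(\sigma,\pi)$. Moreover $\iota(f_0)\ne0$, and hence $I^+(\sigma,\pi)\cap I^-(\sigma,\pi)\neq0$. -/

import Mathlib

noncomputable section
namespace U21

open Matrix

section General

set_option linter.unusedSectionVars false

variable {k G V W : Type*} [Field k] [Group G] [TopologicalSpace G]
  [AddCommGroup V] [Module k V] [AddCommGroup W] [Module k W]

/-- A representation of a topological group is smooth if every vector has an open stabilizer. -/
def IsSmooth (ρ : Representation k G V) : Prop :=
  ∀ v : V, IsOpen {g : G | ρ g v = v}

variable [IsTopologicalGroup G] {K : Subgroup G}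

/-- The space `S(G, σ)` underlying `ind_K^G σ`: locally constant functions `f : G → W` with compact
support such that `f (x g) = σ(x) f(g)` for `x ∈ K`, `g ∈ G`. -/
def compactInd (σ : Representation k K W) : Submodule k (G → W) where
  carrier := {f | (∀ (x : K) (g : G), f (x * g) = σ x (f g)) ∧
    IsLocallyConstant f ∧ HasCompactSupport f}
  zero_mem' := ⟨by simp, IsLocallyConstant.const 0, HasCompactSupport.zero⟩
  add_mem' := by
    rintro f g ⟨hf, hf', hf''⟩ ⟨hg, hg', hg''⟩
    refine ⟨fun x y => by simp [hf, hg], hf'.comp₂ hg' (· + ·), hf''.add hg''⟩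
  smul_mem' := by
    rintro c f ⟨hf, hf', hf''⟩
    refine ⟨fun x y => by simp [hf], hf'.comp (c • ·), ?_⟩
    exact hf''.comp_left (g := (c • ·)) (smul_zero c)

/-- The action of `G` on `ind_K^G σ` by right translation: `(h · f)(g) = f(g h)`. -/
def compactIndRep (σ : Representation k K W) : Representation k G (compactInd σ) where
  toFun h :=
    { toFun := fun f => ⟨fun g => f.1 (g * h), fun x g => by
          change f.1 (x * g * h) = σ x (f.1 (g * h))
          rw [mul_assoc]; exact f.2.1 x _,
        f.2.2.1.comp_continuous (continuous_mul_const h),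
        f.2.2.2.comp_homeomorph (Homeomorph.mulRight h)⟩
      map_add' := fun _ _ => rfl
      map_smul' := fun _ _ => rfl }
  map_one' := by ext f g; simp
  map_mul' a b := by ext f g; simp [mul_assoc]

/-- The space `𝓗_K(σ)` of locally constant, compactly supported functions `φ : G → End(W)` with
`φ(x g y) = σ(x) φ(g) σ(y)` for `x, y ∈ K` and `g ∈ G`. -/
structure HeckeFunction (σ : Representation k K W) where
  /-- the underlying function -/
  toFun : G → Module.End k W
  biequivariant : ∀ (x y : K) (g : G), toFun (x * g * y) = σ x * toFun g * σ y
  locallyConstant : IsLocallyConstant toFun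
  compactSupport : HasCompactSupport toFun

namespace HeckeFunction

variable {σ : Representation k K W} (φ : HeckeFunction σ)

/-- The summand `φ(y) f(y⁻¹ g)` depends only on the coset `y K`. -/
theorem term_mul (f : compactInd σ) (g y : G) (x : K) :
    φ.toFun (y * x) (f.1 ((y * x)⁻¹ * g)) = φ.toFun y (f.1 (y⁻¹ * g)) := by
  have h1 := φ.biequivariant 1 x y
  have h2 := f.2.1 x⁻¹ (y⁻¹ * g)
  have h3 : ((y * x : G)⁻¹ * g) = ((x⁻¹ : K) : G) * (y⁻¹ * g) := by
    simp [mul_assoc]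
  rw [h3, h2]
  simp only [OneMemClass.coe_one, one_mul, map_one] at h1
  rw [h1, Module.End.mul_apply, ← Module.End.mul_apply (σ x), ← map_mul]
  simp

/-- The summand `φ(y) f(y⁻¹ g)` as a function of the coset `y K`. -/
def term (f : compactInd σ) (g : G) (q : G ⧸ K) : W :=
  Quotient.liftOn' q (fun y => φ.toFun y (f.1 (y⁻¹ * g))) fun a b hab => by
    rw [QuotientGroup.leftRel_apply] at hab
    have := φ.term_mul f g a ⟨_, hab⟩
    simpa using this.symm

theorem term_mk (f : compactInd σ) (g y : G) :
    φ.term f g (QuotientGroup.mk y) = φ.toFun y (f.1 (y⁻¹ * g)) := rfl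

theorem finite_cosets (hK : IsOpen (K : Set G)) :
    ((QuotientGroup.mk : G → G ⧸ K) '' (tsupport φ.toFun)).Finite := by
  have : DiscreteTopology (G ⧸ K) := QuotientGroup.discreteTopology hK
  exact (IsCompact.image φ.compactSupport QuotientGroup.continuous_mk).finite_of_discrete

theorem term_support (f : compactInd σ) (g : G) :
    Function.support (φ.term f g) ⊆ (QuotientGroup.mk : G → G ⧸ K) '' (tsupport φ.toFun) := by
  intro q hq
  induction q using QuotientGroup.induction_on with
  | H y =>
    refine ⟨y, subset_tsupport _ ?_, rfl⟩
    intro h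
    apply hq
    rw [term_mk, h]
    rfl

/-- The operator on `ind_K^G σ` attached to `φ ∈ 𝓗_K(σ)`, that is, convolution with `φ`:
`(T_φ f)(g) = ∑_{y K ∈ G / K} φ(y) f(y⁻¹ g)`, a finite sum because `K` is open and `φ` has
compact support. -/
def operator (hK : IsOpen (K : Set G)) :
    Representation.IntertwiningMap (compactIndRep σ) (compactIndRep σ) where
  toFun f := ⟨fun g => ∑ᶠ q : G ⧸ K, φ.term f g q, by
    classical
    set S := (φ.finite_cosets hK).toFinset with hS
    have hsum : ∀ g, (∑ᶠ q : G ⧸ K, φ.term f g q) = ∑ q ∈ S, φ.term f g q := fun g =>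
      finsum_eq_sum_of_support_subset _ (by rw [hS, Set.Finite.coe_toFinset]; exact φ.term_support f g)
    refine ⟨fun x g => ?_, ?_, ?_⟩
    · change (∑ᶠ q : G ⧸ K, φ.term f (x * g) q) = σ x (∑ᶠ q : G ⧸ K, φ.term f g q)
      rw [← finsum_comp_equiv (MulAction.toPerm (x : G) : Equiv.Perm (G ⧸ K))]
      have : ∀ q : G ⧸ K, φ.term f (x * g) ((x : G) • q) = σ x (φ.term f g q) := by
        intro q
        induction q using QuotientGroup.induction_on with
        | H y =>
          have h1 := φ.biequivariant x 1 y
          simp only [OneMemClass.coe_one, mul_one, map_one] at h1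
          rw [MulAction.Quotient.smul_mk, term_mk, term_mk, smul_eq_mul, h1]
          simp [mul_assoc]
      simp only [MulAction.toPerm_apply, this]
      exact ((σ x).toAddMonoidHom.map_finsum ((φ.finite_cosets hK).subset (φ.term_support f g))).symm
    · simp_rw [hsum]
      clear_value S
      clear hS hsum
      induction S using Finset.induction_on with
      | empty => exact IsLocallyConstant.const (0 : W)
      | insert q S hq ih =>
        simp_rw [Finset.sum_insert hq]
        refine IsLocallyConstant.comp₂ ?_ ih (· + ·)
        induction q using QuotientGroup.induction_on with
        | H y =>
          exact (f.2.2.1.comp_continuous (continuous_const_mul y⁻¹)).comp (φ.toFun y)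
    · simp_rw [hsum]
      clear_value S
      clear hS hsum
      induction S using Finset.induction_on with
      | empty => exact HasCompactSupport.zero
      | insert q S hq ih =>
        simp_rw [Finset.sum_insert hq]
        refine HasCompactSupport.add ?_ ih
        induction q using QuotientGroup.induction_on with
        | H y =>
          exact (f.2.2.2.comp_homeomorph (Homeomorph.mulLeft y⁻¹)).comp_left
            (g := φ.toFun y) (map_zero _)⟩
  map_add' f f' := by
    ext g
    have hfin : ∀ f, (Function.support (φ.term f g)).Finite := fun f =>
      (φ.finite_cosets hK).subset (φ.term_support f g)
    change (∑ᶠ q : G ⧸ K, φ.term (f + f') g q) =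
      (∑ᶠ q : G ⧸ K, φ.term f g q) + ∑ᶠ q : G ⧸ K, φ.term f' g q
    rw [← finsum_add_distrib (hfin f) (hfin f')]
    congr 1; ext q
    induction q using QuotientGroup.induction_on with
    | H y => simp [term_mk]
  map_smul' c f := by
    ext g
    change (∑ᶠ q : G ⧸ K, φ.term (c • f) g q) = c • (∑ᶠ q : G ⧸ K, φ.term f g q)
    rw [smul_finsum]
    congr 1; ext q
    induction q using QuotientGroup.induction_on with
    | H y => simp [term_mk]
  isIntertwining' h := by
    ext f g
    change (∑ᶠ q : G ⧸ K, φ.term (compactIndRep σ h f) g q) = ∑ᶠ q : G ⧸ K, φ.term f (g * h) q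
    congr 1; ext q
    induction q using QuotientGroup.induction_on with
    | H y => simp [term_mk, compactIndRep, mul_assoc]

theorem operator_apply (hK : IsOpen (K : Set G)) (f : compactInd σ) (g : G) :
    (φ.operator hK f).1 g = ∑ᶠ q : G ⧸ K, φ.term f g q := rfl

end HeckeFunction

open Classical in
/-- The function supported on `K a I` with value `σ(x) w` at `x a i` for `x ∈ K`, `i ∈ I`
(well defined when `w` is fixed by `K ∩ a I a⁻¹`). -/
def cosetFun (σ : Representation k K W) (I : Subgroup G) (a : G) (w : W) (g : G) : W :=
  if h : ∃ x : K, ∃ i ∈ I, g = x * a * i then σ h.choose w else 0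

theorem cosetFun_apply {σ : Representation k K W} {I : Subgroup G} {a : G} {w : W}
    (hw : ∀ x : K, a⁻¹ * x * a ∈ I → σ x w = w) (x : K) {i : G} (hi : i ∈ I) :
    cosetFun σ I a w (x * a * i) = σ x w := by
  have h : ∃ y : K, ∃ j ∈ I, (x * a * i : G) = y * a * j := ⟨x, i, hi, rfl⟩
  rw [cosetFun, dif_pos h]
  obtain ⟨j, hj, hxj⟩ := h.choose_spec
  set y := h.choose
  have : σ (y⁻¹ * x) w = w := by
    apply hw
    have : a⁻¹ * ((y⁻¹ * x : K) : G) * a = j * i⁻¹ := by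
      have h2 : (x : G) = y * a * j * i⁻¹ * a⁻¹ := by rw [← hxj]; group
      push_cast
      rw [h2]; group
    rw [this]
    exact I.mul_mem hj (I.inv_mem hi)
  rw [map_mul] at this
  conv_rhs => rw [show x = y * (y⁻¹ * x) by group, map_mul, Module.End.mul_apply, map_mul, this]

theorem cosetFun_of_notMem {σ : Representation k K W} {I : Subgroup G} {a : G} {w : W} {g : G}
    (hg : g ∉ DoubleCoset.doubleCoset a (K : Set G) (I : Set G)) : cosetFun σ I a w g = 0 := by
  rw [cosetFun, dif_neg]
  rintro ⟨x, i, hi, rfl⟩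
  exact hg (DoubleCoset.mem_doubleCoset.2 ⟨x, x.2, i, hi, rfl⟩)

theorem isOpen_doubleCoset {K I : Subgroup G} (hI : IsOpen (I : Set G)) (a : G) :
    IsOpen (DoubleCoset.doubleCoset a (K : Set G) (I : Set G)) := by
  exact IsOpen.mul_left hI

theorem isCompact_doubleCoset {K I : Subgroup G} (hK : IsCompact (K : Set G))
    (hI : IsCompact (I : Set G)) (a : G) :
    IsCompact (DoubleCoset.doubleCoset a (K : Set G) (I : Set G)) :=
  (hK.mul isCompact_singleton).mul hI

theorem cosetFun_mem [T2Space G] {σ : Representation k K W} {I : Subgroup G} {a : G} {w : W}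
    (hK : IsCompact (K : Set G)) (hIo : IsOpen (I : Set G)) (hIK : I ≤ K)
    (hw : ∀ x : K, a⁻¹ * x * a ∈ I → σ x w = w) : cosetFun σ I a w ∈ compactInd σ := by
  have hmul : ∀ (x : K) (g : G), ∀ i ∈ I,
      cosetFun σ I a w (x * g * i) = σ x (cosetFun σ I a w g) := by
    intro x g i hi
    by_cases hg : g ∈ DoubleCoset.doubleCoset a (K : Set G) (I : Set G)
    · obtain ⟨y, hy, j, hj, rfl⟩ := DoubleCoset.mem_doubleCoset.1 hg
      have h1 := cosetFun_apply hw ⟨y, hy⟩ hj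
      have h2 := cosetFun_apply hw (x * ⟨y, hy⟩) (I.mul_mem hj hi)
      rw [h1, ← Module.End.mul_apply, ← map_mul, ← h2]
      simp [mul_assoc]
    · rw [cosetFun_of_notMem hg, map_zero, cosetFun_of_notMem]
      intro h
      apply hg
      obtain ⟨y, hy, j, hj, h⟩ := DoubleCoset.mem_doubleCoset.1 h
      refine DoubleCoset.mem_doubleCoset.2 ⟨(x : G)⁻¹ * y, K.mul_mem (K.inv_mem x.2) hy, j * i⁻¹,
        I.mul_mem hj (I.inv_mem hi), ?_⟩
      have : g = (x : G)⁻¹ * (x * g * i) * i⁻¹ := by group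
      rw [this, h]; group
  refine ⟨fun x g => by simpa using hmul x g 1 I.one_mem, ?_, ?_⟩
  · rw [IsLocallyConstant.iff_eventually_eq]
    intro g
    have : {y : G | g⁻¹ * y ∈ I} ∈ nhds g :=
      (hIo.preimage (continuous_const_mul g⁻¹)).mem_nhds (by simp)
    filter_upwards [this] with y hy
    simpa using hmul 1 g _ hy
  · exact HasCompactSupport.intro (isCompact_doubleCoset hK hK a) fun g hg =>
      cosetFun_of_notMem fun h => hg (by
        obtain ⟨y, hy, j, hj, rfl⟩ := DoubleCoset.mem_doubleCoset.1 h
        exact DoubleCoset.mem_doubleCoset.2 ⟨y, hy, j, hIK hj, rfl⟩)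

open Classical in
/-- The function supported on `K a K` with value `σ(x) j σ(y)` at `x a y` for `x, y ∈ K`
(well defined when `j σ(y) = σ(a y a⁻¹) j` for all `y ∈ K ∩ a⁻¹ K a`). -/
def doubleFun (σ : Representation k K W) (a : G) (j : Module.End k W) (g : G) : Module.End k W :=
  if h : ∃ z : K × K, g = z.1 * a * z.2 then σ h.choose.1 * j * σ h.choose.2 else 0

theorem doubleFun_apply {σ : Representation k K W} {a : G} {j : Module.End k W}
    (hj : ∀ x y : K, (x : G) * a = a * y → σ x * j = j * σ y) (x y : K) :
    doubleFun σ a j (x * a * y) = σ x * j * σ y := by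
  have h : ∃ z : K × K, (x * a * y : G) = z.1 * a * z.2 := ⟨(x, y), rfl⟩
  rw [doubleFun, dif_pos h]
  have hz := h.choose_spec
  set z := h.choose
  have := hj (z.1⁻¹ * x) (z.2 * y⁻¹) (by
    push_cast
    calc (z.1 : G)⁻¹ * x * a = (z.1 : G)⁻¹ * (x * a * y) * (y : G)⁻¹ := by group
      _ = _ := by rw [hz]; group)
  calc σ z.1 * j * σ z.2 = σ z.1 * (j * σ (z.2 * y⁻¹)) * σ y := by
        simp only [mul_assoc, ← map_mul]; simp
    _ = σ x * j * σ y := by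
        rw [← this]; simp only [← mul_assoc, ← map_mul]; simp

theorem doubleFun_of_notMem {σ : Representation k K W} {a : G} {j : Module.End k W} {g : G}
    (hg : g ∉ DoubleCoset.doubleCoset a (K : Set G) (K : Set G)) : doubleFun σ a j g = 0 := by
  rw [doubleFun, dif_neg]
  rintro ⟨z, rfl⟩
  exact hg (DoubleCoset.mem_doubleCoset.2 ⟨z.1, z.1.2, z.2, z.2.2, rfl⟩)

/-- The element of `𝓗_K(σ)` supported on `K a K` with value `j` at `a`. -/
def HeckeFunction.ofDouble [T2Space G] (σ : Representation k K W) (a : G) (j : Module.End k W)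
    (hK : IsCompact (K : Set G)) (I : Subgroup G) (hIo : IsOpen (I : Set G)) (hIK : I ≤ K)
    (hjI : ∀ x : K, (x : G) ∈ I → j * σ x = j)
    (hj : ∀ x y : K, (x : G) * a = a * y → σ x * j = j * σ y) : HeckeFunction σ where
  toFun := doubleFun σ a j
  biequivariant x y g := by
    by_cases hg : g ∈ DoubleCoset.doubleCoset a (K : Set G) (K : Set G)
    · obtain ⟨u, hu, v, hv, rfl⟩ := DoubleCoset.mem_doubleCoset.1 hg
      have h1 := doubleFun_apply hj ⟨u, hu⟩ ⟨v, hv⟩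
      have h2 := doubleFun_apply hj (x * ⟨u, hu⟩) (⟨v, hv⟩ * y)
      simp only [map_mul] at h2
      rw [h1]
      simp only [mul_assoc, Subgroup.coe_mul] at h2 ⊢
      exact h2
    · rw [doubleFun_of_notMem hg, mul_zero, zero_mul, doubleFun_of_notMem]
      intro h
      apply hg
      obtain ⟨u, hu, v, hv, h⟩ := DoubleCoset.mem_doubleCoset.1 h
      refine DoubleCoset.mem_doubleCoset.2 ⟨(x : G)⁻¹ * u, K.mul_mem (K.inv_mem x.2) hu, v * (y : G)⁻¹,
        K.mul_mem hv (K.inv_mem y.2), ?_⟩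
      have : g = (x : G)⁻¹ * (x * g * y) * (y : G)⁻¹ := by group
      rw [this, h]; group
  locallyConstant := by
    have hKo : IsOpen (K : Set G) := Subgroup.isOpen_mono hIK hIo
    rw [IsLocallyConstant.iff_eventually_eq]
    intro g
    by_cases hg : g ∈ DoubleCoset.doubleCoset a (K : Set G) (K : Set G)
    · obtain ⟨u, hu, v, hv, rfl⟩ := DoubleCoset.mem_doubleCoset.1 hg
      have : {y : G | v * ((u * a * v)⁻¹ * y) * v⁻¹ ∈ I} ∈ nhds (u * a * v) :=
        (hIo.preimage (by fun_prop)).mem_nhds (by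
          change v * ((u * a * v)⁻¹ * (u * a * v)) * v⁻¹ ∈ I
          rw [inv_mul_cancel, mul_one, mul_inv_cancel]; exact I.one_mem)
      filter_upwards [this] with y hy
      have h1 := doubleFun_apply hj ⟨u, hu⟩ ⟨v, hv⟩
      obtain ⟨z, hz⟩ : ∃ z : K, (z : G) = v * ((u * a * v)⁻¹ * y) * v⁻¹ := ⟨⟨_, hIK hy⟩, rfl⟩
      have hzI : (z : G) ∈ I := hz ▸ hy
      have h2 := doubleFun_apply hj ⟨u, hu⟩ (z * ⟨v, hv⟩)
      rw [map_mul, ← mul_assoc, mul_assoc _ j, hjI z hzI, ← h1] at h2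
      rw [← h2, Subgroup.coe_mul, hz]
      congr 1
      group
    · have : {y : G | g⁻¹ * y ∈ K} ∈ nhds g :=
        (hKo.preimage (continuous_const_mul g⁻¹)).mem_nhds (by simp)
      filter_upwards [this] with y hy
      rw [doubleFun_of_notMem hg, doubleFun_of_notMem]
      intro h
      apply hg
      obtain ⟨u, hu, v, hv, h⟩ := DoubleCoset.mem_doubleCoset.1 h
      refine DoubleCoset.mem_doubleCoset.2 ⟨u, hu, v * (g⁻¹ * y)⁻¹,
        K.mul_mem hv (K.inv_mem hy), ?_⟩
      rw [← mul_assoc, ← h]; group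
  compactSupport := HasCompactSupport.intro (isCompact_doubleCoset hK hK a) fun _ hg =>
    doubleFun_of_notMem hg

section Invariants

variable (σ : Representation k K W) (I I' : Subgroup G)

/-- The subspace `σ^I` of vectors fixed by `I` (for `I ≤ K`). -/
abbrev fixedBy : Submodule k W :=
  Representation.invariants (σ.comp (I.subgroupOf K).subtype)

/-- The space `σ_{I'} = σ / σ(I')` of coinvariants of `I'` (for `I' ≤ K`), where `σ(I')` is spanned by
the vectors `σ(x) w - w` for `x ∈ I'`. -/
abbrev coinvBy : Type _ :=
  Representation.Coinvariants (σ.comp (I'.subgroupOf K).subtype)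

/-- The natural map `σ ↠ σ_{I'}`. -/
abbrev toCoinv : W →ₗ[k] coinvBy σ I' :=
  Representation.Coinvariants.mk (σ.comp (I'.subgroupOf K).subtype)

/-- The composition `σ^I ↪ σ ↠ σ_{I'}`. -/
def invToCoinv : fixedBy σ I →ₗ[k] coinvBy σ I' :=
  toCoinv σ I' ∘ₗ (fixedBy σ I).subtype

open Classical in
/-- The inverse `σ_{I'} → σ^I` of the composition `σ^I ↪ σ ↠ σ_{I'}` (and `0` if that map is
not an isomorphism). -/
def coinvToInv : coinvBy σ I' →ₗ[k] fixedBy σ I :=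
  if h : Function.Bijective (invToCoinv σ I I') then
    (LinearEquiv.ofBijective (invToCoinv σ I I') h).symm.toLinearMap
  else 0

/-- The endomorphism `σ ↠ σ_{I'} → σ^I ↪ σ` of the space of `σ`. -/
def jMap : Module.End k W :=
  (fixedBy σ I).subtype ∘ₗ coinvToInv σ I I' ∘ₗ toCoinv σ I'

variable {σ I I'}

theorem mem_fixedBy {w : W} : w ∈ fixedBy σ I ↔ ∀ x : K, (x : G) ∈ I → σ x w = w :=
  ⟨fun h x hx => h ⟨x, hx⟩, fun h x => h x.1 x.2⟩

theorem jMap_fixed (w : W) (x : K) (hx : (x : G) ∈ I) : σ x (jMap σ I I' w) = jMap σ I I' w :=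
  mem_fixedBy.1 (coinvToInv σ I I' (toCoinv σ I' w)).2 x hx

theorem toCoinv_apply (w : W) (x : K) (hx : (x : G) ∈ I') :
    toCoinv σ I' (σ x w) = toCoinv σ I' w :=
  Representation.Coinvariants.mk_self_apply (σ.comp (I'.subgroupOf K).subtype) ⟨x, hx⟩ w

theorem jMap_mul (x : K) (hx : (x : G) ∈ I') : jMap σ I I' * σ x = jMap σ I I' := by
  ext w
  simp only [jMap, Module.End.mul_apply, LinearMap.comp_apply, toCoinv_apply w x hx]

theorem jMap_comm (t : K) (h : ∀ x ∈ I, (t : G)⁻¹ * x * t ∈ I)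
    (h' : ∀ x ∈ I', (t : G) * x * (t : G)⁻¹ ∈ I') :
    σ t * jMap σ I I' = jMap σ I I' * σ t := by
  by_cases hb : Function.Bijective (invToCoinv σ I I')
  · have key : ∀ w : W, toCoinv σ I' (jMap σ I I' w) = toCoinv σ I' w := by
      intro w
      have := (LinearEquiv.ofBijective (invToCoinv σ I I') hb).apply_symm_apply (toCoinv σ I' w)
      simp only [jMap, coinvToInv, dif_pos hb]
      exact this
    -- the action of `t` on coinvariants
    have hlift : ∀ u v : W, toCoinv σ I' u = toCoinv σ I' v →
        toCoinv σ I' (σ t u) = toCoinv σ I' (σ t v) := by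
      let q : coinvBy σ I' →ₗ[k] coinvBy σ I' :=
        Representation.Coinvariants.lift _ (toCoinv σ I' ∘ₗ σ t) (by
          rintro ⟨x, hx⟩
          ext w
          have h1 := toCoinv_apply (σ := σ) (I' := I') (σ t w) (t * x * t⁻¹) (h' _ hx)
          rw [← Module.End.mul_apply, ← map_mul] at h1
          simp only [inv_mul_cancel_right, map_mul] at h1
          exact h1)
      intro u v huv
      have := congrArg q huv
      exact this
    ext w
    have hmem : σ t (jMap σ I I' w) ∈ fixedBy σ I := by
      rw [mem_fixedBy]
      intro x hx
      have h1 := jMap_fixed (σ := σ) (I := I) (I' := I') w (t⁻¹ * x * t) (h _ hx)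
      conv_rhs => rw [← h1]
      have h2 : ∀ (a b : K) (u : W), σ a (σ b u) = σ (a * b) u := fun a b u => by
        rw [map_mul, Module.End.mul_apply]
      rw [h2, h2]
      congr 2
      group
    have hmem' : jMap σ I I' (σ t w) ∈ fixedBy σ I :=
      (coinvToInv σ I I' (toCoinv σ I' (σ t w))).2
    have := @hb.1 ⟨_, hmem⟩ ⟨_, hmem'⟩ (by
      change toCoinv σ I' (σ t (jMap σ I I' w)) = toCoinv σ I' (jMap σ I I' (σ t w))
      rw [key, hlift _ _ (key w)])
    exact congrArg Subtype.val this
  · simp [jMap, coinvToInv, dif_neg hb]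

end Invariants

end General

/-- An unramified quadratic extension `E / F`, with its non-trivial automorphism and a chosen
uniformizer `ϖ` of `E` lying in `F` (for local fields of finite residue field, such a uniformizer
exists if and only if `E / F` is unramified). -/
structure UnramifiedQuadratic (F E : Type*) [NontriviallyNormedField F] [NormedField E]
    [NormedAlgebra F E] where
  finrank_eq : Module.finrank F E = 2
  /-- the non-trivial element of `Gal(E / F)` -/
  conj : E ≃ₐ[F] E
  conj_ne : conj ≠ AlgEquiv.refl
  /-- the uniformizer -/
  ϖ : F
  ϖ_ne_zero : ϖ ≠ 0
  norm_ϖ_lt_one : ‖ϖ‖ < 1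
  norm_le_norm_ϖ : ∀ x : E, ‖x‖ < 1 → ‖x‖ ≤ ‖ϖ‖

/-- The matrix `β` of the Hermitian form. -/
def betaMat (R : Type*) [Zero R] [One R] : Matrix (Fin 3) (Fin 3) R :=
  !![0, 0, 1; 0, 1, 0; 1, 0, 0]

/-- The two standard maximal compact open subgroups `K₀` and `K₁`. -/
inductive MaxCompact
  | K0
  | K1

namespace MaxCompact

/-- `K` consists of the `g ∈ G` whose `(i, j)` entry lies in `𝔭_E ^ (expK i j)`. -/
def expK : MaxCompact → Fin 3 → Fin 3 → ℤ
  | K0 => ![![0, 0, 0], ![0, 0, 0], ![0, 0, 0]]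
  | K1 => ![![0, 0, -1], ![1, 0, 0], ![1, 1, 0]]

/-- Exponents for the Iwahori subgroup `I_K`, the preimage in `K` of the upper triangular subgroup of
`Γ_K = K / K¹`. -/
def expI : MaxCompact → Fin 3 → Fin 3 → ℤ
  | K0 => ![![0, 0, 0], ![1, 0, 0], ![1, 1, 0]]
  | K1 => ![![0, 0, -1], ![1, 0, 0], ![2, 1, 0]]

/-- Exponents for the opposite Iwahori subgroup `I'_K`, the preimage in `K` of the lower triangular
subgroup of `Γ_K = K / K¹`. -/
def expI' : MaxCompact → Fin 3 → Fin 3 → ℤ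
  | K0 => ![![0, 1, 1], ![0, 0, 1], ![0, 0, 0]]
  | K1 => ![![0, 0, 0], ![1, 0, 0], ![1, 1, 0]]

end MaxCompact

/-- A condition on a matrix of exponents under which it defines a subgroup of `G`. -/
def Admissible (e : Fin 3 → Fin 3 → ℤ) : Prop :=
  (∀ i j l, e i j ≤ e i l + e l j) ∧ (∀ i, e i i = 0) ∧
    ∀ i j : Fin 3, e (Fin.rev j) (Fin.rev i) = e i j

/-- A further condition under which the elements of the subgroup are triangular modulo `𝔭_E`. -/
def Triangular (e : Fin 3 → Fin 3 → ℤ) : Prop :=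
  Admissible e ∧ ∀ i l, l ≠ i → 1 ≤ e i l + e l i

namespace MaxCompact

theorem admissible_expK (c : MaxCompact) : Admissible c.expK := by
  unfold Admissible; cases c <;> decide

theorem triangular_expI (c : MaxCompact) : Triangular c.expI := by
  unfold Triangular Admissible; cases c <;> decide

theorem triangular_expI' (c : MaxCompact) : Triangular c.expI' := by
  unfold Triangular Admissible; cases c <;> decide

end MaxCompact

namespace UnramifiedQuadratic

set_option linter.unusedSectionVars false

variable {F E : Type*} [NontriviallyNormedField F] [NormedField E] [NormedAlgebra F E]
  (D : UnramifiedQuadratic F E)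

/-- The Hermitian form `h(v, w) = vᵀ β w̄` on `E³`. -/
def herm (v w : Fin 3 → E) : E := v ⬝ᵥ (betaMat E *ᵥ fun i => D.conj (w i))

/-- The unitary group `G = U(2, 1)(E / F)`. -/
def G : Subgroup (GL (Fin 3) E) where
  carrier := {g | ∀ v w, D.herm (g.1 *ᵥ v) (g.1 *ᵥ w) = D.herm v w}
  one_mem' v w := by simp
  mul_mem' {a b} ha hb v w := by
    rw [Units.val_mul, ← Matrix.mulVec_mulVec, ← Matrix.mulVec_mulVec, ha, hb]
  inv_mem' {a} ha v w := by
    rw [← ha]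
    simp [Matrix.mulVec_mulVec]

/-- The underlying matrix of an element of `G`. -/
def mat (g : D.G) : Matrix (Fin 3) (Fin 3) E := g.1.1

theorem mat_mul (g h : D.G) : D.mat (g * h) = D.mat g * D.mat h := rfl

theorem mat_one : D.mat 1 = 1 := rfl

theorem mat_inj {g h : D.G} (H : D.mat g = D.mat h) : g = h :=
  Subtype.ext (Units.ext H)

theorem herm_mulVec (A : Matrix (Fin 3) (Fin 3) E) (v w : Fin 3 → E) :
    D.herm (A *ᵥ v) (A *ᵥ w) =
      v ⬝ᵥ ((Aᵀ * betaMat E * A.map D.conj) *ᵥ fun i => D.conj (w i)) := by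
  have : (fun i => D.conj ((A *ᵥ w) i)) = A.map D.conj *ᵥ fun i => D.conj (w i) := by
    ext i
    simp [Matrix.mulVec, dotProduct, map_sum]
  rw [herm, this, ← Matrix.mulVec_mulVec, ← Matrix.mulVec_mulVec, Matrix.dotProduct_mulVec v,
    Matrix.vecMul_transpose]

theorem mem_G_iff (g : GL (Fin 3) E) :
    g ∈ D.G ↔ g.1ᵀ * betaMat E * g.1.map D.conj = betaMat E := by
  constructor
  · intro h
    ext i j
    have := h (Pi.single i 1) (Pi.single j 1)
    rw [herm_mulVec, herm] at this
    have hs : (fun l => D.conj ((Pi.single j 1 : Fin 3 → E) l)) = Pi.single j 1 := by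
      ext l
      by_cases hl : l = j
      · subst hl; simp
      · simp [hl]
    rw [hs] at this
    simpa using this
  · intro h v w
    rw [herm_mulVec, h, herm]

theorem betaMat_mul_self : betaMat E * betaMat E = 1 := by
  ext i j
  fin_cases i <;> fin_cases j <;> simp [betaMat, Matrix.mul_apply, Fin.sum_univ_three]

theorem conj_conj (x : E) : D.conj (D.conj x) = x := by
  have : FiniteDimensional F E := Module.finite_of_finrank_pos (by rw [D.finrank_eq]; norm_num)
  classical
  have hcard : Fintype.card (E ≃ₐ[F] E) ≤ 2 := by
    rw [← D.finrank_eq]; exact AlgEquiv.card_le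
  have hc : D.conj ^ 2 = 1 := by
    have h1 : (1 : E ≃ₐ[F] E) ≠ D.conj := fun h => D.conj_ne h.symm
    by_contra h2
    have h3 : D.conj ≠ D.conj ^ 2 := by
      intro h
      rw [pow_two] at h
      exact h1 (mul_left_cancel (a := D.conj) (by rw [mul_one]; exact h))
    have := Finset.card_le_univ ({1, D.conj, D.conj ^ 2} : Finset (E ≃ₐ[F] E))
    rw [Finset.card_eq_three.2 ⟨1, D.conj, D.conj ^ 2, h1, fun h => h2 h.symm, h3, rfl⟩] at this
    omega
  have := congrArg (fun f : E ≃ₐ[F] E => f x) hc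
  simpa [pow_two] using this

theorem mat_inv_apply (g : D.G) (i j : Fin 3) :
    D.mat g⁻¹ i j = D.conj (D.mat g (Fin.rev j) (Fin.rev i)) := by
  have h := (D.mem_G_iff g.1).1 g.2
  have h1 : betaMat E * (D.mat g)ᵀ * betaMat E * (D.mat g).map D.conj = 1 := by
    rw [Matrix.mul_assoc, Matrix.mul_assoc, ← Matrix.mul_assoc _ (betaMat E)]
    exact (congrArg (betaMat E * ·) h).trans betaMat_mul_self
  -- conjugate the identity
  have h2 : (betaMat E * ((D.mat g).map D.conj)ᵀ * betaMat E) * D.mat g = 1 := by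
    have := congrArg (fun M : Matrix (Fin 3) (Fin 3) E => M.map D.conj) h1
    have hb : (betaMat E).map D.conj = betaMat E := by
      ext i j; fin_cases i <;> fin_cases j <;> simp [betaMat]
    have hcc : ((D.mat g).map D.conj).map D.conj = D.mat g := by
      ext i j; simp [conj_conj]
    have ho : (1 : Matrix (Fin 3) (Fin 3) E).map D.conj = 1 :=
      Matrix.map_one _ (map_zero _) (map_one _)
    have hm : ∀ A B : Matrix (Fin 3) (Fin 3) E,
        (A * B).map D.conj = A.map D.conj * B.map D.conj := fun A B =>
      Matrix.map_mul (f := (D.conj : E →+* E))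
    simp only [hm, hb, hcc, ho] at this
    exact this
  have h3 : D.mat g * D.mat g⁻¹ = 1 := by rw [← mat_mul, mul_inv_cancel, mat_one]
  have h4 : D.mat g⁻¹ = betaMat E * ((D.mat g).map D.conj)ᵀ * betaMat E := by
    calc D.mat g⁻¹ = (betaMat E * ((D.mat g).map D.conj)ᵀ * betaMat E) * D.mat g * D.mat g⁻¹ := by
          rw [h2, one_mul]
      _ = _ := by rw [mul_assoc, h3, mul_one]
  rw [h4]
  fin_cases i <;> fin_cases j <;>
    simp [betaMat, Matrix.mul_apply, Matrix.vecMul, dotProduct, Fin.sum_univ_three, Fin.rev]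

/-- The diagonal element `diag(a₀, a₁, a₂)` of `G`. -/
def diagElt (a : Fin 3 → E) (ha : ∀ i, a i * D.conj (a (Fin.rev i)) = 1) : D.G :=
  ⟨⟨Matrix.diagonal a, Matrix.diagonal fun i => D.conj (a (Fin.rev i)),
    by rw [Matrix.diagonal_mul_diagonal]; simp [ha],
    by rw [Matrix.diagonal_mul_diagonal]; simp [ha, mul_comm]⟩, by
      rw [mem_G_iff]
      have h0 := ha 0
      have h1 := ha 1
      have h2 := ha 2
      simp only [Fin.rev, Fin.isValue] at h0 h1 h2
      ext i j
      fin_cases i <;> fin_cases j <;>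
        simp_all [betaMat, Matrix.mul_apply, Matrix.diagonal_apply]⟩

theorem mat_diagElt (a : Fin 3 → E) (ha : ∀ i, a i * D.conj (a (Fin.rev i)) = 1) :
    D.mat (D.diagElt a ha) = Matrix.diagonal a := rfl

/-- The uniformizer `ϖ` as an element of `E`. -/
def pi : E := algebraMap F E D.ϖ

theorem conj_pi : D.conj D.pi = D.pi := D.conj.commutes _

theorem pi_ne_zero : D.pi ≠ 0 := by
  simpa [pi] using D.ϖ_ne_zero

theorem norm_pi : ‖D.pi‖ = ‖D.ϖ‖ := norm_algebraMap' E D.ϖ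

/-- The element `α = diag(ϖ⁻¹, 1, ϖ)` of `G`. -/
def alpha : D.G := D.diagElt ![D.pi⁻¹, 1, D.pi] (by
  have := D.pi_ne_zero
  intro i
  fin_cases i <;> simp [Fin.rev, conj_pi, this])

/-- The element `β` of `G`. -/
def beta : D.G :=
  ⟨⟨betaMat E, betaMat E, betaMat_mul_self, betaMat_mul_self⟩, by
    rw [mem_G_iff]
    ext i j
    fin_cases i <;> fin_cases j <;> simp [betaMat, Matrix.mul_apply, Fin.sum_univ_three]⟩

/-- The element `β' = β α⁻¹` of `G`. -/
def beta' : D.G := D.beta * D.alpha⁻¹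

/-- The element `β_K`: it is `β` for `K₀` and `β'` for `K₁`. -/
def betaK : MaxCompact → D.G
  | .K0 => D.beta
  | .K1 => D.beta'

end UnramifiedQuadratic

namespace UnramifiedQuadratic

set_option linter.unusedSectionVars false

variable {F E : Type*} [NontriviallyNormedField F] [NormedField E] [NormedAlgebra F E]
  (D : UnramifiedQuadratic F E)

theorem norm_pos : 0 < ‖D.ϖ‖ := norm_pos_iff.2 D.ϖ_ne_zero

theorem conj_norm_le [CompleteSpace F] (x : E) : ‖D.conj x‖ ≤ ‖x‖ := by
  have : FiniteDimensional F E := Module.finite_of_finrank_pos (by rw [D.finrank_eq]; norm_num)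
  let f : E →L[F] E := LinearMap.toContinuousLinearMap D.conj.toLinearMap
  have hf : ∀ y, ‖D.conj y‖ ≤ ‖f‖ * ‖y‖ := fun y => f.le_opNorm y
  by_contra! h
  have hx : 0 < ‖x‖ := by
    rw [norm_pos_iff]
    rintro rfl
    simp at h
  obtain ⟨n, hn⟩ := pow_unbounded_of_one_lt ‖f‖ ((one_lt_div hx).2 h)
  have := hf (x ^ n)
  rw [map_pow, norm_pow, norm_pow] at this
  rw [div_pow, lt_div_iff₀ (pow_pos hx n)] at hn
  linarith

variable [IsUltrametricDist E]

/-- The fractional ideal `𝔭_E ^ n`. -/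
def pE (n : ℤ) : AddSubgroup E where
  carrier := {x | ‖x‖ ≤ ‖D.ϖ‖ ^ n}
  zero_mem' := by
    change ‖(0 : E)‖ ≤ _
    rw [norm_zero]
    exact (zpow_pos D.norm_pos n).le
  add_mem' {a b} ha hb := (IsUltrametricDist.norm_add_le_max a b).trans (max_le ha hb)
  neg_mem' {a} ha := by
    change ‖-a‖ ≤ _
    rwa [norm_neg]

theorem mem_P {n : ℤ} {x : E} : x ∈ D.pE n ↔ ‖x‖ ≤ ‖D.ϖ‖ ^ n := Iff.rfl

theorem P_mono {m n : ℤ} (h : n ≤ m) {x : E} (hx : x ∈ D.pE m) : x ∈ D.pE n :=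
  le_trans (α := ℝ) hx (zpow_le_zpow_right_of_le_one₀ D.norm_pos D.norm_ϖ_lt_one.le h)

theorem mul_mem_P {m n : ℤ} {x y : E} (hx : x ∈ D.pE m) (hy : y ∈ D.pE n) : x * y ∈ D.pE (m + n) := by
  rw [mem_P] at *
  rw [norm_mul, zpow_add₀ D.norm_pos.ne']
  exact mul_le_mul hx hy (norm_nonneg _) (zpow_pos D.norm_pos m).le

theorem one_mem_P : (1 : E) ∈ D.pE 0 := by simp [mem_P]

theorem conj_mem_P [CompleteSpace F] {n : ℤ} {x : E} (hx : x ∈ D.pE n) : D.conj x ∈ D.pE n :=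
  (D.conj_norm_le x).trans hx

theorem isOpen_P (n : ℤ) : IsOpen (D.pE n : Set E) := by
  have : (D.pE n : Set E) = Metric.closedBall 0 (‖D.ϖ‖ ^ n) := by
    ext x; simp [mem_P]
  rw [this]
  exact IsUltrametricDist.isOpen_closedBall 0 (zpow_pos D.norm_pos n).ne'

variable [CompleteSpace F]

/-- The subgroup of the `g ∈ G` whose `(i, j)` entry lies in `𝔭_E ^ (e i j)`. -/
def congSub (e : Fin 3 → Fin 3 → ℤ) (he : Admissible e) : Subgroup D.G where
  carrier := {g | ∀ i j, D.mat g i j ∈ D.pE (e i j)}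
  one_mem' i j := by
    rw [mat_one]
    by_cases h : i = j
    · subst h
      rw [he.2.1, Matrix.one_apply_eq]; exact D.one_mem_P
    · rw [Matrix.one_apply_ne h]; exact zero_mem _
  mul_mem' {a b} ha hb i j := by
    rw [mat_mul, Matrix.mul_apply]
    exact sum_mem fun l _ => D.P_mono (he.1 i j l) (D.mul_mem_P (ha i l) (hb l j))
  inv_mem' {a} ha i j := by
    rw [mat_inv_apply, ← he.2.2]
    exact D.conj_mem_P (ha _ _)

/-- The subgroup of the `g ∈ G` whose `(i, j)` entry lies in `𝔭_E ^ (e i j)` and whose diagonal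
entries are congruent to `1` modulo `𝔭_E`. -/
def congSubOne (e : Fin 3 → Fin 3 → ℤ) (he : Triangular e) : Subgroup D.G where
  carrier := {g | (∀ i j, D.mat g i j ∈ D.pE (e i j)) ∧ ∀ i, D.mat g i i - 1 ∈ D.pE 1}
  one_mem' := ⟨(D.congSub e he.1).one_mem, fun i => by
    rw [mat_one, Matrix.one_apply_eq, sub_self]; exact zero_mem _⟩
  mul_mem' {a b} ha hb := ⟨(D.congSub e he.1).mul_mem ha.1 hb.1, fun i => by
    rw [mat_mul, Matrix.mul_apply, ← Finset.add_sum_erase _ _ (Finset.mem_univ i), add_sub_right_comm]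
    refine add_mem ?_ (sum_mem fun l hl => ?_)
    · have h1 := ha.2 i
      have h2 := D.mul_mem_P (ha.1 i i) (hb.2 i)
      rw [he.1.2.1, zero_add] at h2
      have : D.mat a i i * D.mat b i i - 1 =
        D.mat a i i * (D.mat b i i - 1) + (D.mat a i i - 1) := by ring
      rw [this]
      exact add_mem h2 h1
    · exact D.P_mono (he.2 i l (Finset.ne_of_mem_erase hl)) (D.mul_mem_P (ha.1 i l) (hb.1 l i))⟩
  inv_mem' {a} ha := ⟨(D.congSub e he.1).inv_mem ha.1, fun i => by
    rw [mat_inv_apply]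
    have := D.conj_mem_P (ha.2 (Fin.rev i))
    rwa [map_sub, map_one] at this⟩

theorem congSubOne_le (e : Fin 3 → Fin 3 → ℤ) (he : Triangular e) :
    D.congSubOne e he ≤ D.congSub e he.1 := fun _ h => h.1

theorem congSub_mono {e e' : Fin 3 → Fin 3 → ℤ} (he : Admissible e) (he' : Admissible e')
    (h : ∀ i j, e' i j ≤ e i j) : D.congSub e he ≤ D.congSub e' he' :=
  fun _ hg i j => D.P_mono (h i j) (hg i j)

/-- The maximal compact open subgroup `K ∈ {K₀, K₁}`. -/
def K (c : MaxCompact) : Subgroup D.G := D.congSub c.expK c.admissible_expK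

/-- The Iwahori subgroup `I_K` of `K`. -/
def Iw (c : MaxCompact) : Subgroup D.G := D.congSub c.expI c.triangular_expI.1

/-- The pro-`p` Iwahori subgroup `I_{1,K}`, the preimage in `K` of the unipotent radical of the upper
triangular subgroup of `Γ_K`. -/
def Iw1 (c : MaxCompact) : Subgroup D.G := D.congSubOne c.expI c.triangular_expI

/-- The opposite pro-`p` Iwahori subgroup `I'_{1,K}`, the preimage in `K` of the unipotent radical of
the lower triangular subgroup of `Γ_K`. -/
def Iw1' (c : MaxCompact) : Subgroup D.G := D.congSubOne c.expI' c.triangular_expI'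

theorem Iw_le_K (c : MaxCompact) : D.Iw c ≤ D.K c :=
  D.congSub_mono _ _ (by cases c <;> decide)

theorem Iw1_le_Iw (c : MaxCompact) : D.Iw1 c ≤ D.Iw c := D.congSubOne_le _ _

theorem Iw1_le_K (c : MaxCompact) : D.Iw1 c ≤ D.K c := (D.Iw1_le_Iw c).trans (D.Iw_le_K c)

theorem Iw1'_le_K (c : MaxCompact) : D.Iw1' c ≤ D.K c :=
  (D.congSubOne_le _ _).trans (D.congSub_mono _ _ (by cases c <;> decide))

theorem continuous_entry (i j : Fin 3) : Continuous fun g : D.G => D.mat g i j :=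
  (Units.continuous_val.comp continuous_subtype_val).matrix_elem i j

theorem isOpen_congSub (e : Fin 3 → Fin 3 → ℤ) (he : Admissible e) :
    IsOpen (D.congSub e he : Set D.G) := by
  have : (D.congSub e he : Set D.G) =
      ⋂ i, ⋂ j, (fun g : D.G => D.mat g i j) ⁻¹' (D.pE (e i j) : Set E) := by
    ext g; simp [congSub]
  rw [this]
  exact isOpen_iInter_of_finite fun i => isOpen_iInter_of_finite fun j =>
    (D.isOpen_P _).preimage (D.continuous_entry i j)

theorem isOpen_congSubOne (e : Fin 3 → Fin 3 → ℤ) (he : Triangular e) :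
    IsOpen (D.congSubOne e he : Set D.G) := by
  have : (D.congSubOne e he : Set D.G) = (D.congSub e he.1 : Set D.G) ∩
      ⋂ i, (fun g : D.G => D.mat g i i - 1) ⁻¹' (D.pE 1 : Set E) := by
    ext g; simp [congSubOne, congSub]
  rw [this]
  exact (D.isOpen_congSub _ _).inter (isOpen_iInter_of_finite fun i =>
    (D.isOpen_P _).preimage ((D.continuous_entry i i).sub continuous_const))

theorem isOpen_K (c : MaxCompact) : IsOpen (D.K c : Set D.G) := D.isOpen_congSub _ _

theorem isOpen_Iw1 (c : MaxCompact) : IsOpen (D.Iw1 c : Set D.G) := D.isOpen_congSubOne _ _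

theorem isOpen_Iw1' (c : MaxCompact) : IsOpen (D.Iw1' c : Set D.G) := D.isOpen_congSubOne _ _

theorem isClosed_G : IsClosed (D.G : Set (GL (Fin 3) E)) := by
  have : FiniteDimensional F E := Module.finite_of_finrank_pos (by rw [D.finrank_eq]; norm_num)
  have hc : Continuous D.conj := LinearMap.continuous_of_finiteDimensional D.conj.toLinearMap
  have : (D.G : Set (GL (Fin 3) E)) =
      {g | g.1ᵀ * betaMat E * g.1.map D.conj = betaMat E} := by
    ext g; exact D.mem_G_iff g
  rw [this]
  refine isClosed_eq ?_ continuous_const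
  exact ((Units.continuous_val.matrix_transpose).matrix_mul continuous_const).matrix_mul
    (Units.continuous_val.matrix_map hc)

theorem isCompact_congSub [ProperSpace F] (e : Fin 3 → Fin 3 → ℤ) (he : Admissible e) :
    IsCompact (D.congSub e he : Set D.G) := by
  have : FiniteDimensional F E := Module.finite_of_finrank_pos (by rw [D.finrank_eq]; norm_num)
  have : ProperSpace E := FiniteDimensional.proper F E
  let S : Set (Matrix (Fin 3) (Fin 3) E) :=
    Set.pi Set.univ fun i => Set.pi Set.univ fun j => Metric.closedBall 0 (‖D.ϖ‖ ^ e i j)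
  have hS : IsCompact S := isCompact_univ_pi fun i => isCompact_univ_pi fun j =>
    isCompact_closedBall _ _
  have hmem : ∀ g ∈ D.congSub e he, D.mat g ∈ S := by
    intro g hg i _ j _
    simpa [mem_P] using hg i j
  have hclosed : IsClosed (D.congSub e he : Set D.G) :=
    Subgroup.isClosed_of_isOpen _ (D.isOpen_congSub e he)
  have hemb := (Units.isClosedEmbedding_embedProduct (α := Matrix (Fin 3) (Fin 3) E)).comp
    D.isClosed_G.isClosedEmbedding_subtypeVal
  have hcomp := hemb.isCompact_preimage (hS.prod (hS.image MulOpposite.continuous_op))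
  refine hcomp.of_isClosed_subset hclosed ?_
  intro g hg
  exact ⟨hmem g hg, ⟨D.mat g⁻¹, hmem _ ((D.congSub e he).inv_mem hg), rfl⟩⟩

theorem isCompact_K [ProperSpace F] (c : MaxCompact) : IsCompact (D.K c : Set D.G) :=
  D.isCompact_congSub _ _

theorem mat_diagElt_mul (a : Fin 3 → E) (ha) (g : D.G) (i j : Fin 3) :
    D.mat (D.diagElt a ha * g) i j = a i * D.mat g i j := by
  rw [mat_mul, mat_diagElt, Matrix.diagonal_mul]

theorem mat_mul_diagElt (a : Fin 3 → E) (ha) (g : D.G) (i j : Fin 3) :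
    D.mat (g * D.diagElt a ha) i j = D.mat g i j * a j := by
  rw [mat_mul, mat_diagElt, Matrix.mul_diagonal]

/-- The exponents of the uniformizer in `α`. -/
def alphaExp : Fin 3 → ℤ := ![-1, 0, 1]

theorem mat_alpha : D.mat D.alpha = Matrix.diagonal fun i => D.pi ^ alphaExp i := by
  rw [alpha, mat_diagElt]
  congr 1
  ext i
  fin_cases i <;> simp [alphaExp]

theorem mat_alpha_inv : D.mat D.alpha⁻¹ = Matrix.diagonal fun i => D.pi ^ (-alphaExp i) := by
  ext i j
  rw [mat_inv_apply, mat_alpha]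
  fin_cases i <;> fin_cases j <;> simp [alphaExp, Fin.rev, conj_pi]

theorem mat_alpha_zpow (n : ℤ) :
    D.mat (D.alpha ^ n) = Matrix.diagonal fun i => D.pi ^ (alphaExp i * n) := by
  have hp := D.pi_ne_zero
  induction n using Int.induction_on with
  | zero => simp [mat_one]
  | succ n ih =>
    rw [_root_.zpow_add_one, mat_mul, ih, mat_alpha, Matrix.diagonal_mul_diagonal]
    congr 1; ext i
    rw [← zpow_add₀ hp, mul_add, mul_one]
  | pred n ih =>
    rw [_root_.zpow_sub_one, mat_mul, ih, mat_alpha_inv, Matrix.diagonal_mul_diagonal]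
    congr 1; ext i
    rw [← zpow_add₀ hp, mul_sub, mul_one, sub_eq_add_neg]

theorem zpow_mul_mem_P {m n : ℤ} {x : E} : D.pi ^ m * x ∈ D.pE n ↔ x ∈ D.pE (n - m) := by
  rw [mem_P, mem_P, norm_mul, norm_zpow, norm_pi, zpow_sub₀ D.norm_pos.ne',
    le_div_iff₀ (zpow_pos D.norm_pos m), mul_comm]

/-- Relation between the entries of `x` and `α ^ n x α ^ (-n)`. -/
theorem entry_of_alpha_conj {n : ℤ} {x y : D.G} (h : D.alpha ^ n * x = y * D.alpha ^ n)
    (i j : Fin 3) : D.mat x i j = D.pi ^ ((alphaExp j - alphaExp i) * n) * D.mat y i j := by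
  have hp := D.pi_ne_zero
  have := congrArg (fun g => D.mat g i j) h
  simp only [mat_mul, mat_alpha_zpow, Matrix.diagonal_mul, Matrix.mul_diagonal] at this
  rw [sub_mul, zpow_sub₀ hp, div_mul_eq_mul_div, eq_div_iff (zpow_ne_zero _ hp), mul_comm, this,
    mul_comm]

/-- An element that is lower triangular modulo `𝔭_E` has the same diagonal modulo `𝔭_E` as some
diagonal element of `G` with entries of norm one. -/
theorem exists_torus (c : MaxCompact) {g : D.G} (hg : g ∈ D.congSub c.expI' c.triangular_expI'.1) :
    ∃ (a : Fin 3 → E) (_ : ∀ i, a i * D.conj (a (Fin.rev i)) = 1), (∀ i, ‖a i‖ = 1) ∧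
      ∀ i, D.mat g i i - a i ∈ D.pE 1 := by
  set u : Fin 3 → E := fun i => D.mat g i i with hu
  have he := c.triangular_expI'
  have hu0 : ∀ i, u i ∈ D.pE 0 := fun i => he.1.2.1 i ▸ hg i i
  have hmod : ∀ i, u i * D.conj (u (Fin.rev i)) - 1 ∈ D.pE 1 := by
    intro i
    have h1 : (D.mat g * D.mat g⁻¹) i i = 1 := by
      rw [← mat_mul, mul_inv_cancel, mat_one, Matrix.one_apply_eq]
    rw [Matrix.mul_apply, ← Finset.add_sum_erase _ _ (Finset.mem_univ i)] at h1
    have h2 : u i * D.conj (u (Fin.rev i)) - 1 =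
        -∑ l ∈ Finset.univ.erase i, D.mat g i l * D.mat g⁻¹ l i := by
      rw [← h1, mat_inv_apply]; ring
    rw [h2]
    refine neg_mem (sum_mem fun l hl => ?_)
    exact D.P_mono (he.2 i l (Finset.ne_of_mem_erase hl))
      (D.mul_mem_P (hg i l) ((D.congSub _ he.1).inv_mem hg l i))
  have hnorm : ∀ i, ‖u i‖ = 1 := by
    intro i
    have h0 : ∀ i, ‖u i‖ ≤ 1 := fun i => by simpa [mem_P] using hu0 i
    refine le_antisymm (h0 i) ?_
    by_contra! hlt
    have h1 : ‖u i * D.conj (u (Fin.rev i))‖ < 1 := by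
      rw [norm_mul]
      exact mul_lt_one_of_nonneg_of_lt_one_left (norm_nonneg _) hlt
        ((D.conj_norm_le _).trans (h0 _))
    have h2 : ‖u i * D.conj (u (Fin.rev i)) - 1‖ < 1 := by
      have := hmod i
      rw [mem_P, zpow_one] at this
      exact this.trans_lt D.norm_ϖ_lt_one
    have h3 : (1 : E) = u i * D.conj (u (Fin.rev i)) - (u i * D.conj (u (Fin.rev i)) - 1) := by ring
    have h4 : ‖(1 : E)‖ < 1 := by
      rw [h3, sub_eq_add_neg]
      refine (IsUltrametricDist.norm_add_le_max _ _).trans_lt (max_lt h1 ?_)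
      rwa [norm_neg]
    simp at h4
  have hne : ∀ i, u i ≠ 0 := fun i h => by
    have := hnorm i
    rw [h, norm_zero] at this
    exact zero_ne_one this
  have hcne : D.conj (u 0) ≠ 0 := by simpa using hne 0
  have hcnorm : ‖D.conj (u 0)‖ = 1 := by
    refine le_antisymm ((D.conj_norm_le _).trans (hnorm 0).le) ?_
    have := D.conj_norm_le (D.conj (u 0))
    rwa [conj_conj, hnorm] at this
  -- the determinant
  set d := (D.mat g).det with hd
  have hdd : d * D.conj d = 1 := by
    have h1 := congrArg Matrix.det ((D.mem_G_iff g.1).1 g.2)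
    have hb : (betaMat E).det * (betaMat E).det = 1 := by
      rw [← Matrix.det_mul, betaMat_mul_self, Matrix.det_one]
    have hdet : ((g.1.1).map D.conj).det = D.conj d := by
      rw [hd]; exact (RingHom.map_det (D.conj : E →+* E) _).symm
    rw [Matrix.det_mul, Matrix.det_mul, Matrix.det_transpose, hdet] at h1
    have h2 : (g.1.1).det = d := rfl
    rw [h2] at h1
    calc d * D.conj d = d * (betaMat E).det * D.conj d * (betaMat E).det := by
          linear_combination (-d * D.conj d) * hb
      _ = 1 := by rw [h1, hb]
  have hdnorm : ‖d‖ = 1 := by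
    have h1 : ‖d‖ * ‖D.conj d‖ = 1 := by rw [← norm_mul, hdd, norm_one]
    have h2 := D.conj_norm_le d
    have h3 := D.conj_norm_le (D.conj d)
    rw [conj_conj] at h3
    have h4 : ‖D.conj d‖ = ‖d‖ := le_antisymm h2 h3
    rw [h4] at h1
    nlinarith [norm_nonneg d]
  have hδ : d - u 0 * u 1 * u 2 ∈ D.pE 1 := by
    rw [hd, Matrix.det_fin_three]
    have key : ∀ i j l i' j' l' : Fin 3,
        1 ≤ c.expI' i i' + c.expI' j j' + c.expI' l l' →
        D.mat g i i' * D.mat g j j' * D.mat g l l' ∈ D.pE 1 := fun i j l i' j' l' h =>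
      D.P_mono h (D.mul_mem_P (D.mul_mem_P (hg _ _) (hg _ _)) (hg _ _))
    have e1 := key 0 1 2 0 2 1 (by cases c <;> decide)
    have e2 := key 0 1 2 1 0 2 (by cases c <;> decide)
    have e3 := key 0 1 2 1 2 0 (by cases c <;> decide)
    have e4 := key 0 1 2 2 0 1 (by cases c <;> decide)
    have e5 := key 0 1 2 2 1 0 (by cases c <;> decide)
    have := sub_mem (add_mem (sub_mem (neg_mem e1) e2) (add_mem e3 e4)) e5
    convert this using 1
    simp only [hu]
    ring
  have hinv : ∀ {x y : E}, ‖y‖ = 1 → x ∈ D.pE 1 → x / y ∈ D.pE 1 := by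
    intro x y hy hx
    rw [mem_P, norm_div, hy, div_one]; exact hx
  have h2c : u 2 * D.conj (u 0) - 1 ∈ D.pE 1 := hmod 2
  refine ⟨![u 0, d * D.conj (u 0) / u 0, (D.conj (u 0))⁻¹], ?_, ?_, ?_⟩
  · have hu0ne := hne 0
    intro i
    fin_cases i
    · simp [Fin.rev, conj_conj, hu0ne]
    · simp only [Fin.rev]
      simp only [Fin.mk_one, Matrix.cons_val_one, Matrix.cons_val_zero, map_div₀, map_mul, conj_conj]
      simp only [Nat.reduceAdd, Nat.reduceSub, Fin.mk_one, Matrix.cons_val_one, Matrix.cons_val_zero,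
        map_div₀, map_mul, conj_conj]
      field_simp
      exact hdd
    · simp [Fin.rev, hu0ne]
  · intro i
    fin_cases i
    · simpa using hnorm 0
    · simp [hdnorm, hnorm, hcnorm]
    · simp [hcnorm]
  · intro i
    fin_cases i
    · simp [hu, zero_mem]
    · change u 1 - d * D.conj (u 0) / u 0 ∈ D.pE 1
      have : u 1 - d * D.conj (u 0) / u 0 =
          (-(u 0 * u 1 * (u 2 * D.conj (u 0) - 1)) - (d - u 0 * u 1 * u 2) * D.conj (u 0)) / u 0 := by
        have := hne 0
        field_simp
        ring
      rw [this]
      refine hinv (hnorm 0) (sub_mem (neg_mem ?_) ?_)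
      · simpa using D.mul_mem_P (D.mul_mem_P (hu0 0) (hu0 1)) h2c
      · simpa using D.mul_mem_P hδ (D.conj_mem_P (hu0 0))
    · change u 2 - (D.conj (u 0))⁻¹ ∈ D.pE 1
      have : u 2 - (D.conj (u 0))⁻¹ = (u 2 * D.conj (u 0) - 1) / D.conj (u 0) := by
        field_simp
      rw [this]
      exact hinv hcnorm h2c

theorem norm_one_mul_mem_P {a x : E} (ha : ‖a‖ = 1) {n : ℤ} : a * x ∈ D.pE n ↔ x ∈ D.pE n := by
  rw [mem_P, mem_P, norm_mul, ha, one_mul]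

theorem diagElt_inv_mul_mem {e : Fin 3 → Fin 3 → ℤ} (he : Triangular e) {g : D.G}
    (hg : g ∈ D.congSub e he.1) {a : Fin 3 → E} (ha) (hn : ∀ i, ‖a i‖ = 1)
    (hga : ∀ i, D.mat g i i - a i ∈ D.pE 1) : (D.diagElt a ha)⁻¹ * g ∈ D.congSubOne e he := by
  have h : ∀ i j, D.mat g i j = a i * D.mat ((D.diagElt a ha)⁻¹ * g) i j := by
    intro i j
    rw [← D.mat_diagElt_mul a ha, mul_inv_cancel_left]
  refine ⟨fun i j => ?_, fun i => ?_⟩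
  · rw [← D.norm_one_mul_mem_P (hn i), ← h]; exact hg i j
  · rw [← D.norm_one_mul_mem_P (hn i), mul_sub, ← h, mul_one]; exact hga i

theorem diagElt_inv_conj_mem {e : Fin 3 → Fin 3 → ℤ} (he : Triangular e) {g : D.G}
    (hg : g ∈ D.congSubOne e he) {a : Fin 3 → E} (ha) (hn : ∀ i, ‖a i‖ = 1) :
    (D.diagElt a ha)⁻¹ * g * D.diagElt a ha ∈ D.congSubOne e he := by
  have h : ∀ i j, a i * D.mat ((D.diagElt a ha)⁻¹ * g * D.diagElt a ha) i j =
      a j * D.mat g i j := by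
    intro i j
    rw [← D.mat_diagElt_mul a ha, mul_comm (a j), ← D.mat_mul_diagElt a ha]
    refine congrArg (fun h => D.mat h i j) ?_
    group
  refine ⟨fun i j => ?_, fun i => ?_⟩
  · rw [← D.norm_one_mul_mem_P (hn i), h, D.norm_one_mul_mem_P (hn j)]; exact hg.1 i j
  · rw [← D.norm_one_mul_mem_P (hn i), mul_sub, h, ← mul_sub, D.norm_one_mul_mem_P (hn i)]
    exact hg.2 i

theorem diagElt_conj_mem {e : Fin 3 → Fin 3 → ℤ} (he : Triangular e) {g : D.G}
    (hg : g ∈ D.congSubOne e he) {a : Fin 3 → E} (ha) (hn : ∀ i, ‖a i‖ = 1) :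
    D.diagElt a ha * g * (D.diagElt a ha)⁻¹ ∈ D.congSubOne e he := by
  have h : ∀ i j, a j * D.mat (D.diagElt a ha * g * (D.diagElt a ha)⁻¹) i j =
      a i * D.mat g i j := by
    intro i j
    rw [mul_comm (a j), ← D.mat_mul_diagElt a ha, ← D.mat_diagElt_mul a ha]
    refine congrArg (fun h => D.mat h i j) ?_
    group
  refine ⟨fun i j => ?_, fun i => ?_⟩
  · rw [← D.norm_one_mul_mem_P (hn j), h, D.norm_one_mul_mem_P (hn i)]; exact hg.1 i j
  · rw [← D.norm_one_mul_mem_P (hn i), mul_sub, h, ← mul_sub, D.norm_one_mul_mem_P (hn i)]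
    exact hg.2 i

theorem diagElt_mem_K (c : MaxCompact) {a : Fin 3 → E} (ha) (hn : ∀ i, ‖a i‖ = 1) :
    D.diagElt a ha ∈ D.K c := by
  intro i j
  rw [mat_diagElt]
  by_cases h : i = j
  · subst h
    rw [Matrix.diagonal_apply_eq, c.admissible_expK.2.1, mem_P, hn, zpow_zero]
  · rw [Matrix.diagonal_apply_ne _ h]; exact zero_mem _

section Weight

variable {k W : Type*} [Field k] [AddCommGroup W] [Module k W] {c : MaxCompact}
  (σ : Representation k (D.K c) W)

/-- The endomorphism `j_σ`, through the inverse of `σ^{I_{1,K}} ↪ σ ↠ σ_{I'_{1,K}}`. -/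
def jSigma : Module.End k W := jMap σ (D.Iw1 c) (D.Iw1' c)

theorem jSigma_alpha (x y : D.K c) (h : (x : D.G) * D.alpha = D.alpha * y) :
    σ x * D.jSigma σ = D.jSigma σ * σ y := by
  have h1 : D.alpha ^ (1 : ℤ) * (y : D.G) = x * D.alpha ^ (1 : ℤ) := by simpa using h.symm
  have hent := D.entry_of_alpha_conj h1
  have hy : (y : D.G) ∈ D.congSub c.expI' c.triangular_expI'.1 := by
    intro i j
    have htab : c.expI' i j ≤ c.expK i j ∨
        c.expI' i j ≤ c.expK i j + (alphaExp j - alphaExp i) * 1 := by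
      revert i j; cases c <;> decide
    rcases htab with h2 | h2
    · exact D.P_mono h2 (y.2 i j)
    · rw [hent, zpow_mul_mem_P]
      exact D.P_mono (by omega) (x.2 i j)
  have hx : (x : D.G) ∈ D.congSub c.expI c.triangular_expI.1 := by
    intro i j
    have htab : c.expI i j ≤ c.expK i j ∨
        c.expI i j + (alphaExp j - alphaExp i) * 1 ≤ c.expK i j := by
      revert i j; cases c <;> decide
    rcases htab with h2 | h2
    · exact D.P_mono h2 (x.2 i j)
    · have h3 := D.P_mono h2 (y.2 i j)
      rw [hent, zpow_mul_mem_P] at h3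
      simpa using h3
  have hdiag : ∀ i, D.mat y i i = D.mat x i i := fun i => by
    rw [hent, sub_self, zero_mul, zpow_zero, one_mul]
  obtain ⟨a, ha, hn, hya⟩ := D.exists_torus c hy
  obtain ⟨t, ht⟩ : ∃ t : D.K c, (t : D.G) = D.diagElt a ha := ⟨⟨_, D.diagElt_mem_K c ha hn⟩, rfl⟩
  have hty : ((t⁻¹ * y : D.K c) : D.G) ∈ D.Iw1' c := by
    push_cast; rw [ht]
    exact D.diagElt_inv_mul_mem c.triangular_expI' hy ha hn hya
  have htx : ((t⁻¹ * x : D.K c) : D.G) ∈ D.Iw1 c := by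
    push_cast; rw [ht]
    exact D.diagElt_inv_mul_mem c.triangular_expI hx ha hn fun i => hdiag i ▸ hya i
  have hcomm : σ t * D.jSigma σ = D.jSigma σ * σ t := jMap_comm t
    (fun g hg => by rw [ht]; exact D.diagElt_inv_conj_mem c.triangular_expI hg ha hn)
    (fun g hg => by rw [ht]; exact D.diagElt_conj_mem c.triangular_expI' hg ha hn)
  have hfix : σ (t⁻¹ * x) * D.jSigma σ = D.jSigma σ := by
    ext w
    exact jMap_fixed w _ htx
  have hkill : D.jSigma σ * σ (t⁻¹ * y) = D.jSigma σ := jMap_mul _ hty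
  calc σ x * D.jSigma σ = σ t * (σ (t⁻¹ * x) * D.jSigma σ) := by
        rw [← mul_assoc, ← map_mul, mul_inv_cancel_left]
    _ = σ t * (D.jSigma σ * σ (t⁻¹ * y)) := by rw [hfix, hkill]
    _ = D.jSigma σ * σ y := by
        rw [← mul_assoc, hcomm, mul_assoc, ← map_mul, mul_inv_cancel_left]

/-- The element `φ` of `𝓗_K(σ)` supported on `K α K` with `φ(α) = j_σ`. -/
def heckePhi [ProperSpace F] : HeckeFunction σ :=
  HeckeFunction.ofDouble σ D.alpha (D.jSigma σ) (D.isCompact_K c) (D.Iw1' c) (D.isOpen_Iw1' c)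
    (D.Iw1'_le_K c) (fun x hx => jMap_mul x hx) (D.jSigma_alpha σ)

/-- The spherical Hecke operator `T` on `ind_K^G σ`, a `G`-endomorphism. -/
def heckeT [ProperSpace F] : Representation.IntertwiningMap (compactIndRep σ) (compactIndRep σ) :=
  (D.heckePhi σ).operator (D.isOpen_K c)

end Weight

/-- The exponents of the uniformizer in the antidiagonal matrix `β_K`. -/
def betaExp : MaxCompact → Fin 3 → ℤ
  | .K0 => ![0, 0, 0]
  | .K1 => ![-1, 0, 1]

theorem mat_betaK (c : MaxCompact) (i j : Fin 3) :
    D.mat (D.betaK c) i j = if j = Fin.rev i then D.pi ^ betaExp c i else 0 := by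
  cases c
  · change betaMat E i j = _
    fin_cases i <;> fin_cases j <;> simp [betaMat, betaExp, Fin.rev]
  · change D.mat (D.beta * D.alpha⁻¹) i j = _
    rw [mat_mul, mat_alpha_inv, Matrix.mul_diagonal]
    change betaMat E i j * _ = _
    fin_cases i <;> fin_cases j <;> simp [betaMat, betaExp, alphaExp, Fin.rev]

theorem betaK_mem_K (c : MaxCompact) : D.betaK c ∈ D.K c := by
  intro i j
  rw [mat_betaK]
  split_ifs with h
  · subst h
    rw [mem_P, norm_zpow, norm_pi]
    refine zpow_le_zpow_right_of_le_one₀ D.norm_pos D.norm_ϖ_lt_one.le ?_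
    revert i; cases c <;> decide
  · exact zero_mem _

theorem betaK_conj_mem (c : MaxCompact) {x : D.G} (hx : x ∈ D.Iw1' c) :
    (D.betaK c)⁻¹ * x * D.betaK c ∈ D.Iw1 c := by
  have hp := D.pi_ne_zero
  set z := (D.betaK c)⁻¹ * x * D.betaK c with hz
  have h1 : D.betaK c * z = x * D.betaK c := by rw [hz]; group
  have hent : ∀ i j, D.mat z i j =
      D.pi ^ (betaExp c (Fin.rev j) - betaExp c (Fin.rev i)) *
        D.mat x (Fin.rev i) (Fin.rev j) := by
    intro i j
    have h2 := congrArg (fun g => D.mat g (Fin.rev i) j) h1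
    simp only [mat_mul, Matrix.mul_apply, mat_betaK, ite_mul, zero_mul, mul_ite, mul_zero,
      Finset.sum_ite_eq', Finset.mem_univ, if_true, Fin.rev_rev] at h2
    have h3 : ∀ l : Fin 3, (j = Fin.rev l) ↔ (l = Fin.rev j) := fun l => by
      constructor <;> rintro rfl <;> simp
    simp only [h3, Finset.sum_ite_eq', Finset.mem_univ, if_true] at h2
    rw [zpow_sub₀ hp, div_mul_eq_mul_div, eq_div_iff (zpow_ne_zero _ hp), mul_comm, h2, mul_comm]
  refine ⟨fun i j => ?_, fun i => ?_⟩
  · rw [hent, zpow_mul_mem_P]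
    refine D.P_mono ?_ (hx.1 _ _)
    revert i j; cases c <;> decide
  · rw [hent, sub_self, zpow_zero, one_mul]
    exact hx.2 _

section Functions

variable {k W : Type*} [Field k] [AddCommGroup W] [Module k W] {c : MaxCompact}
  (σ : Representation k (D.K c) W)

/-- The value of `f_n` at `α ^ (-n)`: it is `β_K v₀` for `n > 0` and `v₀` for `n ≤ 0`. -/
def fValue (v₀ : fixedBy σ (D.Iw1 c)) (n : ℤ) : W :=
  if 0 < n then σ ⟨D.betaK c, D.betaK_mem_K c⟩ v₀ else v₀

theorem fValue_fixed (v₀ : fixedBy σ (D.Iw1 c)) (n : ℤ) (x : D.K c)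
    (hx : (D.alpha ^ (-n))⁻¹ * (x : D.G) * D.alpha ^ (-n) ∈ D.Iw1 c) :
    σ x (D.fValue σ v₀ n) = D.fValue σ v₀ n := by
  obtain ⟨y, hy⟩ : ∃ y, y = (D.alpha ^ (-n))⁻¹ * (x : D.G) * D.alpha ^ (-n) := ⟨_, rfl⟩
  rw [← hy] at hx
  have h1 : D.alpha ^ n * (x : D.G) = y * D.alpha ^ n := by rw [hy]; group
  have hent := D.entry_of_alpha_conj h1
  have hdiag : ∀ i, D.mat x i i = D.mat y i i := fun i => by
    rw [hent, sub_self, zero_mul, zpow_zero, one_mul]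
  unfold fValue
  split_ifs with hn
  · have hxI : (x : D.G) ∈ D.Iw1' c := by
      refine ⟨fun i j => ?_, fun i => by rw [hdiag]; exact hx.2 i⟩
      have htab : c.expI' i j ≤ c.expK i j ∨ (0 ≤ alphaExp j - alphaExp i ∧
          c.expI' i j ≤ c.expI i j + (alphaExp j - alphaExp i)) := by
        revert i j; cases c <;> decide
      rcases htab with h2 | ⟨h2, h3⟩
      · exact D.P_mono h2 (x.2 i j)
      · rw [hent, zpow_mul_mem_P]
        have h4 := le_mul_of_one_le_right h2 hn
        exact D.P_mono (by linarith) (hx.1 i j)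
    obtain ⟨b, hb⟩ : ∃ b : D.K c, b = ⟨D.betaK c, D.betaK_mem_K c⟩ := ⟨_, rfl⟩
    have hbI : ((b⁻¹ * x * b : D.K c) : D.G) ∈ D.Iw1 c := by
      rw [hb]; exact D.betaK_conj_mem c hxI
    rw [← hb]
    have h2 := mem_fixedBy.1 v₀.2 _ hbI
    have h3 : ∀ (a b : D.K c) (u : W), σ a (σ b u) = σ (a * b) u := fun a b u => by
      rw [map_mul, Module.End.mul_apply]
    conv_rhs => rw [← h2]
    rw [h3, h3]
    congr 2
    group
  · refine mem_fixedBy.1 v₀.2 x ⟨fun i j => ?_, fun i => by rw [hdiag]; exact hx.2 i⟩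
    have htab : c.expI i j ≤ c.expK i j ∨ alphaExp j - alphaExp i ≤ 0 := by
      revert i j; cases c <;> decide
    rcases htab with h2 | h2
    · exact D.P_mono h2 (x.2 i j)
    · rw [hent, zpow_mul_mem_P]
      have h4 := mul_nonneg_of_nonpos_of_nonpos h2 (not_lt.1 hn)
      exact D.P_mono (by linarith) (hx.1 i j)

/-- The `I_{1,K}`-invariant function `f_n`, supported on `K α ^ (-n) I_{1,K}`, with
`f_n(α ^ (-n)) = β_K v₀` for `n > 0` and `f_n(α ^ (-n)) = v₀` for `n ≤ 0`. -/
def fFun [ProperSpace F] (v₀ : fixedBy σ (D.Iw1 c)) (n : ℤ) : compactInd σ :=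
  ⟨cosetFun σ (D.Iw1 c) (D.alpha ^ (-n)) (D.fValue σ v₀ n),
    cosetFun_mem (D.isCompact_K c) (D.isOpen_Iw1 c) (D.Iw1_le_K c) (D.fValue_fixed σ v₀ n)⟩

/-- The subspace of the functions in `ind_K^G σ` supported in the coset `K a I_K`. -/
def supportedOn (a : D.G) : Submodule k (compactInd σ) where
  carrier := {f | ∀ g : D.G,
    g ∉ DoubleCoset.doubleCoset a (D.K c : Set D.G) (D.Iw c : Set D.G) → f.1 g = 0}
  zero_mem' _ _ := rfl
  add_mem' {f f'} hf hf' g hg := by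
    change f.1 g + f'.1 g = 0
    rw [hf g hg, hf' g hg, add_zero]
  smul_mem' r f hf g hg := by
    change r • f.1 g = 0
    rw [hf g hg, smul_zero]

/-- `R⁺_n(σ)`: the functions supported in `K α ^ n I_K`. -/
def Rplus (n : ℕ) : Submodule k (compactInd σ) := D.supportedOn σ (D.alpha ^ n)

/-- `R⁻_n(σ)`: the functions supported in `K α ^ (-(n + 1)) I_K`. -/
def Rminus (n : ℕ) : Submodule k (compactInd σ) := D.supportedOn σ (D.alpha ^ (-((n : ℤ) + 1)))

/-- `I⁺(σ)`, the sum of the `R⁺_n(σ)` for `n ≥ 0`. -/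
def Iplus : Submodule k (compactInd σ) := ⨆ n : ℕ, D.Rplus σ n

/-- `I⁻(σ)`, the sum of the `R⁻_n(σ)` for `n ≥ 0`. -/
def Iminus : Submodule k (compactInd σ) := ⨆ n : ℕ, D.Rminus σ n

end Functions

end UnramifiedQuadratic

end U21
end

/-! Put $d=\deg P$ and $\Phi=P(T)(\alpha^d f_0)$, which is `shiftedAeval`. Since $\iota$ kills the
image of $P(T)$, it kills $\Phi$ and all its translates. So it suffices to change $f_0$ and $f_1$ by
multiples of translates of $\Phi$ so that they land in $I^-(\sigma)$ and $I^+(\sigma)$.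

Each $T$ enlarges supports by one factor $K\alpha K$. Measured by powers of $\varpi$ in the
denominators, $\alpha^m$ is out of reach of $s$ such factors when $|m|>s$. Hence $T^s(\alpha^d f_0)$
vanishes at $\alpha^n$ unless $|n+d|\le s$ (`heckeT_pow_support`). For $n\ge0$ and $s\le d$ only
$n=0$, $s=d$ survives, and there a single coset contributes at every step, giving $j_\sigma^d
v_0=v_0$ (`heckeT_pow_apply`). So $\Phi(\alpha^n)=0$ for $n>0$, and $\Phi(1)$ is the leading
coefficient of $P$ times $v_0$.

Moreover $\Phi$ is invariant under the upper unipotent elements of $I_{1,K}$, and for $n\ge0$ every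
element of $\alpha^n I_K$ lies in $K\alpha^n u$ for such a $u$. After division by the leading
coefficient, $f_0-\Phi$ therefore vanishes on $K\alpha^nI_K$ for all $n\ge0$, and $G=\bigcup_n
K\alpha^nI_K$ puts it in $I^-(\sigma)$. Translating $\Phi$ by $\alpha\beta_K$ reverses the
direction, because $\beta_K$ inverts $\alpha$, and treats $f_1$ in the same way. Finally $f_0$ is
supported in $K$, so it lies in $I^+(\sigma)$, and it generates the induced representation
(`compactInd_eq_top`), so $\iota(f_0)\ne0$.

The identity $j_\sigma v_0=v_0$ rests on the bijectivity of $\sigma^{I_{1,K}}\to\sigma_{I'_{1,K}}$.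
This concerns the finite group $\Gamma_K$ of relative rank one and is deduced from its Bruhat
decomposition in `RankOneDatum.invToCoinv_bijective`. -/

noncomputable section
namespace U21

open Matrix

/-! ### Fixed vectors of finite $p$-groups in characteristic $p$. -/

section FiniteImage

variable {k H M : Type*} [Field k] [Group H] [AddCommGroup M] [Module k M]

/-- A finite `p`-group acting on a non-zero `p`-torsion group fixes a non-zero element. -/
theorem exists_ne_zero_fixed_of_isPGroup {p : ℕ} [Fact p.Prime] {Q X : Type*} [Group Q] [Finite Q]
    (hQ : IsPGroup p Q) [AddCommGroup X] [DistribMulAction Q X] (hX : ∀ x : X, p • x = 0)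
    {x : X} (hx : x ≠ 0) : ∃ y : X, y ≠ 0 ∧ ∀ g : Q, g • y = y := by
  have hp : p.Prime := Fact.out
  set S : Set X := Set.range fun g : Q => g • x with hS
  set Y := AddSubgroup.closure S with hY
  have hstab : ∀ (g : Q) (y : X), y ∈ Y → g • y ∈ Y := by
    intro g y hy
    induction hy using AddSubgroup.closure_induction with
    | mem y hy =>
      obtain ⟨h, rfl⟩ := hy
      exact AddSubgroup.subset_closure ⟨g * h, mul_smul g h x⟩
    | zero => rw [smul_zero]; exact Y.zero_mem
    | add a b _ _ ha hb => rw [smul_add]; exact Y.add_mem ha hb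
    | neg a _ ha => rw [smul_neg]; exact Y.neg_mem ha
  let act : MulAction Q Y :=
    { smul := fun g y => ⟨g • (y : X), hstab g y y.2⟩
      one_smul := fun y => Subtype.ext (one_smul Q (y : X))
      mul_smul := fun a b y => Subtype.ext (mul_smul a b (y : X)) }
  -- The group generated by one orbit is finitely generated and $p$-torsion, hence finite, and $p$
  -- divides its order because $x$ has order $p$. Counting fixed points modulo $p$ then yields one
  -- besides $0$.
  have hfg : AddGroup.FG Y :=
    (AddGroup.fg_iff_addSubgroup_fg Y).2
      ((AddSubgroup.fg_iff Y).2 ⟨S, rfl, Set.finite_range _⟩)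
  have htors : ∀ y : Y, p • y = 0 := fun y => Subtype.ext (hX y)
  have hfin : Finite Y := AddCommGroup.finite_of_fg_isAddTorsion Y fun y =>
    isOfFinAddOrder_iff_nsmul_eq_zero.2 ⟨p, hp.pos, htors y⟩
  have hxY : x ∈ Y := AddSubgroup.subset_closure ⟨1, one_smul Q x⟩
  have hord : addOrderOf (⟨x, hxY⟩ : Y) = p :=
    addOrderOf_eq_prime (htors _) fun h => hx (congrArg Subtype.val h)
  have hdvd : p ∣ Nat.card Y := by
    have := addOrderOf_dvd_natCard (⟨x, hxY⟩ : Y)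
    rwa [hord] at this
  obtain ⟨b, hb, hne⟩ := hQ.exists_fixed_point_of_prime_dvd_card_of_fixed_point Y hdvd
    (a := (0 : Y)) fun g => Subtype.ext (smul_zero g)
  exact ⟨b, fun h => hne (Subtype.ext h.symm), fun g => congrArg Subtype.val (hb g)⟩

/-- A representation in characteristic `p` whose image is a finite `p`-group fixes a non-zero
vector. -/
theorem exists_ne_zero_fixed {p : ℕ} [Fact p.Prime] [CharP k p] (ρ : Representation k H M)
    (hfin : (Set.range ρ).Finite) (hp : ∀ x, ρ (x ^ p) = 1) [Nontrivial M] :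
    ∃ y : M, y ≠ 0 ∧ ∀ x : H, ρ x y = y := by
  let f : H →* (Module.End k M)ˣ := MonoidHom.toHomUnits ρ
  have hf : ∀ x, ((f x : (Module.End k M)ˣ) : Module.End k M) = ρ x := fun _ => rfl
  have : Finite f.range := by
    have hsub : (f.range : Set (Module.End k M)ˣ) ⊆ Units.val ⁻¹' Set.range ρ := by
      rintro _ ⟨x, rfl⟩; exact ⟨x, rfl⟩
    exact ((hfin.preimage Units.val_injective.injOn).subset hsub).to_subtype
  have hP : IsPGroup p f.range := by
    rintro ⟨_, x, rfl⟩
    refine ⟨1, Subtype.ext (Units.ext ?_)⟩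
    rw [pow_one]
    change (((f x) ^ p : (Module.End k M)ˣ) : Module.End k M) = 1
    rw [← map_pow, hf, hp]
  obtain ⟨m, hm⟩ := exists_ne (0 : M)
  obtain ⟨y, hy, hfix⟩ := exists_ne_zero_fixed_of_isPGroup hP (X := M) (fun x => by
    rw [← Nat.cast_smul_eq_nsmul k, CharP.cast_eq_zero, zero_smul]) hm
  exact ⟨y, hy, fun x => hfix ⟨f x, x, rfl⟩⟩

end FiniteImage

/-! ### Invariants and opposite coinvariants in relative rank one. -/

section RankOne

set_option linter.unusedSectionVars false

variable {k G W : Type*} [Field k] [Group G] [TopologicalSpace G] [IsTopologicalGroup G]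
  [AddCommGroup W] [Module k W] {K : Subgroup G}
  (σ : Representation k K W)

theorem eq_top_of_stable {K' : Type*} [Group K'] {ρ : Representation k K' W} (hρ : ρ.IsIrreducible)
    (M : Submodule k W) (hM : ∀ x, ∀ v ∈ M, ρ x v ∈ M) {v : W} (hv : v ∈ M) (hv0 : v ≠ 0) :
    M = ⊤ := by
  rcases hρ.eq_bot_or_eq_top ⟨M, fun g v hv => hM g v hv⟩ with h | h
  · exfalso
    apply hv0
    have h1 := congrArg Subrepresentation.toSubmodule h
    have h2 : M = ⊥ := h1
    rw [h2] at hv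
    exact (Submodule.mem_bot k).1 hv
  · exact congrArg Subrepresentation.toSubmodule h

/-- Opposite subgroups `U`, `U'` of `K` exchanged by an element `w`, and a subgroup `B` containing
`U`, which behave under `σ` as the maximal unipotent subgroups and a Borel subgroup of a finite group
of Lie type of relative rank one. -/
structure RankOneDatum (p : ℕ) (U U' B : Subgroup G) (w : K) : Prop where
  torus : ∀ b : K, (b : G) ∈ B → ∃ t : K, ((t⁻¹ * b : K) : G) ∈ U ∧
    (∀ x ∈ U, (t : G)⁻¹ * x * t ∈ U) ∧ ∀ x ∈ U', (t : G) * x * (t : G)⁻¹ ∈ U'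
  cover : ∀ x : K, (∃ u b : K, (u : G) ∈ U' ∧ (b : G) ∈ B ∧ x = u * b) ∨
    ∃ b : K, (b : G) ∈ B ∧ x = w * b
  weyl : ∀ x : K, ((w⁻¹ * x * w : K) : G) ∈ U' ↔ (x : G) ∈ U
  -- In the finite group, $U'\cap B$ is trivial and $U'$ has exponent $p$. For the preimages in $K$
  -- this holds only modulo elements acting trivially, so the conditions are imposed on $\sigma$.
  inter_trivial : ∀ x : K, (x : G) ∈ U' → (x : G) ∈ B → σ x = 1
  pow_trivial : ∀ x : K, (x : G) ∈ U' → σ (x ^ p) = 1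
  finite_range : (Set.range σ).Finite

namespace RankOneDatum

variable {σ} {p : ℕ} {U U' B : Subgroup G} {w : K}

theorem finite_image (h : RankOneDatum σ p U U' B w) :
    {A : Module.End k W | ∃ u : K, (u : G) ∈ U ∧ σ u = A}.Finite :=
  h.finite_range.subset (by rintro _ ⟨u, _, rfl⟩; exact ⟨u, rfl⟩)

/-- The sum of the elements of `σ(U)`. -/
def normU (h : RankOneDatum σ p U U' B w) : Module.End k W :=
  -- The sum runs over distinct operators: $U$ may be infinite, and counting an operator with
  -- multiplicity could give zero in characteristic $p$.
  ∑ A ∈ h.finite_image.toFinset, A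

theorem mul_normU (h : RankOneDatum σ p U U' B w) (u : K) (hu : (u : G) ∈ U) :
    σ u * h.normU = h.normU := by
  rw [normU, Finset.mul_sum]
  refine Finset.sum_bij' (fun A _ => σ u * A) (fun A _ => σ u⁻¹ * A) ?_ ?_ ?_ ?_ ?_
  · intro A hA
    rw [Set.Finite.mem_toFinset] at hA ⊢
    obtain ⟨v, hv, rfl⟩ := hA
    exact ⟨u * v, U.mul_mem hu hv, map_mul _ _ _⟩
  · intro A hA
    rw [Set.Finite.mem_toFinset] at hA ⊢
    obtain ⟨v, hv, rfl⟩ := hA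
    exact ⟨u⁻¹ * v, U.mul_mem (U.inv_mem hu) hv, map_mul _ _ _⟩
  · intro A _
    rw [← mul_assoc, ← map_mul, inv_mul_cancel, map_one, one_mul]
  · intro A _
    rw [← mul_assoc, ← map_mul, mul_inv_cancel, map_one, one_mul]
  · intro A _; rfl

theorem normU_mul (h : RankOneDatum σ p U U' B w) (u : K) (hu : (u : G) ∈ U) :
    h.normU * σ u = h.normU := by
  rw [normU, Finset.sum_mul]
  refine Finset.sum_bij' (fun A _ => A * σ u) (fun A _ => A * σ u⁻¹) ?_ ?_ ?_ ?_ ?_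
  · intro A hA
    rw [Set.Finite.mem_toFinset] at hA ⊢
    obtain ⟨v, hv, rfl⟩ := hA
    exact ⟨v * u, U.mul_mem hv hu, map_mul _ _ _⟩
  · intro A hA
    rw [Set.Finite.mem_toFinset] at hA ⊢
    obtain ⟨v, hv, rfl⟩ := hA
    exact ⟨v * u⁻¹, U.mul_mem hv (U.inv_mem hu), map_mul _ _ _⟩
  · intro A _
    rw [mul_assoc, ← map_mul, mul_inv_cancel, map_one, mul_one]
  · intro A _
    rw [mul_assoc, ← map_mul, inv_mul_cancel, map_one, mul_one]
  · intro A _; rfl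

/-- The operator `∑_{u ∈ U} u w` on `W`. -/
def heckeS (h : RankOneDatum σ p U U' B w) : Module.End k W := h.normU * σ w

theorem heckeS_mem (h : RankOneDatum σ p U U' B w) (v : W) : h.heckeS v ∈ fixedBy σ U := by
  rw [mem_fixedBy]
  intro x hx
  rw [heckeS, ← Module.End.mul_apply, ← mul_assoc, h.mul_normU x hx]

/-- Since $wU'w^{-1}=U$, an element of $U'$ moves across $w$ into $U$, where `normU` absorbs it. -/
theorem heckeS_mul (h : RankOneDatum σ p U U' B w) (x : K) (hx : (x : G) ∈ U') :
    h.heckeS * σ x = h.heckeS := by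
  have h1 : (w * x * w⁻¹ : K).1 ∈ U := by
    rw [← h.weyl]
    convert hx using 2
    group
  have h2 : w * x = (w * x * w⁻¹) * w := by group
  rw [heckeS, mul_assoc, ← map_mul, h2, map_mul, ← mul_assoc, h.normU_mul _ h1]

/-- By `heckeS_mul` the operator factors through the $U'$-coinvariants. -/
theorem heckeS_eq_zero (h : RankOneDatum σ p U U' B w) {v : W} (hv : toCoinv σ U' v = 0) :
    h.heckeS v = 0 := by
  let q : coinvBy σ U' →ₗ[k] W := Representation.Coinvariants.lift _ h.heckeS (by
    rintro ⟨x, hx⟩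
    exact h.heckeS_mul x hx)
  have h1 : q (toCoinv σ U' v) = h.heckeS v := rfl
  rw [← h1, hv, map_zero]

/-- On vectors fixed by $U$, an element of $B$ acts as its torus part, and conjugation by the torus
part preserves $U$. -/
theorem apply_fixed_mem (h : RankOneDatum σ p U U' B w) {v : W} (hv : v ∈ fixedBy σ U) (b : K)
    (hb : (b : G) ∈ B) : σ b v ∈ fixedBy σ U := by
  obtain ⟨t, htb, htU, -⟩ := h.torus b hb
  have h1 : σ b v = σ t v := by
    have := mem_fixedBy.1 hv _ htb
    conv_rhs => rw [← this, ← Module.End.mul_apply, ← map_mul, mul_inv_cancel_left]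
  rw [h1, mem_fixedBy]
  intro x hx
  have h2 := mem_fixedBy.1 hv (t⁻¹ * x * t) (htU _ hx)
  conv_rhs => rw [← h2]
  rw [← Module.End.mul_apply, ← Module.End.mul_apply, ← map_mul, ← map_mul]
  congr 2
  group

/-- The torus part of $b$ also preserves $U'$ under conjugation, so it acts on the coinvariants. -/
theorem apply_ker_mem (h : RankOneDatum σ p U U' B w) {v : W} (hv : v ∈ fixedBy σ U)
    (hv' : toCoinv σ U' v = 0) (b : K) (hb : (b : G) ∈ B) : toCoinv σ U' (σ b v) = 0 := by
  obtain ⟨t, htb, -, htU'⟩ := h.torus b hb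
  have h1 : σ b v = σ t v := by
    have := mem_fixedBy.1 hv _ htb
    conv_rhs => rw [← this, ← Module.End.mul_apply, ← map_mul, mul_inv_cancel_left]
  rw [h1]
  let q : coinvBy σ U' →ₗ[k] coinvBy σ U' :=
    Representation.Coinvariants.lift _ (toCoinv σ U' ∘ₗ σ t) (by
      rintro ⟨x, hx⟩
      ext u
      have h1 := toCoinv_apply (σ := σ) (I' := U') (σ t u) (t * x * t⁻¹) (htU' _ hx)
      rw [← Module.End.mul_apply, ← map_mul] at h1
      simp only [inv_mul_cancel_right, map_mul] at h1
      exact h1)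
  have h2 : q (toCoinv σ U' v) = toCoinv σ U' (σ t v) := rfl
  rw [← h2, hv', map_zero]

/-- A non-zero subspace of `σ^U` stable under `B` and `∑_{u ∈ U} u w` generates `σ` over `U'`. -/
theorem span_eq_top (h : RankOneDatum σ p U U' B w) (hσ : σ.IsIrreducible) (Q : Submodule k W)
    (hB : ∀ b : K, (b : G) ∈ B → ∀ v ∈ Q, σ b v ∈ Q) (hS : ∀ v ∈ Q, h.heckeS v ∈ Q) (hQ : Q ≠ ⊥) :
    Submodule.span k {y : W | ∃ u : K, (u : G) ∈ U' ∧ ∃ v ∈ Q, σ u v = y} = ⊤ := by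
  classical
  set M := Submodule.span k {y : W | ∃ u : K, (u : G) ∈ U' ∧ ∃ v ∈ Q, σ u v = y} with hM
  have happ : ∀ (a b : K) (v : W), σ a (σ b v) = σ (a * b) v := fun a b v => by
    rw [map_mul, Module.End.mul_apply]
  -- The term of the identity in `heckeS v` is $\sigma(w)v$. Every other term $\sigma(uw)v$ lies in
  -- $M$, because $uw$ falls in the big cell $U'B$.
  have hwQ : ∀ v ∈ Q, σ w v ∈ M := by
    intro v hv
    have h1 : h.heckeS v = ∑ A ∈ h.finite_image.toFinset, A (σ w v) := by
      rw [heckeS, normU, Module.End.mul_apply, LinearMap.sum_apply]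
    have hmem : (1 : Module.End k W) ∈ h.finite_image.toFinset := by
      rw [Set.Finite.mem_toFinset]; exact ⟨1, U.one_mem, map_one _⟩
    rw [← Finset.add_sum_erase _ _ hmem, Module.End.one_apply] at h1
    rw [← sub_eq_iff_eq_add.2 h1]
    refine sub_mem (Submodule.subset_span ⟨1, U'.one_mem, _, hS v hv, by simp⟩)
      (sum_mem fun A hA => ?_)
    rw [Finset.mem_erase, Set.Finite.mem_toFinset] at hA
    obtain ⟨hA1, u, hu, rfl⟩ := hA
    rw [happ]
    rcases h.cover (u * w) with ⟨u', b, hu', hb, hub⟩ | ⟨b, hb, hub⟩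
    · rw [hub, ← happ]
      exact Submodule.subset_span ⟨u', hu', _, hB b hb v hv, rfl⟩
    -- If $uw\in wB$, then $w^{-1}uw\in U'\cap B$ acts trivially, hence so does $u$, although the
    -- identity operator was removed from the sum.
    · exfalso
      apply hA1
      have h2 : b = w⁻¹ * u * w := by rw [mul_assoc, hub, inv_mul_cancel_left]
      have h3 := h.inter_trivial b (h2 ▸ (h.weyl u).2 hu) hb
      have h4 : u = w * b * w⁻¹ := by rw [h2]; group
      rw [h4, map_mul, map_mul, h3, mul_one, ← map_mul, mul_inv_cancel, map_one]
  have hKQ : ∀ (x : K), ∀ v ∈ Q, σ x v ∈ M := by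
    intro x v hv
    rcases h.cover x with ⟨u, b, hu, hb, rfl⟩ | ⟨b, hb, rfl⟩
    · rw [← happ]
      exact Submodule.subset_span ⟨u, hu, _, hB b hb v hv, rfl⟩
    · rw [← happ]
      exact hwQ _ (hB b hb v hv)
  obtain ⟨v, hv, hv0⟩ := (Submodule.ne_bot_iff Q).1 hQ
  refine eq_top_of_stable hσ M (fun x y hy => ?_) (by simpa using hKQ 1 v hv) hv0
  induction hy using Submodule.span_induction with
  | mem y hy =>
    obtain ⟨u, -, v, hv, rfl⟩ := hy
    rw [happ]
    exact hKQ _ v hv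
  | zero => rw [map_zero]; exact M.zero_mem
  | add a b _ _ ha hb => rw [map_add]; exact M.add_mem ha hb
  | smul c a _ ha => rw [map_smul]; exact M.smul_mem c ha

/-- The $U'$-span of $Q$ is everything, and $U'$ acts trivially on coinvariants, so $Q$ alone
already has full image. -/
theorem toCoinv_surjOn (h : RankOneDatum σ p U U' B w) (hσ : σ.IsIrreducible) (Q : Submodule k W)
    (hB : ∀ b : K, (b : G) ∈ B → ∀ v ∈ Q, σ b v ∈ Q) (hS : ∀ v ∈ Q, h.heckeS v ∈ Q) (hQ : Q ≠ ⊥)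
    (y : W) : ∃ v ∈ Q, toCoinv σ U' v = toCoinv σ U' y := by
  have hy : y ∈ (⊤ : Submodule k W) := Submodule.mem_top
  rw [← h.span_eq_top hσ Q hB hS hQ] at hy
  induction hy using Submodule.span_induction with
  | mem y hy =>
    obtain ⟨u, hu, v, hv, rfl⟩ := hy
    exact ⟨v, hv, (toCoinv_apply v u hu).symm⟩
  | zero => exact ⟨0, Q.zero_mem, rfl⟩
  | add a b _ _ ha hb =>
    obtain ⟨v, hv, hva⟩ := ha
    obtain ⟨v', hv', hvb⟩ := hb
    exact ⟨v + v', Q.add_mem hv hv', by rw [map_add, map_add, hva, hvb]⟩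
  | smul c a _ ha =>
    obtain ⟨v, hv, hva⟩ := ha
    exact ⟨c • v, Q.smul_mem c hv, by rw [map_smul, map_smul, hva]⟩

/-- $U'$ acts on the dual through a finite group of exponent $p$, so it fixes a non-zero functional,
and such a functional factors through the coinvariants. -/
theorem exists_toCoinv_ne_zero (h : RankOneDatum σ p U U' B w) [Fact p.Prime] [CharP k p]
    [Nontrivial W] : ∃ y : W, toCoinv σ U' y ≠ 0 := by
  let ρ : Representation k (U'.subgroupOf K) W := σ.comp (U'.subgroupOf K).subtype
  have hfin : (Set.range ρ.dual).Finite := by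
    refine (h.finite_range.image fun A : Module.End k W => Module.Dual.transpose A).subset ?_
    rintro _ ⟨x, rfl⟩
    exact ⟨σ (x⁻¹ : U'.subgroupOf K), ⟨_, rfl⟩, rfl⟩
  have hp : ∀ x, ρ.dual (x ^ p) = 1 := by
    intro x
    have h1 : ρ (x ^ p)⁻¹ = 1 := by
      rw [← inv_pow]
      exact h.pow_trivial _ (x⁻¹).2
    ext f v
    rw [Representation.dual_apply, h1]
    rfl
  obtain ⟨f, hf, hfix⟩ := exists_ne_zero_fixed (p := p) ρ.dual hfin hp
  by_contra! hall
  apply hf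
  let q : coinvBy σ U' →ₗ[k] k := Representation.Coinvariants.lift ρ f (by
    intro x
    conv_rhs => rw [← hfix x⁻¹]
    ext v
    simp [Representation.dual_apply, Module.Dual.transpose_apply])
  ext v
  have h1 : q (toCoinv σ U' v) = f v := rfl
  rw [← h1, hall, map_zero, LinearMap.zero_apply]

/-- For an irreducible representation, the natural map from the `U`-invariants to the
`U'`-coinvariants is bijective. -/
theorem invToCoinv_bijective (h : RankOneDatum σ p U U' B w) [Fact p.Prime] [CharP k p]
    (hσ : σ.IsIrreducible) (hne : fixedBy σ U ≠ ⊥) :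
    Function.Bijective (invToCoinv σ U U') := by
  have hnt : Nontrivial W := by
    obtain ⟨v, -, hv⟩ := (Submodule.ne_bot_iff _).1 hne
    exact ⟨v, 0, hv⟩
  constructor
  · rw [← LinearMap.ker_eq_bot]
    by_contra hker
    -- The kernel is stable under $B$, and `heckeS` kills it. Were it non-zero, it would surject
    -- onto the coinvariants; but its image is zero and the coinvariants are not.
    set Q : Submodule k W := fixedBy σ U ⊓ LinearMap.ker (toCoinv σ U') with hQ
    have hQ0 : Q ≠ ⊥ := by
      obtain ⟨v, hv, hv0⟩ := (Submodule.ne_bot_iff _).1 hker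
      exact (Submodule.ne_bot_iff _).2 ⟨v, ⟨v.2, hv⟩, fun h => hv0 (Subtype.ext h)⟩
    obtain ⟨y, hy⟩ := h.exists_toCoinv_ne_zero
    obtain ⟨v, hv, hvy⟩ := h.toCoinv_surjOn hσ Q
      (fun b hb v hv => ⟨h.apply_fixed_mem hv.1 b hb, h.apply_ker_mem hv.1 hv.2 b hb⟩)
      (fun v hv => by rw [h.heckeS_eq_zero hv.2]; exact Q.zero_mem) hQ0 y
    exact hy (hvy ▸ hv.2)
  · intro z
    obtain ⟨y, rfl⟩ := Representation.Coinvariants.mk_surjective _ z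
    obtain ⟨v, hv, hvy⟩ := h.toCoinv_surjOn hσ (fixedBy σ U)
      (fun b hb v hv => h.apply_fixed_mem hv b hb) (fun v _ => h.heckeS_mem v) hne y
    exact ⟨⟨v, hv⟩, hvy⟩

end RankOneDatum

theorem jMap_apply_of_mem {I I' : Subgroup G} (hb : Function.Bijective (invToCoinv σ I I')) {v : W}
    (hv : v ∈ fixedBy σ I) : jMap σ I I' v = v := by
  have := (LinearEquiv.ofBijective (invToCoinv σ I I') hb).symm_apply_apply ⟨v, hv⟩
  simp only [jMap, coinvToInv, dif_pos hb]
  exact congrArg Subtype.val this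

end RankOne
end U21
end

/-! ### Matrix relations, unipotent elements and elimination in $U(2,1)$. -/

noncomputable section
namespace U21

open Matrix

namespace UnramifiedQuadratic

set_option linter.unusedSectionVars false

section Entries

variable {F E : Type*} [NontriviallyNormedField F] [NormedField E] [NormedAlgebra F E]
  (D : UnramifiedQuadratic F E) [IsUltrametricDist E] [CompleteSpace F]

theorem fin_three_rev_zero : Fin.rev (0 : Fin 3) = 2 := rfl

theorem fin_three_rev_one : Fin.rev (1 : Fin 3) = 1 := rfl

theorem fin_three_rev_two : Fin.rev (2 : Fin 3) = 0 := rfl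

/-- The relations between entries used below come from pairing two columns of $g$; in particular the
first and last columns are isotropic. -/
theorem column_herm (g : D.G) (i j : Fin 3) :
    D.mat g 0 i * D.conj (D.mat g 2 j) + D.mat g 1 i * D.conj (D.mat g 1 j) +
      D.mat g 2 i * D.conj (D.mat g 0 j) = betaMat E i j := by
  have h := congrFun (congrFun ((D.mem_G_iff g.1).1 g.2) i) j
  rw [← h]
  simp only [mat, Matrix.mul_apply, Fin.sum_univ_three, Matrix.transpose_apply, Matrix.map_apply,
    betaMat]
  simp
  ring

theorem mat_alpha_zpow_mul (n : ℤ) (g : D.G) (i j : Fin 3) :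
    D.mat (D.alpha ^ n * g) i j = D.pi ^ (alphaExp i * n) * D.mat g i j := by
  rw [mat_mul, mat_alpha_zpow, Matrix.diagonal_mul]

theorem mat_mul_alpha_zpow (n : ℤ) (g : D.G) (i j : Fin 3) :
    D.mat (g * D.alpha ^ n) i j = D.pi ^ (alphaExp j * n) * D.mat g i j := by
  rw [mat_mul, mat_alpha_zpow, Matrix.mul_diagonal, mul_comm]

theorem mat_alpha_conj (n : ℤ) (g : D.G) (i j : Fin 3) :
    D.mat (D.alpha ^ n * g * D.alpha ^ (-n)) i j =
      D.pi ^ ((alphaExp i - alphaExp j) * n) * D.mat g i j := by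
  rw [mat_mul_alpha_zpow, mat_alpha_zpow_mul, ← mul_assoc, ← zpow_add₀ D.pi_ne_zero]
  congr 2
  ring

theorem betaExp_add_rev (c : MaxCompact) (i : Fin 3) : betaExp c i + betaExp c (Fin.rev i) = 0 := by
  revert i; cases c <;> decide

theorem mat_betaK_mul (c : MaxCompact) (g : D.G) (i j : Fin 3) :
    D.mat (D.betaK c * g) i j = D.pi ^ betaExp c i * D.mat g (Fin.rev i) j := by
  simp [mat_mul, Matrix.mul_apply, mat_betaK]

theorem mat_mul_betaK (c : MaxCompact) (g : D.G) (i j : Fin 3) :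
    D.mat (g * D.betaK c) i j = D.pi ^ betaExp c (Fin.rev j) * D.mat g i (Fin.rev j) := by
  have h3 : ∀ l : Fin 3, (j = Fin.rev l) ↔ (l = Fin.rev j) := fun l => by
    constructor <;> rintro rfl <;> simp
  simp [mat_mul, Matrix.mul_apply, mat_betaK, h3, mul_comm]

theorem betaK_mul_self (c : MaxCompact) : D.betaK c * D.betaK c = 1 := by
  apply D.mat_inj
  ext i j
  rw [mat_betaK_mul, mat_betaK, Fin.rev_rev, mat_one, Matrix.one_apply]
  by_cases h : i = j
  · subst h
    rw [if_pos rfl, if_pos rfl, ← zpow_add₀ D.pi_ne_zero, betaExp_add_rev, zpow_zero]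
  · rw [if_neg h, if_neg (Ne.symm h), mul_zero]

theorem betaK_inv (c : MaxCompact) : (D.betaK c)⁻¹ = D.betaK c :=
  inv_eq_of_mul_eq_one_left (D.betaK_mul_self c)

theorem mat_betaK_conj (c : MaxCompact) (g : D.G) (i j : Fin 3) :
    D.mat (D.betaK c * g * D.betaK c) i j =
      D.pi ^ (betaExp c i - betaExp c j) * D.mat g (Fin.rev i) (Fin.rev j) := by
  rw [mat_mul_betaK, mat_betaK_mul, ← mul_assoc, ← zpow_add₀ D.pi_ne_zero]
  congr 2
  have := betaExp_add_rev c j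
  linarith

/-- $\beta_K$ represents the non-trivial Weyl element: it reverses the coordinates, hence inverts
$\alpha$. -/
theorem alpha_zpow_mul_betaK (c : MaxCompact) (n : ℤ) :
    D.alpha ^ n * D.betaK c = D.betaK c * D.alpha ^ (-n) := by
  apply D.mat_inj
  ext i j
  rw [mat_alpha_zpow_mul, mat_mul_alpha_zpow, mat_betaK]
  split_ifs with h
  · subst h
    congr 2
    have : ∀ i : Fin 3, alphaExp (Fin.rev i) = -alphaExp i := by decide
    rw [this]; ring
  · rw [mul_zero, mul_zero]

/-- An upper triangular element of `G`. -/
structure IsUpper (g : D.G) : Prop where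
  h10 : D.mat g 1 0 = 0
  h20 : D.mat g 2 0 = 0
  h21 : D.mat g 2 1 = 0

/-- A lower triangular element of `G`. -/
structure IsLower (g : D.G) : Prop where
  h01 : D.mat g 0 1 = 0
  h02 : D.mat g 0 2 = 0
  h12 : D.mat g 1 2 = 0

/-- An upper triangular unipotent element of `G`. -/
structure IsUpperUnip (g : D.G) : Prop extends D.IsUpper g where
  diag : ∀ i, D.mat g i i = 1

/-- A lower triangular unipotent element of `G`. -/
structure IsLowerUnip (g : D.G) : Prop extends D.IsLower g where
  diag : ∀ i, D.mat g i i = 1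

variable {D}

theorem IsLower.inv {g : D.G} (h : D.IsLower g) : D.IsLower g⁻¹ := by
  constructor <;> rw [mat_inv_apply]
  · exact (congrArg D.conj h.h12).trans (map_zero _)
  · exact (congrArg D.conj h.h02).trans (map_zero _)
  · exact (congrArg D.conj h.h01).trans (map_zero _)

theorem IsUpperUnip.inv {g : D.G} (h : D.IsUpperUnip g) : D.IsUpperUnip g⁻¹ := by
  refine ⟨⟨?_, ?_, ?_⟩, fun i => ?_⟩ <;> rw [mat_inv_apply]
  · exact (congrArg D.conj h.h21).trans (map_zero _)
  · exact (congrArg D.conj h.h20).trans (map_zero _)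
  · exact (congrArg D.conj h.h10).trans (map_zero _)
  · exact (congrArg D.conj (h.diag _)).trans (map_one _)

theorem IsLowerUnip.inv {g : D.G} (h : D.IsLowerUnip g) : D.IsLowerUnip g⁻¹ := by
  refine ⟨h.toIsLower.inv, fun i => ?_⟩
  rw [mat_inv_apply]
  exact (congrArg D.conj (h.diag _)).trans (map_one _)

theorem IsUpperUnip.alpha_conj {g : D.G} (h : D.IsUpperUnip g) (n : ℤ) :
    D.IsUpperUnip (D.alpha ^ n * g * D.alpha ^ (-n)) := by
  refine ⟨⟨?_, ?_, ?_⟩, fun i => ?_⟩ <;> rw [mat_alpha_conj]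
  · rw [h.h10, mul_zero]
  · rw [h.h20, mul_zero]
  · rw [h.h21, mul_zero]
  · rw [h.diag, sub_self, zero_mul, zpow_zero, one_mul]

theorem IsUpperUnip.h01_eq {g : D.G} (h : D.IsUpperUnip g) :
    D.mat g 0 1 = -D.conj (D.mat g 1 2) := by
  have := D.column_herm g 1 2
  rw [h.diag, h.diag, h.h21, map_one, mul_one, one_mul, zero_mul, add_zero] at this
  simp [betaMat] at this
  exact eq_neg_of_add_eq_zero_left this

theorem IsLowerUnip.h21_eq {g : D.G} (h : D.IsLowerUnip g) :
    D.mat g 2 1 = -D.conj (D.mat g 1 0) := by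
  have := D.column_herm g 1 0
  rw [h.diag, h.diag, h.h01, map_one, mul_one, one_mul, zero_mul, zero_add] at this
  simp [betaMat] at this
  exact eq_neg_of_add_eq_zero_right this

/-- Isotropy of the last column: the corner entry controls the size of the middle one. -/
theorem IsUpperUnip.isotropic {g : D.G} (h : D.IsUpperUnip g) :
    D.mat g 1 2 * D.conj (D.mat g 1 2) = -(D.mat g 0 2 + D.conj (D.mat g 0 2)) := by
  have := D.column_herm g 2 2
  rw [h.diag, map_one] at this
  simp [betaMat] at this
  linear_combination this

theorem IsLowerUnip.isotropic {g : D.G} (h : D.IsLowerUnip g) :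
    D.mat g 1 0 * D.conj (D.mat g 1 0) = -(D.mat g 2 0 + D.conj (D.mat g 2 0)) := by
  have := D.column_herm g 0 0
  rw [h.diag, map_one] at this
  simp [betaMat] at this
  linear_combination this

variable (D)

/-- Isotropy is the only condition on the parameters. The inverse `A'` is $\beta\bar A^{T}\beta$, as
it must be in a unitary group. -/
theorem exists_isUpperUnip {a b : E} (h : b + D.conj b + a * D.conj a = 0) :
    ∃ u : D.G, D.IsUpperUnip u ∧ D.mat u 0 2 = b ∧ D.mat u 1 2 = a := by
  have h' : D.conj b = -b - a * D.conj a := by linear_combination h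
  let A : Matrix (Fin 3) (Fin 3) E := !![1, -D.conj a, b; 0, 1, a; 0, 0, 1]
  let A' : Matrix (Fin 3) (Fin 3) E := !![1, D.conj a, D.conj b; 0, 1, -a; 0, 0, 1]
  have h1 : A * A' = 1 := by
    ext i j
    fin_cases i <;> fin_cases j <;> simp [A, A', Matrix.mul_apply, Fin.sum_univ_three, h']
    ring
  have h2 : A' * A = 1 := by
    ext i j
    fin_cases i <;> fin_cases j <;> simp [A, A', Matrix.mul_apply, Fin.sum_univ_three, h']
    ring
  refine ⟨⟨⟨A, A', h1, h2⟩, ?_⟩, ⟨⟨rfl, rfl, rfl⟩, fun i => ?_⟩, rfl, rfl⟩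
  · rw [mem_G_iff]
    ext i j
    fin_cases i <;> fin_cases j <;>
      simp [A, betaMat, Matrix.mul_apply, Fin.sum_univ_three, conj_conj, h']
  · fin_cases i <;> rfl

theorem exists_isLowerUnip {a b : E} (h : b + D.conj b + a * D.conj a = 0) :
    ∃ u : D.G, D.IsLowerUnip u ∧ D.mat u 2 0 = b ∧ D.mat u 1 0 = a := by
  have h' : D.conj b = -b - a * D.conj a := by linear_combination h
  let A : Matrix (Fin 3) (Fin 3) E := !![1, 0, 0; a, 1, 0; b, -D.conj a, 1]
  let A' : Matrix (Fin 3) (Fin 3) E := !![1, 0, 0; -a, 1, 0; D.conj b, D.conj a, 1]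
  have h1 : A * A' = 1 := by
    ext i j
    fin_cases i <;> fin_cases j <;> simp [A, A', Matrix.mul_apply, Fin.sum_univ_three, h']
    ring
  have h2 : A' * A = 1 := by
    ext i j
    fin_cases i <;> fin_cases j <;> simp [A, A', Matrix.mul_apply, Fin.sum_univ_three, h']
    ring
  refine ⟨⟨⟨A, A', h1, h2⟩, ?_⟩, ⟨⟨rfl, rfl, rfl⟩, fun i => ?_⟩, rfl, rfl⟩
  · rw [mem_G_iff]
    ext i j
    fin_cases i <;> fin_cases j <;>
      simp [A, betaMat, Matrix.mul_apply, Fin.sum_univ_three, conj_conj, h']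
  · fin_cases i <;> rfl

/-- Elimination in the last column. -/
theorem exists_upperUnip_lower (g : D.G) (hg : D.mat g 2 2 ≠ 0) :
    ∃ u : D.G, D.IsUpperUnip u ∧ D.mat u 0 2 = D.mat g 0 2 / D.mat g 2 2 ∧
      D.IsLower (u⁻¹ * g) ∧ ∀ j, D.mat (u⁻¹ * g) 2 j = D.mat g 2 j := by
  have hg' : D.conj (D.mat g 2 2) ≠ 0 := by simpa using hg
  have hiso := D.column_herm g 2 2
  simp [betaMat] at hiso
  -- The isotropic last column of $g$, divided by its bottom entry, is the last column of a
  -- unipotent element.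
  obtain ⟨u, hu, hu02, hu12⟩ := D.exists_isUpperUnip
    (a := D.mat g 1 2 / D.mat g 2 2) (b := D.mat g 0 2 / D.mat g 2 2) (by
      rw [map_div₀, map_div₀]
      field_simp
      linear_combination hiso)
  have hrow : ∀ j, D.mat (u⁻¹ * g) 2 j = D.mat g 2 j := fun j => by
    rw [mat_mul, Matrix.mul_apply, Fin.sum_univ_three]
    simp only [mat_inv_apply, fin_three_rev_zero, fin_three_rev_one, fin_three_rev_two, hu.diag,
      hu.h20, hu.h10, map_zero, map_one]
    ring
  have h02 : D.mat (u⁻¹ * g) 0 2 = 0 := by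
    rw [mat_mul, Matrix.mul_apply, Fin.sum_univ_three]
    simp only [mat_inv_apply, fin_three_rev_zero, fin_three_rev_one, fin_three_rev_two, hu.diag,
      hu02, hu12, map_one, map_div₀]
    field_simp
    linear_combination hiso
  have h12 : D.mat (u⁻¹ * g) 1 2 = 0 := by
    rw [mat_mul, Matrix.mul_apply, Fin.sum_univ_three]
    simp only [mat_inv_apply, fin_three_rev_zero, fin_three_rev_one, fin_three_rev_two, hu.diag,
      hu.h21, hu.h01_eq, hu12, map_one, map_zero, map_neg, conj_conj]
    field_simp
    ring
  refine ⟨u, hu, hu02, ⟨?_, h02, h12⟩, hrow⟩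
  -- The last column now has only its bottom entry, so orthogonality to the middle column forces the
  -- $(0,1)$ entry to vanish.
  have := D.column_herm (u⁻¹ * g) 2 1
  rw [h02, h12, hrow 2] at this
  simp [betaMat, hg] at this
  exact this

/-- Elimination in the first column. -/
theorem exists_lowerUnip_upper (g : D.G) (hg : D.mat g 0 0 ≠ 0) :
    ∃ u : D.G, D.IsLowerUnip u ∧ D.mat u 2 0 = D.mat g 2 0 / D.mat g 0 0 ∧
      D.IsUpper (u⁻¹ * g) ∧ ∀ j, D.mat (u⁻¹ * g) 0 j = D.mat g 0 j := by
  have hg' : D.conj (D.mat g 0 0) ≠ 0 := by simpa using hg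
  have hiso := D.column_herm g 0 0
  simp [betaMat] at hiso
  obtain ⟨u, hu, hu02, hu12⟩ := D.exists_isLowerUnip
    (a := D.mat g 1 0 / D.mat g 0 0) (b := D.mat g 2 0 / D.mat g 0 0) (by
      rw [map_div₀, map_div₀]
      field_simp
      linear_combination hiso)
  have hrow : ∀ j, D.mat (u⁻¹ * g) 0 j = D.mat g 0 j := fun j => by
    rw [mat_mul, Matrix.mul_apply, Fin.sum_univ_three]
    simp only [mat_inv_apply, fin_three_rev_zero, fin_three_rev_one, fin_three_rev_two, hu.diag,
      hu.h02, hu.h12, map_zero, map_one]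
    ring
  have h20 : D.mat (u⁻¹ * g) 2 0 = 0 := by
    rw [mat_mul, Matrix.mul_apply, Fin.sum_univ_three]
    simp only [mat_inv_apply, fin_three_rev_zero, fin_three_rev_one, fin_three_rev_two, hu.diag,
      hu02, hu12, map_one, map_div₀]
    field_simp
    linear_combination hiso
  have h10 : D.mat (u⁻¹ * g) 1 0 = 0 := by
    rw [mat_mul, Matrix.mul_apply, Fin.sum_univ_three]
    simp only [mat_inv_apply, fin_three_rev_zero, fin_three_rev_one, fin_three_rev_two, hu.diag,
      hu.h01, hu.h21_eq, hu12, map_one, map_zero, map_neg, conj_conj]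
    field_simp
    ring
  refine ⟨u, hu, hu02, ⟨h10, h20, ?_⟩, hrow⟩
  have := D.column_herm (u⁻¹ * g) 0 1
  rw [h10, h20, hrow 0] at this
  simp [betaMat, hg] at this
  exact this

end Entries

end UnramifiedQuadratic
end U21
end

/-! ### The decomposition $G=\bigcup_n K\alpha^nI_K$ and factorizations of $I_K$. -/

noncomputable section
namespace U21

namespace UnramifiedQuadratic

set_option linter.unusedSectionVars false

section Decomposition

variable {F E : Type*} [NontriviallyNormedField F] [NormedField E] [NormedAlgebra F E]
  (D : UnramifiedQuadratic F E) [IsUltrametricDist E] [CompleteSpace F]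

theorem conj_norm (x : E) : ‖D.conj x‖ = ‖x‖ := by
  refine le_antisymm (D.conj_norm_le x) ?_
  simpa [conj_conj] using D.conj_norm_le (D.conj x)

theorem conj_mem_P_iff {n : ℤ} {x : E} : D.conj x ∈ D.pE n ↔ x ∈ D.pE n := by
  rw [mem_P, mem_P, conj_norm]

/-- Scaling by a power of $\varpi$ brings $\|x\|$ into $(\|\varpi\|,1]$, and no norm lies strictly
between $\|\varpi\|$ and $1$. -/
theorem exists_norm_eq {x : E} (hx : x ≠ 0) : ∃ n : ℤ, ‖x‖ = ‖D.ϖ‖ ^ n := by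
  obtain ⟨n, hn1, hn2⟩ := exists_mem_Ioc_zpow (norm_pos_iff.2 hx)
    ((one_lt_inv₀ D.norm_pos).2 D.norm_ϖ_lt_one)
  rw [inv_zpow'] at hn1 hn2
  refine ⟨-(n + 1), le_antisymm hn2 ?_⟩
  by_contra! hlt
  have h1 : ‖D.pi ^ (n + 1) * x‖ < 1 := by
    rw [norm_mul, norm_zpow, norm_pi]
    calc ‖D.ϖ‖ ^ (n + 1) * ‖x‖ < ‖D.ϖ‖ ^ (n + 1) * ‖D.ϖ‖ ^ (-(n + 1)) :=
          mul_lt_mul_of_pos_left hlt (zpow_pos D.norm_pos _)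
      _ = 1 := by rw [← zpow_add₀ D.norm_pos.ne', add_neg_cancel, zpow_zero]
  have h2 := D.norm_le_norm_ϖ _ h1
  rw [norm_mul, norm_zpow, norm_pi, zpow_add₀ D.norm_pos.ne', zpow_one] at h2
  have h3 : ‖D.ϖ‖ ^ n * ‖x‖ ≤ 1 := by
    have := D.norm_pos
    nlinarith
  rw [zpow_neg, ← one_div, div_lt_iff₀ (zpow_pos D.norm_pos n)] at hn1
  linarith

/-- The dual form of `mem_P`, using that the valuation is discrete. -/
theorem inv_mem_P_of_not_mem {n : ℤ} {x : E} (hx : x ∉ D.pE n) : x⁻¹ ∈ D.pE (1 - n) := by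
  rw [mem_P, not_le] at hx
  have hx0 : x ≠ 0 := by
    rintro rfl
    rw [norm_zero] at hx
    exact absurd hx (zpow_pos D.norm_pos n).le.not_gt
  obtain ⟨m, hm⟩ := D.exists_norm_eq hx0
  rw [hm, zpow_lt_zpow_iff_right_of_lt_one₀ D.norm_pos D.norm_ϖ_lt_one] at hx
  rw [mem_P, norm_inv, hm, ← zpow_neg]
  exact zpow_le_zpow_right_of_le_one₀ D.norm_pos D.norm_ϖ_lt_one.le (by omega)

/-- The valuation of $x\bar x$ is twice that of $x$, so a bound $2n-1$ rounds up to $n$. The odd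
bound is what $K_1$ requires, since its corner exponents are $-1$ and $1$. -/
theorem mem_P_of_mul_conj {m n : ℤ} {x : E} (hx : x * D.conj x ∈ D.pE m) (h : 2 * n - 1 ≤ m) :
    x ∈ D.pE n := by
  by_contra hn
  have h1 := D.inv_mem_P_of_not_mem hn
  have h2 := D.mul_mem_P (D.mul_mem_P h1 (D.conj_mem_P h1)) hx
  have hx0 : x ≠ 0 := by
    rintro rfl
    exact hn (zero_mem _)
  have hx1 : D.conj x ≠ 0 := by simpa using hx0
  have h3 : x⁻¹ * D.conj x⁻¹ * (x * D.conj x) = 1 := by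
    rw [map_inv₀]; field_simp
  rw [h3] at h2
  have h4 := D.P_mono (n := 1) (by omega) h2
  rw [mem_P, norm_one, zpow_one] at h4
  exact absurd h4 D.norm_ϖ_lt_one.not_ge

variable {D} in
-- By isotropy the corner entry bounds the two entries next to the diagonal, so only the corner has
-- to be tested.
theorem IsUpperUnip.mem_Iw1 {u : D.G} (h : D.IsUpperUnip u) {c : MaxCompact}
    (hu : D.mat u 0 2 ∈ D.pE (c.expK 0 2)) : u ∈ D.Iw1 c := by
  have h12 : D.mat u 1 2 ∈ D.pE 0 := by
    refine D.mem_P_of_mul_conj (m := c.expK 0 2) ?_ (by cases c <;> decide)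
    rw [h.isotropic]
    exact neg_mem (add_mem hu (D.conj_mem_P hu))
  have h01 : D.mat u 0 1 ∈ D.pE 0 := by
    rw [h.h01_eq]
    exact neg_mem (D.conj_mem_P h12)
  refine ⟨fun i j => ?_, fun i => by rw [h.diag, sub_self]; exact zero_mem _⟩
  have hd : D.mat u i i ∈ D.pE (c.expI i i) := by
    rw [h.diag, c.triangular_expI.1.2.1]; exact D.one_mem_P
  fin_cases i <;> fin_cases j
  · exact hd
  · exact D.P_mono (by cases c <;> decide) h01
  · exact D.P_mono (by cases c <;> decide) hu
  · exact h.h10 ▸ zero_mem _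
  · exact hd
  · exact D.P_mono (by cases c <;> decide) h12
  · exact h.h20 ▸ zero_mem _
  · exact h.h21 ▸ zero_mem _
  · exact hd

variable {D} in
theorem IsLowerUnip.mem_Iw1' {u : D.G} (h : D.IsLowerUnip u) {c : MaxCompact}
    (hu : D.mat u 2 0 ∈ D.pE (c.expK 2 0)) : u ∈ D.Iw1' c := by
  have h10 : D.mat u 1 0 ∈ D.pE (c.expK 1 0) := by
    refine D.mem_P_of_mul_conj (m := c.expK 2 0) ?_ (by cases c <;> decide)
    rw [h.isotropic]
    exact neg_mem (add_mem hu (D.conj_mem_P hu))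
  have h21 : D.mat u 2 1 ∈ D.pE (c.expK 1 0) := by
    rw [h.h21_eq]
    exact neg_mem (D.conj_mem_P h10)
  refine ⟨fun i j => ?_, fun i => by rw [h.diag, sub_self]; exact zero_mem _⟩
  have hd : D.mat u i i ∈ D.pE (c.expI' i i) := by
    rw [h.diag, c.triangular_expI'.1.2.1]; exact D.one_mem_P
  fin_cases i <;> fin_cases j
  · exact hd
  · exact h.h01 ▸ zero_mem _
  · exact h.h02 ▸ zero_mem _
  · exact D.P_mono (by cases c <;> decide) h10
  · exact hd
  · exact h.h12 ▸ zero_mem _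
  · exact D.P_mono (by cases c <;> decide) hu
  · exact D.P_mono (by cases c <;> decide) h21
  · exact hd

variable {D} in
theorem IsLowerUnip.mem_Iw1 {u : D.G} (h : D.IsLowerUnip u) {c : MaxCompact}
    (hu : D.mat u 2 0 ∈ D.pE (c.expI 2 0)) : u ∈ D.Iw1 c := by
  have h10 : D.mat u 1 0 ∈ D.pE 1 := by
    refine D.mem_P_of_mul_conj (m := c.expI 2 0) ?_ (by cases c <;> decide)
    rw [h.isotropic]
    exact neg_mem (add_mem hu (D.conj_mem_P hu))
  have h21 : D.mat u 2 1 ∈ D.pE 1 := by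
    rw [h.h21_eq]
    exact neg_mem (D.conj_mem_P h10)
  refine ⟨fun i j => ?_, fun i => by rw [h.diag, sub_self]; exact zero_mem _⟩
  have hd : D.mat u i i ∈ D.pE (c.expI i i) := by
    rw [h.diag, c.triangular_expI.1.2.1]; exact D.one_mem_P
  fin_cases i <;> fin_cases j
  · exact hd
  · exact h.h01 ▸ zero_mem _
  · exact h.h02 ▸ zero_mem _
  · exact D.P_mono (by cases c <;> decide) h10
  · exact hd
  · exact h.h12 ▸ zero_mem _
  · exact D.P_mono (by cases c <;> decide) hu
  · exact D.P_mono (by cases c <;> decide) h21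
  · exact hd

variable {D} in
theorem IsLower.mul_conj {g : D.G} (h : D.IsLower g) :
    D.mat g 2 2 * D.conj (D.mat g 0 0) = 1 := by
  have := D.column_herm g 2 0
  rw [h.h02, h.h12, zero_mul, zero_mul, zero_add, zero_add] at this
  simpa [betaMat] using this

variable {D} in
theorem IsLower.mul_conj_one {g : D.G} (h : D.IsLower g) :
    D.mat g 1 1 * D.conj (D.mat g 1 1) = 1 := by
  have := D.column_herm g 1 1
  rw [h.h01, map_zero, zero_mul, mul_zero, zero_add, add_zero] at this
  simpa [betaMat] using this

variable {D} in
theorem IsLower.ne_zero {g : D.G} (h : D.IsLower g) : D.mat g 0 0 ≠ 0 ∧ D.mat g 2 2 ≠ 0 := by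
  constructor <;> intro h0 <;> simpa [h0] using h.mul_conj

/-- A diagonal element of `G` is in `K α ^ n` for some `n`. -/
theorem exists_alpha_of_diagonal (c : MaxCompact) {g : D.G} (hu : D.IsUpper g) (hl : D.IsLower g) :
    ∃ k ∈ D.K c, ∃ n : ℤ, g = k * D.alpha ^ n := by
  obtain ⟨h0, h2⟩ := hl.ne_zero
  obtain ⟨n, hn⟩ := D.exists_norm_eq h0
  have hn2 : ‖D.mat g 2 2‖ = ‖D.ϖ‖ ^ (-n) := by
    have := congrArg norm hl.mul_conj
    rw [norm_mul, conj_norm, hn, norm_one] at this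
    rw [zpow_neg]
    exact eq_inv_of_mul_eq_one_left this
  have hn1 : ‖D.mat g 1 1‖ = 1 := by
    have := congrArg norm hl.mul_conj_one
    rw [norm_mul, conj_norm, norm_one] at this
    nlinarith [norm_nonneg (D.mat g 1 1)]
  -- The diagonal of $\alpha^{-n}$ has valuations $n,0,-n$, exactly those of $g$.
  refine ⟨g * D.alpha ^ n, fun i j => ?_, -n, by group⟩
  rw [mat_mul_alpha_zpow]
  have hd : ∀ i, D.pi ^ (alphaExp i * n) * D.mat g i i ∈ D.pE 0 := by
    intro i
    rw [zpow_mul_mem_P, mem_P]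
    fin_cases i
    · exact hn.le.trans_eq (by simp [alphaExp])
    · exact hn1.le.trans_eq (by simp [alphaExp])
    · exact hn2.le.trans_eq (by simp [alphaExp])
  have hK := c.admissible_expK.2.1
  fin_cases i <;> fin_cases j
  · exact hK 0 ▸ hd 0
  · exact D.mem_P.2 (by simp [hl.h01, (zpow_pos D.norm_pos _).le])
  · exact D.mem_P.2 (by simp [hl.h02, (zpow_pos D.norm_pos _).le])
  · exact D.mem_P.2 (by simp [hu.h10, (zpow_pos D.norm_pos _).le])
  · exact hK 1 ▸ hd 1
  · exact D.mem_P.2 (by simp [hl.h12, (zpow_pos D.norm_pos _).le])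
  · exact D.mem_P.2 (by simp [hu.h20, (zpow_pos D.norm_pos _).le])
  · exact D.mem_P.2 (by simp [hu.h21, (zpow_pos D.norm_pos _).le])
  · exact hK 2 ▸ hd 2

variable {D} in
theorem IsLower.mul {g h : D.G} (hg : D.IsLower g) (hh : D.IsLower h) : D.IsLower (g * h) := by
  constructor <;> rw [mat_mul, Matrix.mul_apply, Fin.sum_univ_three] <;>
    simp [hg.h01, hg.h02, hg.h12, hh.h01, hh.h02, hh.h12]

variable {D} in
/-- A lower triangular element of `G` is the product of a unipotent and a diagonal element. -/
theorem IsLower.exists_eq_mul (c : MaxCompact) {g : D.G} (h : D.IsLower g) :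
    ∃ u, D.IsLowerUnip u ∧ D.mat u 2 0 = D.mat g 2 0 / D.mat g 0 0 ∧
      ∃ k ∈ D.K c, ∃ n : ℤ, g = u * (k * D.alpha ^ n) := by
  obtain ⟨u, hu, hu20, hup, -⟩ := D.exists_lowerUnip_upper g h.ne_zero.1
  obtain ⟨k, hk, n, hn⟩ := D.exists_alpha_of_diagonal c hup (hu.inv.toIsLower.mul h)
  exact ⟨u, hu, hu20, k, hk, n, by rw [← hn, mul_inv_cancel_left]⟩

variable {D} in
theorem IsLower.exists_K_alpha {c : MaxCompact} {g : D.G} (h : D.IsLower g)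
    (hg : D.mat g 2 0 / D.mat g 0 0 ∈ D.pE (c.expK 2 0)) :
    ∃ k ∈ D.K c, ∃ n : ℤ, g = k * D.alpha ^ n := by
  obtain ⟨u, hu, hu20, k, hk, n, hn⟩ := h.exists_eq_mul c
  exact ⟨u * k, mul_mem (D.Iw1'_le_K c (hu.mem_Iw1' (hu20 ▸ hg))) hk, n, by rw [hn, mul_assoc]⟩

variable {D} in
-- Eliminating in $g^{-1}$ places the unipotent factor on the right of the diagonal part. Its corner
-- is governed by $g_{20}/g_{22}$ instead of $g_{20}/g_{00}$.
theorem IsLower.mem_doubleCoset_of_last {c : MaxCompact} {g : D.G} (h : D.IsLower g)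
    (hg : D.mat g 2 0 / D.mat g 2 2 ∈ D.pE (c.expI 2 0)) :
    ∃ k ∈ D.K c, ∃ n : ℤ, ∃ i ∈ D.Iw c, g = k * D.alpha ^ n * i := by
  obtain ⟨v, hv, hv20, hup, -⟩ := D.exists_lowerUnip_upper g⁻¹ h.inv.ne_zero.1
  have hvI : v ∈ D.Iw1 c := by
    refine hv.mem_Iw1 ?_
    rw [hv20, mat_inv_apply, mat_inv_apply]
    simp only [fin_three_rev_zero, fin_three_rev_two, ← map_div₀]
    exact D.conj_mem_P hg
  have hl : D.IsLower (v⁻¹ * g⁻¹) := hv.inv.toIsLower.mul h.inv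
  have hu' : D.IsUpper (g * v) := by
    have e : g * v = (v⁻¹ * g⁻¹)⁻¹ := by group
    rw [e]
    constructor <;> rw [mat_inv_apply]
    · exact (congrArg D.conj hup.h21).trans (map_zero _)
    · exact (congrArg D.conj hup.h20).trans (map_zero _)
    · exact (congrArg D.conj hup.h10).trans (map_zero _)
  obtain ⟨k, hk, n, hn⟩ := D.exists_alpha_of_diagonal c hu' (h.mul hv.toIsLower)
  exact ⟨k, hk, n, v⁻¹, inv_mem (D.Iw1_le_Iw c hvI), by rw [← hn]; group⟩

variable {D} in
-- If $g_{20}$ is small against $g_{00}$ or $g_{22}$, the unipotent part is absorbed by $K$ on the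
-- left or by $I_K$ on the right. Otherwise both inverse ratios are small. Then $g^{-1}\beta_K$ has
-- $g_{20}$ (up to conjugation and scaling) in its bottom diagonal place, and removing an upper
-- unipotent element of $I_{1,K}$ returns to the first case.
theorem IsLower.mem_doubleCoset (c : MaxCompact) {g : D.G} (h : D.IsLower g) :
    ∃ k ∈ D.K c, ∃ n : ℤ, ∃ i ∈ D.Iw c, g = k * D.alpha ^ n * i := by
  by_cases h1 : D.mat g 2 0 / D.mat g 0 0 ∈ D.pE (c.expK 2 0)
  · obtain ⟨k, hk, n, hn⟩ := h.exists_K_alpha h1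
    exact ⟨k, hk, n, 1, one_mem _, by rw [mul_one, hn]⟩
  by_cases h2 : D.mat g 2 0 / D.mat g 2 2 ∈ D.pE (c.expI 2 0)
  · exact h.mem_doubleCoset_of_last h2
  obtain ⟨hne0, hne2⟩ := h.ne_zero
  have h20 : D.mat g 2 0 ≠ 0 := fun h0 => h1 (by rw [h0, zero_div]; exact zero_mem _)
  have h1' := D.inv_mem_P_of_not_mem h1
  have h2' := D.inv_mem_P_of_not_mem h2
  rw [inv_div] at h1' h2'
  have hp := D.pi_ne_zero
  have e02 : D.mat (g⁻¹ * D.betaK c) 0 2 = D.pi ^ betaExp c 0 * D.conj (D.mat g 2 2) := by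
    rw [mat_mul_betaK, mat_inv_apply]; rfl
  have e22 : D.mat (g⁻¹ * D.betaK c) 2 2 = D.pi ^ betaExp c 0 * D.conj (D.mat g 2 0) := by
    rw [mat_mul_betaK, mat_inv_apply]; rfl
  have e20 : D.mat (g⁻¹ * D.betaK c) 2 0 = D.pi ^ betaExp c 2 * D.conj (D.mat g 0 0) := by
    rw [mat_mul_betaK, mat_inv_apply]; rfl
  have hne : D.mat (g⁻¹ * D.betaK c) 2 2 ≠ 0 := by
    rw [e22]; exact mul_ne_zero (zpow_ne_zero _ hp) (by simpa using h20)
  obtain ⟨u, hu, hu02, hl, hrow⟩ := D.exists_upperUnip_lower _ hne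
  have huI : u ∈ D.Iw c := by
    refine D.Iw1_le_Iw c (hu.mem_Iw1 ?_)
    rw [hu02, e02, e22, mul_div_mul_left _ _ (zpow_ne_zero _ hp), ← map_div₀]
    exact D.conj_mem_P (D.P_mono (by cases c <;> decide) h2')
  have hz : D.mat (u⁻¹ * (g⁻¹ * D.betaK c))⁻¹ 2 0 / D.mat (u⁻¹ * (g⁻¹ * D.betaK c))⁻¹ 0 0 ∈
      D.pE (c.expK 2 0) := by
    rw [mat_inv_apply, mat_inv_apply, fin_three_rev_zero, fin_three_rev_two, hrow, hrow, e20, e22,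
      ← map_div₀, mul_div_mul_comm, ← zpow_sub₀ hp, ← map_div₀, D.conj_mem_P_iff, zpow_mul_mem_P]
    exact D.conj_mem_P (D.P_mono (by cases c <;> decide) h1')
  obtain ⟨k, hk, n, hn⟩ := hl.inv.exists_K_alpha hz
  refine ⟨D.betaK c * k, mul_mem (D.betaK_mem_K c) hk, n, u⁻¹, inv_mem huI, ?_⟩
  rw [mul_assoc (D.betaK c), ← hn]
  group

/-- The decomposition `G = ⋃ K α ^ n I_K`. -/
theorem exists_eq_mul_alpha_zpow_mul (c : MaxCompact) (g : D.G) :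
    ∃ k ∈ D.K c, ∃ n : ℤ, ∃ i ∈ D.Iw c, g = k * D.alpha ^ n * i := by
  have key : ∀ g : D.G, D.mat g 2 2 ≠ 0 → D.mat g 0 2 / D.mat g 2 2 ∈ D.pE (c.expK 0 2) →
      ∃ k ∈ D.K c, ∃ n : ℤ, ∃ i ∈ D.Iw c, g = k * D.alpha ^ n * i := by
    intro g hg h
    obtain ⟨u, hu, hu02, hl, -⟩ := D.exists_upperUnip_lower g hg
    obtain ⟨k, hk, n, i, hi, hkn⟩ := hl.mem_doubleCoset c
    refine ⟨u * k, mul_mem (D.Iw1_le_K c (hu.mem_Iw1 (hu02 ▸ h))) hk, n, i, hi, ?_⟩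
    rw [mul_assoc u, mul_assoc u, ← hkn, mul_inv_cancel_left]
  -- $\beta_K$ exchanges the outer entries of the last column up to scaling, so either $g$ or
  -- $\beta_Kg$ satisfies the condition of `key`.
  by_cases h : D.mat g 2 2 ≠ 0 ∧ D.mat g 0 2 / D.mat g 2 2 ∈ D.pE (c.expK 0 2)
  · exact key g h.1 h.2
  have hp := D.pi_ne_zero
  have e02 : D.mat (D.betaK c * g) 0 2 = D.pi ^ betaExp c 0 * D.mat g 2 2 := by
    rw [mat_betaK_mul]; rfl
  have e22 : D.mat (D.betaK c * g) 2 2 = D.pi ^ betaExp c 2 * D.mat g 0 2 := by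
    rw [mat_betaK_mul]; rfl
  have h02 : D.mat g 0 2 ≠ 0 ∧ D.mat g 2 2 / D.mat g 0 2 ∈ D.pE (1 - c.expK 0 2) := by
    by_cases h22 : D.mat g 2 2 = 0
    -- If both outer entries of the last column vanished, isotropy would kill the middle one, yet
    -- this column pairs to $1$ with the first.
    · refine ⟨fun h0 => ?_, by rw [h22, zero_div]; exact zero_mem _⟩
      have := D.column_herm g 2 0
      rw [h0, h22] at this
      have h3 := D.column_herm g 2 2
      rw [h0, h22] at h3
      simp [betaMat] at h3
      rw [h3] at this
      simp [betaMat] at this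
    · have h1 : D.mat g 0 2 / D.mat g 2 2 ∉ D.pE (c.expK 0 2) := fun h' => h ⟨h22, h'⟩
      refine ⟨fun h0 => h1 (by rw [h0, zero_div]; exact zero_mem _), ?_⟩
      rw [← inv_div]
      exact D.inv_mem_P_of_not_mem h1
  obtain ⟨k, hk, n, i, hi, hkn⟩ := key (D.betaK c * g)
    (by rw [e22]; exact mul_ne_zero (zpow_ne_zero _ hp) h02.1) (by
      rw [e02, e22, mul_div_mul_comm, ← zpow_sub₀ hp, zpow_mul_mem_P]
      exact D.P_mono (by cases c <;> decide) h02.2)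
  refine ⟨D.betaK c * k, mul_mem (D.betaK_mem_K c) hk, n, i, hi, ?_⟩
  rw [mul_assoc (D.betaK c), mul_assoc (D.betaK c), ← hkn, ← mul_assoc, betaK_mul_self, one_mul]

/-- Off-diagonal products lie in $\mathfrak p$ by triangularity, so $g_{ii}(g^{-1})_{ii}\equiv1$
with both factors integral. -/
theorem congSub_norm_diag {e : Fin 3 → Fin 3 → ℤ} (he : Triangular e) {g : D.G}
    (hg : g ∈ D.congSub e he.1) (i : Fin 3) : ‖D.mat g i i‖ = 1 := by
  have h0 : ∀ i, ‖D.mat g i i‖ ≤ 1 := fun i => by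
    have := hg i i
    rwa [he.1.2.1, mem_P, zpow_zero] at this
  have h1 : (D.mat g * D.mat g⁻¹) i i = 1 := by
    rw [← mat_mul, mul_inv_cancel, mat_one, Matrix.one_apply_eq]
  rw [Matrix.mul_apply, ← Finset.add_sum_erase _ _ (Finset.mem_univ i)] at h1
  have h2 : ∑ l ∈ Finset.univ.erase i, D.mat g i l * D.mat g⁻¹ l i ∈ D.pE 1 :=
    sum_mem fun l hl => D.P_mono (he.2 i l (Finset.ne_of_mem_erase hl))
      (D.mul_mem_P (hg i l) ((D.congSub _ he.1).inv_mem hg l i))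
  refine le_antisymm (h0 i) ?_
  by_contra! hlt
  have h3 : D.mat g i i ∈ D.pE 1 := by
    rw [mem_P, zpow_one]; exact D.norm_le_norm_ϖ _ hlt
  have h4 : D.mat g⁻¹ i i ∈ D.pE 0 := by
    rw [mat_inv_apply, mem_P, zpow_zero, conj_norm]; exact h0 _
  have h5 := add_mem (D.P_mono (by norm_num) (D.mul_mem_P h3 h4)) h2
  rw [h1, mem_P, norm_one, zpow_one] at h5
  exact absurd h5 D.norm_ϖ_lt_one.not_ge

theorem div_mem_P_of_norm_eq_one {x y : E} {n : ℤ} (hx : x ∈ D.pE n) (hy : ‖y‖ = 1) :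
    x / y ∈ D.pE n := by
  rwa [mem_P, norm_div, hy, div_one]

/-- Factorization of `I_K` with a unipotent right factor which is upper triangular. -/
theorem exists_alpha_mul_upperUnip (c : MaxCompact) {i : D.G} (hi : i ∈ D.Iw c) (n : ℕ) :
    ∃ k ∈ D.K c, ∃ u ∈ D.Iw1 c, D.IsUpperUnip u ∧
      D.alpha ^ (n : ℤ) * i = k * D.alpha ^ (n : ℤ) * u := by
  have hinv := (D.Iw c).inv_mem hi
  have hd := D.congSub_norm_diag c.triangular_expI hinv 2
  -- Elimination in $i^{-1}$ leaves the unipotent factor on the right: $iu$ is lower triangular, and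
  -- conjugation by $\alpha^n$ with $n\ge0$ only shrinks entries below the diagonal.
  obtain ⟨u, hu, hu02, hl, -⟩ := D.exists_upperUnip_lower i⁻¹ (norm_ne_zero_iff.1 (by rw [hd]; exact one_ne_zero))
  have huI : u ∈ D.Iw1 c := hu.mem_Iw1 (by
    rw [hu02]
    exact D.div_mem_P_of_norm_eq_one (D.P_mono (by cases c <;> decide) (hinv 0 2)) hd)
  have hl' : D.IsLower (i * u) := by
    have := hl.inv
    rwa [mul_inv_rev, inv_inv, inv_inv] at this
  have hmem := (D.Iw c).mul_mem hi (D.Iw1_le_Iw c huI)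
  refine ⟨D.alpha ^ (n : ℤ) * (i * u) * D.alpha ^ (-(n : ℤ)), fun a b => ?_, u⁻¹, inv_mem huI,
    hu.inv, by group⟩
  rw [mat_alpha_conj, zpow_mul_mem_P]
  have hz : ∀ m, (0 : E) ∈ D.pE m := fun m => zero_mem _
  have hmono : ∀ a b, (alphaExp a - alphaExp b) ≥ 0 → D.mat (i * u) a b ∈
      D.pE (c.expK a b - (alphaExp a - alphaExp b) * n) := by
    intro a b hab
    refine D.P_mono ?_ (D.Iw_le_K c hmem a b)
    have : 0 ≤ (alphaExp a - alphaExp b) * (n : ℤ) := mul_nonneg hab (Int.natCast_nonneg n)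
    linarith
  fin_cases a <;> fin_cases b
  · exact hmono 0 0 (by decide)
  · exact hl'.h01 ▸ hz _
  · exact hl'.h02 ▸ hz _
  · exact hmono 1 0 (by decide)
  · exact hmono 1 1 (by decide)
  · exact hl'.h12 ▸ hz _
  · exact hmono 2 0 (by decide)
  · exact hmono 2 1 (by decide)
  · exact hmono 2 2 (by decide)

/-- Factorization of `I_K` with a unipotent right factor which is lower triangular. -/
theorem exists_alpha_mul_lowerUnip (c : MaxCompact) {i : D.G} (hi : i ∈ D.Iw c) (n : ℕ) :
    ∃ k ∈ D.K c, ∃ u ∈ D.Iw1 c, D.IsLowerUnip u ∧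
      D.alpha ^ (-(n : ℤ)) * i = k * D.alpha ^ (-(n : ℤ)) * u := by
  have hinv := (D.Iw c).inv_mem hi
  have hd := D.congSub_norm_diag c.triangular_expI hinv 0
  -- Conjugation by $\alpha^{-n}$ contracts above the diagonal, so here $iu$ has to be upper
  -- triangular.
  obtain ⟨u, hu, hu20, hl, -⟩ := D.exists_lowerUnip_upper i⁻¹ (norm_ne_zero_iff.1 (by rw [hd]; exact one_ne_zero))
  have huI : u ∈ D.Iw1 c := hu.mem_Iw1 (by
    rw [hu20]
    exact D.div_mem_P_of_norm_eq_one (hinv 2 0) hd)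
  have hl' : D.IsUpper (i * u) := by
    have e : i * u = (u⁻¹ * i⁻¹)⁻¹ := by group
    rw [e]
    constructor <;> rw [mat_inv_apply]
    · exact (congrArg D.conj hl.h21).trans (map_zero _)
    · exact (congrArg D.conj hl.h20).trans (map_zero _)
    · exact (congrArg D.conj hl.h10).trans (map_zero _)
  have hmem := (D.Iw c).mul_mem hi (D.Iw1_le_Iw c huI)
  refine ⟨D.alpha ^ (-(n : ℤ)) * (i * u) * D.alpha ^ (- -(n : ℤ)), fun a b => ?_, u⁻¹, inv_mem huI,
    hu.inv, by group⟩
  rw [mat_alpha_conj, zpow_mul_mem_P]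
  have hz : ∀ m, (0 : E) ∈ D.pE m := fun m => zero_mem _
  have hmono : ∀ a b, (alphaExp a - alphaExp b) ≤ 0 → D.mat (i * u) a b ∈
      D.pE (c.expK a b - (alphaExp a - alphaExp b) * -n) := by
    intro a b hab
    refine D.P_mono ?_ (D.Iw_le_K c hmem a b)
    have : 0 ≤ (alphaExp a - alphaExp b) * -(n : ℤ) :=
      mul_nonneg_of_nonpos_of_nonpos hab (by simp)
    linarith
  fin_cases a <;> fin_cases b
  · exact hmono 0 0 (by decide)
  · exact hmono 0 1 (by decide)
  · exact hmono 0 2 (by decide)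
  · exact hl'.h10 ▸ hz _
  · exact hmono 1 1 (by decide)
  · exact hmono 1 2 (by decide)
  · exact hl'.h20 ▸ hz _
  · exact hl'.h21 ▸ hz _
  · exact hmono 2 2 (by decide)

end Decomposition

end UnramifiedQuadratic
end U21
end

/-! ### The weight $\sigma$ as a representation of $\Gamma_K$, and $j_\sigma v_0=v_0$. -/

noncomputable section
namespace U21

namespace MaxCompact

/-- Exponents for `K¹ = I_{1,K} ∩ I'_{1,K}`. -/
def expN (c : MaxCompact) (i j : Fin 3) : ℤ := max (c.expI i j) (c.expI' i j)

theorem triangular_expN (c : MaxCompact) : Triangular c.expN := by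
  unfold Triangular Admissible; cases c <;> decide

end MaxCompact

namespace UnramifiedQuadratic

set_option linter.unusedSectionVars false

section Weights

variable {F E : Type*} [NontriviallyNormedField F] [NormedField E] [NormedAlgebra F E]
  (D : UnramifiedQuadratic F E) [IsUltrametricDist E] [CompleteSpace F]

/-- The pro-`p` radical `K¹` of `K`. -/
def radK (c : MaxCompact) : Subgroup D.G := D.congSubOne c.expN c.triangular_expN

theorem radK_le_Iw1 (c : MaxCompact) : D.radK c ≤ D.Iw1 c := fun _ hx =>
  ⟨fun i j => D.P_mono (le_max_left _ _) (hx.1 i j), hx.2⟩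

theorem mem_radK {c : MaxCompact} {x : D.G} (h' : x ∈ D.Iw1' c) (h : x ∈ D.Iw c) :
    x ∈ D.radK c := by
  refine ⟨fun i j => ?_, h'.2⟩
  rcases max_choice (c.expI i j) (c.expI' i j) with hm | hm <;>
    rw [MaxCompact.expN, hm]
  · exact h i j
  · exact h'.1 i j

/-- Membership in $K^1$ says that $x-1$ lies in a two-sided ideal, with exponents `e`, of the order
with exponents `expK`. Conjugation by $K$ preserves that ideal. -/
theorem radK_conj_mem (c : MaxCompact) {k x : D.G} (hk : k ∈ D.K c) (hx : x ∈ D.radK c) :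
    k * x * k⁻¹ ∈ D.radK c := by
  let e : Fin 3 → Fin 3 → ℤ := fun i j => if i = j then 1 else c.expN i j
  have hx1 : ∀ i j, (D.mat x - 1) i j ∈ D.pE (e i j) := by
    intro i j
    by_cases h : i = j
    · subst h
      simpa [e] using hx.2 i
    · simpa [e, h] using hx.1 i j
  have hmul : ∀ i l m j, e i j ≤ c.expK i l + e l m + c.expK m j := by
    cases c <;> decide
  have hk' := (D.K c).inv_mem hk
  have hconj : D.mat (k * x * k⁻¹) - 1 = D.mat k * (D.mat x - 1) * D.mat k⁻¹ := by
    have h1 : D.mat k * D.mat k⁻¹ = 1 := by rw [← mat_mul, mul_inv_cancel, mat_one]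
    rw [mul_sub, sub_mul, mul_one, h1, mat_mul, mat_mul]
  have hy : ∀ i j, (D.mat (k * x * k⁻¹) - 1) i j ∈ D.pE (e i j) := by
    intro i j
    rw [hconj, Matrix.mul_apply]
    refine sum_mem fun m _ => ?_
    rw [Matrix.mul_apply, Finset.sum_mul]
    exact sum_mem fun l _ => D.P_mono (hmul i l m j)
      (D.mul_mem_P (D.mul_mem_P (hk i l) (hx1 l m)) (hk' m j))
  have hdiag : ∀ i, D.mat (k * x * k⁻¹) i i - 1 ∈ D.pE 1 := fun i => by
    simpa [e] using hy i i
  refine ⟨fun i j => ?_, hdiag⟩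
  by_cases h : i = j
  · subst h
    rw [c.triangular_expN.1.2.1]
    have := add_mem (D.P_mono (by norm_num) (hdiag i)) D.one_mem_P
    rwa [sub_add_cancel] at this
  · simpa [e, h] using hy i j

theorem betaK_mul_mul_mem_Iw1' (c : MaxCompact) {x : D.G} (hx : x ∈ D.Iw1 c) :
    D.betaK c * x * D.betaK c ∈ D.Iw1' c := by
  refine ⟨fun i j => ?_, fun i => ?_⟩
  · rw [mat_betaK_conj, zpow_mul_mem_P]
    exact D.P_mono (by revert i j; cases c <;> decide) (hx.1 _ _)
  · rw [mat_betaK_conj, sub_self, zpow_zero, one_mul]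
    exact hx.2 _

theorem betaK_mul_mul_mem_Iw1 (c : MaxCompact) {x : D.G} (hx : x ∈ D.Iw1' c) :
    D.betaK c * x * D.betaK c ∈ D.Iw1 c := by
  have := D.betaK_conj_mem c hx
  rwa [betaK_inv] at this

/-- A criterion for an element of `K` to lie in `I_K`, in terms of its first column. -/
theorem mem_Iw_of_column (c : MaxCompact) {b : D.G} (hb : b ∈ D.K c) (h10 : D.mat b 1 0 ∈ D.pE 1)
    (h20 : D.mat b 2 0 ∈ D.pE (c.expI 2 0)) : b ∈ D.Iw c := by
  have hb' := (D.K c).inv_mem hb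
  -- Otherwise the whole first column is small enough to put the $(0,0)$ entry of $b^{-1}b=1$ in
  -- $\mathfrak p$.
  have h00 : D.mat b 0 0 ∉ D.pE 1 := by
    intro h
    have h1 : (D.mat b⁻¹ * D.mat b) 0 0 = 1 := by
      rw [← mat_mul, inv_mul_cancel, mat_one, Matrix.one_apply_eq]
    rw [Matrix.mul_apply, Fin.sum_univ_three] at h1
    have h2 : (1 : E) ∈ D.pE 1 := by
      rw [← h1]
      exact add_mem (add_mem
        (D.P_mono (by cases c <;> decide) (D.mul_mem_P (hb' 0 0) h))
        (D.P_mono (by cases c <;> decide) (D.mul_mem_P (hb' 0 1) h10)))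
        (D.P_mono (by cases c <;> decide) (D.mul_mem_P (hb' 0 2) h20))
    rw [mem_P, norm_one, zpow_one] at h2
    exact absurd h2 D.norm_ϖ_lt_one.not_ge
  -- Orthogonality of the first two columns expresses $b_{00}\overline{b_{21}}$ through small
  -- entries, and $b_{00}$ is a unit.
  have h21 : D.mat b 2 1 ∈ D.pE 1 := by
    have h1 := D.column_herm b 0 1
    have h2 : D.mat b 0 0 * D.conj (D.mat b 2 1) ∈ D.pE 1 := by
      have h3 : D.mat b 0 0 * D.conj (D.mat b 2 1) =
          -(D.mat b 1 0 * D.conj (D.mat b 1 1) + D.mat b 2 0 * D.conj (D.mat b 0 1)) := by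
        simp [betaMat] at h1
        linear_combination h1
      rw [h3]
      exact neg_mem (add_mem
        (D.P_mono (by cases c <;> decide) (D.mul_mem_P h10 (D.conj_mem_P (hb 1 1))))
        (D.P_mono (by cases c <;> decide) (D.mul_mem_P h20 (D.conj_mem_P (hb 0 1)))))
    have h3 := D.mul_mem_P (D.inv_mem_P_of_not_mem h00) h2
    have hne : D.mat b 0 0 ≠ 0 := fun h => h00 (h ▸ zero_mem _)
    rw [inv_mul_cancel_left₀ hne, conj_mem_P_iff] at h3
    simpa using h3
  intro i j
  fin_cases i <;> fin_cases j
  · exact D.P_mono (by cases c <;> decide) (hb 0 0)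
  · exact D.P_mono (by cases c <;> decide) (hb 0 1)
  · exact D.P_mono (by cases c <;> decide) (hb 0 2)
  · exact D.P_mono (by cases c <;> decide) h10
  · exact D.P_mono (by cases c <;> decide) (hb 1 1)
  · exact D.P_mono (by cases c <;> decide) (hb 1 2)
  · exact h20
  · exact D.P_mono (by cases c <;> decide) h21
  · exact D.P_mono (by cases c <;> decide) (hb 2 2)

/-- The decomposition `K = I'_{1,K} I_K ∪ β_K I_K`. -/
theorem K_cover (c : MaxCompact) {x : D.G} (hx : x ∈ D.K c) :
    (∃ u ∈ D.Iw1' c, ∃ b ∈ D.Iw c, x = u * b) ∨ ∃ b ∈ D.Iw c, x = D.betaK c * b := by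
  -- A unit $x_{00}$ is the big cell. Otherwise isotropy of the first column makes its middle entry
  -- small too, and $\beta_Kx$ meets the column criterion for $I_K$.
  by_cases h00 : D.mat x 0 0 ∈ D.pE 1
  · right
    refine ⟨D.betaK c * x, ?_, by rw [← mul_assoc, betaK_mul_self, one_mul]⟩
    refine D.mem_Iw_of_column c (mul_mem (D.betaK_mem_K c) hx) ?_ ?_
    · have h1 : D.mat (D.betaK c * x) 1 0 = D.mat x 1 0 := by
        rw [mat_betaK_mul, fin_three_rev_one, show betaExp c 1 = 0 by cases c <;> rfl, zpow_zero,
          one_mul]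
      rw [h1]
      refine D.mem_P_of_mul_conj (m := 1) ?_ (by norm_num)
      have h2 := D.column_herm x 0 0
      have h3 : D.mat x 1 0 * D.conj (D.mat x 1 0) =
          -(D.mat x 0 0 * D.conj (D.mat x 2 0) + D.mat x 2 0 * D.conj (D.mat x 0 0)) := by
        simp [betaMat] at h2
        linear_combination h2
      rw [h3]
      exact neg_mem (add_mem
        (D.P_mono (by cases c <;> decide) (D.mul_mem_P h00 (D.conj_mem_P (hx 2 0))))
        (D.P_mono (by cases c <;> decide) (D.mul_mem_P (hx 2 0) (D.conj_mem_P h00))))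
    · rw [mat_betaK_mul, fin_three_rev_two, zpow_mul_mem_P]
      exact D.P_mono (by cases c <;> decide) h00
  · left
    have hne : D.mat x 0 0 ≠ 0 := fun h => h00 (h ▸ zero_mem _)
    obtain ⟨u, hu, hu20, hup, -⟩ := D.exists_lowerUnip_upper x hne
    have huI : u ∈ D.Iw1' c := hu.mem_Iw1' (by
      rw [hu20, div_eq_mul_inv]
      have := D.mul_mem_P (hx 2 0) (D.inv_mem_P_of_not_mem h00)
      simpa using this)
    refine ⟨u, huI, u⁻¹ * x, ?_, by rw [mul_inv_cancel_left]⟩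
    exact D.mem_Iw_of_column c (mul_mem (inv_mem (D.Iw1'_le_K c huI)) hx)
      (hup.h10 ▸ zero_mem _) (hup.h20 ▸ zero_mem _)

/-- Conjugation by $\beta_K$ reduces to the lower triangular case `exists_torus`. It reverses the
diagonal, whence `Fin.rev` in the torus element. -/
theorem exists_torus_Iw (c : MaxCompact) {b : D.G} (hb : b ∈ D.Iw c) :
    ∃ t ∈ D.K c, t⁻¹ * b ∈ D.Iw1 c ∧ (∀ x ∈ D.Iw1 c, t⁻¹ * x * t ∈ D.Iw1 c) ∧
      ∀ x ∈ D.Iw1' c, t * x * t⁻¹ ∈ D.Iw1' c := by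
  have hb' : D.betaK c * b * D.betaK c ∈ D.congSub c.expI' c.triangular_expI'.1 := by
    intro i j
    rw [mat_betaK_conj, zpow_mul_mem_P]
    exact D.P_mono (by revert i j; cases c <;> decide) (hb _ _)
  obtain ⟨a, ha, hn, hba⟩ := D.exists_torus c hb'
  have ha' : ∀ i, (fun i => a (Fin.rev i)) i * D.conj ((fun i => a (Fin.rev i)) (Fin.rev i)) = 1 :=
    fun i => ha (Fin.rev i)
  refine ⟨D.diagElt (fun i => a (Fin.rev i)) ha', D.diagElt_mem_K c ha' fun i => hn _,
    D.diagElt_inv_mul_mem c.triangular_expI hb ha' (fun i => hn _) fun i => ?_,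
    fun x hx => D.diagElt_inv_conj_mem c.triangular_expI hx ha' fun i => hn _,
    fun x hx => D.diagElt_conj_mem c.triangular_expI' hx ha' fun i => hn _⟩
  have := hba (Fin.rev i)
  rwa [mat_betaK_conj, sub_self, zpow_zero, one_mul, Fin.rev_rev] at this

variable {D} in
-- The corner is quadratic in $m$. For $m=p$ odd, both $p$ and $\binom p2$ lie in $\mathfrak p$,
-- which is how $u^p$ gets into $K^1$.
theorem IsLowerUnip.pow {u : D.G} (h : D.IsLowerUnip u) (m : ℕ) :
    D.IsLowerUnip (u ^ m) ∧ D.mat (u ^ m) 2 1 = m * D.mat u 2 1 ∧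
      D.mat (u ^ m) 2 0 = m * D.mat u 2 0 + (m.choose 2 : ℕ) * (D.mat u 2 1 * D.mat u 1 0) := by
  induction m with
  | zero =>
    rw [pow_zero]
    refine ⟨⟨⟨?_, ?_, ?_⟩, fun i => ?_⟩, ?_, ?_⟩ <;> simp [mat_one]
  | succ m ih =>
    obtain ⟨⟨hl, hd⟩, h21, h20⟩ := ih
    rw [pow_succ]
    refine ⟨⟨hl.mul h.toIsLower, fun i => ?_⟩, ?_, ?_⟩
    · rw [mat_mul, Matrix.mul_apply, Fin.sum_univ_three]
      fin_cases i <;> simp [hd, h.diag, hl.h01, hl.h02, hl.h12, h.h01, h.h02, h.h12]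
    · rw [mat_mul, Matrix.mul_apply, Fin.sum_univ_three]
      simp only [hd, h.diag, h21, h.h01]
      push_cast; ring
    · rw [mat_mul, Matrix.mul_apply, Fin.sum_univ_three]
      simp only [hd, h.diag, h21, h20]
      rw [Nat.choose_succ_succ' m 1, Nat.choose_one_right]
      push_cast; ring

variable {k W : Type*} [Field k] [AddCommGroup W] [Module k W] {c : MaxCompact}
  {σ : Representation k (D.K c) W}

/-- $K^1$ is normal, so $\sigma^{K^1}$ is $K$-stable. It contains $v_0$ because $K^1\subset
I_{1,K}$, so irreducibility makes it all of $\sigma$. -/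
theorem radK_acts_trivially (hσ : σ.IsIrreducible) {v₀ : W} (hv₀ : v₀ ∈ fixedBy σ (D.Iw1 c))
    (hne : v₀ ≠ 0) (x : D.K c) (hx : (x : D.G) ∈ D.radK c) : σ x = 1 := by
  have htop : fixedBy σ (D.radK c) = ⊤ := by
    refine eq_top_of_stable hσ _ (fun y v hv => ?_) (mem_fixedBy.2 fun y hy =>
      mem_fixedBy.1 hv₀ y (D.radK_le_Iw1 c hy)) hne
    rw [mem_fixedBy] at hv ⊢
    intro z hz
    have h1 := hv (y⁻¹ * z * y) (by
      have := D.radK_conj_mem c (inv_mem y.2) hz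
      rwa [inv_inv] at this)
    conv_rhs => rw [← h1]
    rw [← Module.End.mul_apply, ← Module.End.mul_apply, ← map_mul, ← map_mul]
    congr 2
    group
  ext v
  exact mem_fixedBy.1 (htop ▸ Submodule.mem_top : v ∈ fixedBy σ (D.radK c)) x hx

/-- $K$ is compact and $K^1$ open, so $\sigma$ factors through a finite quotient. -/
theorem finite_range_of_radK [ProperSpace F] (h : ∀ x : D.K c, (x : D.G) ∈ D.radK c → σ x = 1) :
    (Set.range σ).Finite := by
  have : CompactSpace (D.K c) := isCompact_iff_compactSpace.1 (D.isCompact_K c)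
  let N : Subgroup (D.K c) := (D.radK c).subgroupOf (D.K c)
  have hN : IsOpen (N : Set (D.K c)) :=
    (D.isOpen_congSubOne c.expN c.triangular_expN).preimage continuous_subtype_val
  have : Finite (D.K c ⧸ N) := Subgroup.quotient_finite_of_isOpen N hN
  refine (Set.finite_range fun q : D.K c ⧸ N => σ q.out).subset ?_
  rintro _ ⟨x, rfl⟩
  refine ⟨QuotientGroup.mk x, ?_⟩
  have h1 : (QuotientGroup.mk x : D.K c ⧸ N).out⁻¹ * x ∈ N :=
    QuotientGroup.eq.1 (QuotientGroup.out_eq' _)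
  have h2 := h (_ * x) (Subgroup.mem_subgroupOf.1 h1)
  have h3 : x = (QuotientGroup.mk x : D.K c ⧸ N).out *
      ((QuotientGroup.mk x : D.K c ⧸ N).out⁻¹ * x) := by group
  conv_rhs => rw [h3, map_mul, h2, mul_one]

theorem rankOneDatum [ProperSpace F] {p : ℕ} [Fact p.Prime] (hp : p ≠ 2) (hpF : ‖(p : F)‖ < 1)
    (htriv : ∀ x : D.K c, (x : D.G) ∈ D.radK c → σ x = 1) :
    RankOneDatum σ p (D.Iw1 c) (D.Iw1' c) (D.Iw c) ⟨D.betaK c, D.betaK_mem_K c⟩ where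
  torus b hb := by
    obtain ⟨t, ht, h1, h2, h3⟩ := D.exists_torus_Iw c hb
    exact ⟨⟨t, ht⟩, h1, h2, h3⟩
  cover x := by
    rcases D.K_cover c x.2 with ⟨u, hu, b, hb, h⟩ | ⟨b, hb, h⟩
    · exact Or.inl ⟨⟨u, D.Iw1'_le_K c hu⟩, ⟨b, D.Iw_le_K c hb⟩, hu, hb, Subtype.ext h⟩
    · exact Or.inr ⟨⟨b, D.Iw_le_K c hb⟩, hb, Subtype.ext h⟩
  weyl x := by
    push_cast
    rw [betaK_inv]
    refine ⟨fun h => ?_, D.betaK_mul_mul_mem_Iw1' c⟩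
    have h1 := D.betaK_mul_mul_mem_Iw1 c h
    have h2 : D.betaK c * (D.betaK c * x * D.betaK c) * D.betaK c =
        (D.betaK c * D.betaK c) * x * (D.betaK c * D.betaK c) := by group
    rwa [h2, betaK_mul_self, one_mul, mul_one] at h1
  inter_trivial x hx hx' := htriv x (D.mem_radK hx hx')
  pow_trivial x hx := by
    have hpE : (p : E) ∈ D.pE 1 := by
      rw [mem_P, zpow_one]
      refine D.norm_le_norm_ϖ _ ?_
      rw [← map_natCast (algebraMap F E), norm_algebraMap']
      exact hpF
    -- Oddness of $p$ enters here: $p$ divides $\binom p2$.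
    have hcE : ((p.choose 2 : ℕ) : E) ∈ D.pE 1 := by
      have hp' : p.Prime := Fact.out
      obtain ⟨m, hm⟩ := hp'.dvd_choose_self (k := 2) (by norm_num)
        (lt_of_le_of_ne hp'.two_le (Ne.symm hp))
      rw [hm, Nat.cast_mul]
      have hmE : (m : E) ∈ D.pE 0 := by
        rw [mem_P, zpow_zero]; exact IsUltrametricDist.norm_natCast_le_one E m
      simpa using D.mul_mem_P hpE hmE
    have hd := D.congSub_norm_diag c.triangular_expI' hx.1 0
    obtain ⟨u, hu, hu20, hup, -⟩ := D.exists_lowerUnip_upper (x : D.G)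
      (norm_ne_zero_iff.1 (by rw [hd]; exact one_ne_zero))
    have huI : u ∈ D.Iw1' c := hu.mem_Iw1' (by
      rw [hu20]
      exact D.div_mem_P_of_norm_eq_one (D.Iw1'_le_K c hx 2 0) hd)
    have huK := D.Iw1'_le_K c huI
    have hxK := x.2
    -- The element $x$ differs from the lower unipotent $u$ by an element of $I'_{1,K}\cap
    -- I_K\subset K^1$, so the $p$-th power may be computed on $u$.
    have hn : σ (⟨u, huK⟩⁻¹ * x) = 1 := by
      refine htriv _ (D.mem_radK ((D.Iw1' c).mul_mem (inv_mem huI) hx) ?_)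
      exact D.mem_Iw_of_column c (mul_mem (inv_mem huK) hxK) (hup.h10 ▸ zero_mem _)
        (hup.h20 ▸ zero_mem _)
    have hx1 : σ x = σ ⟨u, huK⟩ := by
      conv_lhs => rw [← mul_inv_cancel_left ⟨u, huK⟩ x, map_mul, hn, mul_one]
    rw [map_pow, hx1, ← map_pow]
    obtain ⟨hup1, -, hup2⟩ := hu.pow p
    refine htriv _ (D.mem_radK (pow_mem huI p) (D.Iw1_le_Iw c (hup1.mem_Iw1 ?_)))
    rw [hup2]
    exact add_mem (D.P_mono (by cases c <;> decide) (D.mul_mem_P hpE (huK 2 0)))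
      (D.P_mono (by cases c <;> decide) (D.mul_mem_P hcE (D.mul_mem_P (huK 2 1) (huK 1 0))))
  finite_range := D.finite_range_of_radK htriv

/-- The endomorphism `j_σ` fixes `σ^{I_{1,K}}`. -/
theorem jSigma_apply [ProperSpace F] {p : ℕ} [Fact p.Prime] [CharP k p] (hp : p ≠ 2)
    (hpF : ‖(p : F)‖ < 1) (hσ : σ.IsIrreducible) (v : fixedBy σ (D.Iw1 c)) :
    D.jSigma σ v = v := by
  by_cases hv : v = 0
  · rw [hv]; simp
  have hv' : (v : W) ≠ 0 := fun h => hv (Subtype.ext h)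
  have h := D.rankOneDatum hp hpF (D.radK_acts_trivially hσ v.2 hv')
  exact jMap_apply_of_mem σ (h.invToCoinv_bijective hσ
    ((Submodule.ne_bot_iff _).2 ⟨v, v.2, hv'⟩)) v.2

end Weights

end UnramifiedQuadratic
end U21
end

/-! ### Supports and generation in compact induction. -/

noncomputable section
namespace U21

section Support

set_option linter.unusedSectionVars false

variable {k G W : Type*} [Field k] [Group G] [TopologicalSpace G] [IsTopologicalGroup G]
  [AddCommGroup W] [Module k W] {K : Subgroup G} {σ : Representation k K W}

/-- The restriction of a function in `ind_K^G σ` to a clopen set stable under `K`. -/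
def restrictTo (S : Set G) (hS : IsClopen S) (hK : ∀ (x : K) (g : G), (x : G) * g ∈ S ↔ g ∈ S)
    (f : compactInd σ) : compactInd σ :=
  ⟨S.indicator f.1, fun x g => by
      classical
      rw [Set.indicator_apply, Set.indicator_apply]
      by_cases hg : g ∈ S
      · rw [if_pos hg, if_pos ((hK x g).2 hg)]; exact f.2.1 x g
      · rw [if_neg hg, if_neg fun h => hg ((hK x g).1 h), map_zero],
    (LocallyConstant.indicator ⟨f.1, f.2.2.1⟩ hS).isLocallyConstant,
    f.2.2.2.mono fun g hg h0 => hg (by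
      classical
      rw [Set.indicator_apply, h0, ite_self])⟩

/-- Finitely many pieces cover the compact support, and cutting off one clopen piece at a time
writes $f$ as a finite sum in $M$. The pieces need not be disjoint. -/
theorem mem_of_support_subset_iUnion {ι : Type*} (M : Submodule k (compactInd σ)) (S : ι → Set G)
    (hS : ∀ i, IsClopen (S i)) (hK : ∀ i (x : K) (g : G), (x : G) * g ∈ S i ↔ g ∈ S i)
    (hM : ∀ i (f : compactInd σ), (∀ g ∉ S i, f.1 g = 0) → f ∈ M)
    (f : compactInd σ) (hf : ∀ g, f.1 g ≠ 0 → ∃ i, g ∈ S i) : f ∈ M := by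
  classical
  have hclosed : IsClosed (Function.support f.1) := by
    have h0 : Function.support f.1 = (f.1 ⁻¹' {0})ᶜ := rfl
    rw [h0]
    exact (f.2.2.1.isOpen_fiber 0).isClosed_compl
  have hcomp : IsCompact (Function.support f.1) := by
    have h0 := f.2.2.2
    rwa [HasCompactSupport, tsupport, hclosed.closure_eq] at h0
  obtain ⟨t, ht⟩ := hcomp.elim_finite_subcover S (fun i => (hS i).isOpen) fun g hg =>
    Set.mem_iUnion.2 (hf g hg)
  clear hclosed hcomp hf
  induction t using Finset.induction_on generalizing f with
  | empty =>
    have h0 : f = 0 := by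
      refine Subtype.ext (funext fun g => ?_)
      by_contra hg
      simpa using ht hg
    rw [h0]; exact M.zero_mem
  | insert i t _ ih =>
    set f' := restrictTo (S i) (hS i) (hK i) f with hf'
    have h1 : f' ∈ M := hM i f' fun g hg => Set.indicator_of_notMem hg _
    have h2 : f - f' ∈ M := by
      refine ih _ fun g hg => ?_
      have hgi : g ∉ S i := fun h => hg (by
        change f.1 g - (S i).indicator f.1 g = 0
        rw [Set.indicator_of_mem h, sub_self])
      have hfg : f.1 g ≠ 0 := fun h => hg (by
        change f.1 g - (S i).indicator f.1 g = 0
        rw [Set.indicator_of_notMem hgi, h, sub_zero])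
      have h3 := Set.mem_iUnion₂.1 (ht hfg)
      obtain ⟨j, hj, hgj⟩ := h3
      rcases Finset.mem_insert.1 hj with rfl | hj
      · exact absurd hgj hgi
      · exact Set.mem_iUnion₂.2 ⟨j, hj, hgj⟩
    have h3 := M.add_mem h2 h1
    rwa [sub_add_cancel] at h3

theorem isClopen_coset (hK : IsOpen (K : Set G)) (g : G) : IsClopen {h : G | h * g⁻¹ ∈ K} :=
  ⟨(Subgroup.isClosed_of_isOpen K hK).preimage (continuous_mul_const g⁻¹),
    hK.preimage (continuous_mul_const g⁻¹)⟩

/-- For irreducible `σ`, a non-zero function supported in `K` generates `ind_K^G σ`. -/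
theorem compactInd_eq_top (hσ : σ.IsIrreducible) (hK : IsOpen (K : Set G))
    (M : Submodule k (compactInd σ)) (hM : ∀ g, ∀ f ∈ M, compactIndRep σ g f ∈ M)
    {f₀ : compactInd σ} (hf₀ : f₀ ∈ M) (hsupp : ∀ g ∉ K, f₀.1 g = 0) (h1 : f₀.1 1 ≠ 0) :
    M = ⊤ := by
  -- The values at $1$ of functions in $M$ supported in $K$ form a $K$-stable subspace, hence all of
  -- $\sigma$.
  let Q : Submodule k W :=
    { carrier := {w | ∃ f ∈ M, (∀ g ∉ K, f.1 g = 0) ∧ f.1 1 = w}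
      zero_mem' := ⟨0, M.zero_mem, fun _ _ => rfl, rfl⟩
      add_mem' := by
        rintro _ _ ⟨f, hf, hs, rfl⟩ ⟨f', hf', hs', rfl⟩
        refine ⟨f + f', M.add_mem hf hf', fun g hg => ?_, rfl⟩
        change f.1 g + f'.1 g = 0
        rw [hs g hg, hs' g hg, add_zero]
      smul_mem' := by
        rintro a _ ⟨f, hf, hs, rfl⟩
        refine ⟨a • f, M.smul_mem a hf, fun g hg => ?_, rfl⟩
        change a • f.1 g = 0
        rw [hs g hg, smul_zero] }
  have hQ : Q = ⊤ := by
    refine eq_top_of_stable hσ Q (fun x w hw => ?_) ⟨f₀, hf₀, hsupp, rfl⟩ h1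
    obtain ⟨f, hf, hs, rfl⟩ := hw
    refine ⟨compactIndRep σ x f, hM _ f hf, fun g hg => ?_, ?_⟩
    · exact hs _ fun h => hg ((K.mul_mem_cancel_right x.2).1 h)
    · change f.1 (1 * x) = σ x (f.1 1)
      rw [← f.2.1, one_mul, mul_one]
  rw [eq_top_iff]
  rintro f -
  refine mem_of_support_subset_iUnion M (fun g : G => {h : G | h * g⁻¹ ∈ K})
    (isClopen_coset hK) (fun g x h => ?_) (fun g f hf => ?_) f
    fun g _ => ⟨g, by simp [K.one_mem]⟩
  · simp only [Set.mem_ofPred_eq, mul_assoc]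
    exact K.mul_mem_cancel_left x.2
  -- A function supported in $Kg$ is determined by its value at $g$, so it is a translate of an
  -- element of $M$ supported in $K$.
  · obtain ⟨f', hf', hs, hfg⟩ : f.1 g ∈ Q := hQ ▸ Submodule.mem_top
    have h2 : f = compactIndRep σ g⁻¹ f' := by
      refine Subtype.ext (funext fun h => ?_)
      change f.1 h = f'.1 (h * g⁻¹)
      by_cases hh : h * g⁻¹ ∈ K
      · have h3 := f'.2.1 ⟨_, hh⟩ 1
        have h4 := f.2.1 ⟨_, hh⟩ g
        rw [mul_one, hfg, ← h4] at h3
        simpa using h3.symm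
      · rw [hf h hh, hs _ hh]
    rw [h2]
    exact hM _ f' hf'

theorem cosetFun_mul_right {I : Subgroup G} {a : G} {w : W}
    (hw : ∀ x : K, a⁻¹ * x * a ∈ I → σ x w = w) (g : G) {i : G} (hi : i ∈ I) :
    cosetFun σ I a w (g * i) = cosetFun σ I a w g := by
  by_cases hg : g ∈ DoubleCoset.doubleCoset a (K : Set G) (I : Set G)
  · obtain ⟨y, hy, j, hj, rfl⟩ := DoubleCoset.mem_doubleCoset.1 hg
    have h1 := cosetFun_apply hw ⟨y, hy⟩ hj
    have h2 := cosetFun_apply hw ⟨y, hy⟩ (I.mul_mem hj hi)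
    rw [h1, ← h2, mul_assoc _ j]
  · rw [cosetFun_of_notMem hg, cosetFun_of_notMem]
    intro h
    apply hg
    obtain ⟨y, hy, j, hj, h⟩ := DoubleCoset.mem_doubleCoset.1 h
    exact DoubleCoset.mem_doubleCoset.2 ⟨y, hy, j * i⁻¹, I.mul_mem hj (I.inv_mem hi), by
      rw [← mul_assoc, ← h, mul_inv_cancel_right]⟩

theorem HeckeFunction.exists_of_operator_ne_zero (φ : HeckeFunction σ) (hK : IsOpen (K : Set G))
    (f : compactInd σ) (g : G) (h : (φ.operator hK f).1 g ≠ 0) :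
    ∃ y : G, φ.toFun y ≠ 0 ∧ f.1 (y⁻¹ * g) ≠ 0 := by
  rw [operator_apply] at h
  obtain ⟨q, hq⟩ : ∃ q, φ.term f g q ≠ 0 := by
    by_contra! h0
    exact h (by simp [h0])
  induction q using QuotientGroup.induction_on with
  | H y =>
    rw [term_mk] at hq
    exact ⟨y, fun h0 => hq (by rw [h0]; rfl), fun h0 => hq (by rw [h0, map_zero])⟩

/-- An intertwining operator of `ind_K^G σ` and its polynomials commute with the action of `G`. -/
theorem aeval_intertwining (T : Representation.IntertwiningMap (compactIndRep σ) (compactIndRep σ))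
    (P : Polynomial k) (g : G) (f : compactInd σ) :
    Polynomial.aeval T.toLinearMap P (compactIndRep σ g f) =
      compactIndRep σ g (Polynomial.aeval T.toLinearMap P f) := by
  have h1 : Commute (compactIndRep σ g) T.toLinearMap := (T.isIntertwining' g).symm
  have h2 : Commute (compactIndRep σ g) (Polynomial.aeval T.toLinearMap P) := by
    rw [Polynomial.aeval_eq_sum_range]
    exact Commute.sum_right _ _ _ fun i _ => (h1.pow_right i).smul_right _
  exact (LinearMap.congr_fun h2.eq f).symm

end Support

end U21
end

/-! ### A filtration of $G$ by denominators, and contraction by $\alpha$. -/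

noncomputable section
namespace U21

namespace UnramifiedQuadratic

set_option linter.unusedSectionVars false

section Lattice

variable {F E : Type*} [NontriviallyNormedField F] [NormedField E] [NormedAlgebra F E]
  (D : UnramifiedQuadratic F E) [IsUltrametricDist E] [CompleteSpace F]

/-- The elements of `G` in `ϖ ^ (-s) R`, for `R` the order of matrices defining `K`. -/
def InLattice (c : MaxCompact) (s : ℤ) (g : D.G) : Prop :=
  ∀ i j, D.mat g i j ∈ D.pE (c.expK i j - s)

variable {D} in
-- The order is closed under products, so levels add. The level plays the role of a distance from
-- the vertex fixed by $K$.
theorem InLattice.mul {c : MaxCompact} {s t : ℤ} {g h : D.G} (hg : D.InLattice c s g)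
    (hh : D.InLattice c t h) : D.InLattice c (s + t) (g * h) := by
  intro i j
  rw [mat_mul, Matrix.mul_apply]
  refine sum_mem fun l _ => D.P_mono ?_ (D.mul_mem_P (hg i l) (hh l j))
  have := c.admissible_expK.1 i j l
  linarith

theorem inLattice_of_mem_K {c : MaxCompact} {g : D.G} (hg : g ∈ D.K c) : D.InLattice c 0 g :=
  fun i j => by rw [sub_zero]; exact hg i j

theorem mem_alpha_zpow_entry (n m : ℤ) (i : Fin 3) :
    D.mat (D.alpha ^ n) i i ∈ D.pE m ↔ m ≤ alphaExp i * n := by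
  rw [mat_alpha_zpow, Matrix.diagonal_apply_eq, mem_P, norm_zpow, norm_pi,
    zpow_le_zpow_iff_right_of_lt_one₀ D.norm_pos D.norm_ϖ_lt_one]

theorem inLattice_alpha_zpow (c : MaxCompact) {n : ℤ} (hn : n = 1 ∨ n = -1) :
    D.InLattice c 1 (D.alpha ^ n) := by
  intro i j
  by_cases h : i = j
  · subst h
    rw [mem_alpha_zpow_entry]
    rcases hn with rfl | rfl <;> revert i <;> cases c <;> decide
  · rw [mat_alpha_zpow, Matrix.diagonal_apply_ne _ h]; exact zero_mem _

/-- The outer diagonal entries $\varpi^{-n}$ and $\varpi^{n}$ of $\alpha^n$ must both lie in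
$\mathfrak p^{-s}$. -/
theorem le_of_inLattice_alpha_zpow {c : MaxCompact} {s n : ℤ}
    (h : D.InLattice c s (D.alpha ^ n)) : |n| ≤ s := by
  have h0 := (D.mem_alpha_zpow_entry _ _ _).1 (h 0 0)
  have h2 := (D.mem_alpha_zpow_entry _ _ _).1 (h 2 2)
  rw [c.admissible_expK.2.1] at h0 h2
  simp only [alphaExp, Matrix.cons_val_zero, Matrix.cons_val] at h0 h2
  exact abs_le.2 ⟨by linarith, by linarith⟩

theorem inLattice_of_mem_doubleCoset {c : MaxCompact} {y : D.G} {n : ℤ} (hn : n = 1 ∨ n = -1)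
    {I : Subgroup D.G} (hI : I ≤ D.K c)
    (hy : y ∈ DoubleCoset.doubleCoset (D.alpha ^ n) (D.K c : Set D.G) (I : Set D.G)) :
    D.InLattice c 1 y := by
  obtain ⟨k, hk, k', hk', rfl⟩ := DoubleCoset.mem_doubleCoset.1 hy
  exact ((D.inLattice_of_mem_K hk).mul (D.inLattice_alpha_zpow c hn)).mul
    (D.inLattice_of_mem_K (hI hk'))

/-- The coset `α K` is the only one in `K α K / K` at distance `s` from `α ^ (s + 1) K`. -/
theorem alpha_inv_mul_mem_K {c : MaxCompact} {y : D.G}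
    (hy : y ∈ DoubleCoset.doubleCoset D.alpha (D.K c : Set D.G) (D.K c : Set D.G)) {s : ℤ}
    (hs : D.InLattice c s (y⁻¹ * D.alpha ^ (s + 1))) : D.alpha⁻¹ * y ∈ D.K c := by
  obtain ⟨k, hk, k', hk', rfl⟩ := DoubleCoset.mem_doubleCoset.1 hy
  set m := k⁻¹ with hm
  have hmK : m ∈ D.K c := inv_mem hk
  have h1 : D.InLattice c s (D.alpha ^ (-1 : ℤ) * m * D.alpha ^ (s + 1)) := by
    have h2 := (D.inLattice_of_mem_K hk').mul hs
    have h3 : k' * ((k * D.alpha * k')⁻¹ * D.alpha ^ (s + 1)) =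
        D.alpha ^ (-1 : ℤ) * m * D.alpha ^ (s + 1) := by rw [hm]; group
    rwa [h3, zero_add] at h2
  -- On the first column $\alpha^{s+1}$ brings in $\varpi^{-(s+1)}$, one power more than level $s$
  -- allows, so $m$ must compensate: by one power in row $1$ and two in row $2$.
  have h2 : ∀ i, D.mat m i 0 ∈ D.pE (c.expK i 0 + 1 + alphaExp i) := by
    intro i
    have := h1 i 0
    rw [mat_mul_alpha_zpow, mat_alpha_zpow_mul, zpow_mul_mem_P, zpow_mul_mem_P] at this
    refine D.P_mono ?_ this
    have : alphaExp 0 = -1 := rfl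
    rw [this]; linarith
  have h10 : D.mat m 1 0 ∈ D.pE (c.expK 1 0 + 1) := D.P_mono (by cases c <;> decide) (h2 1)
  have h20 : D.mat m 2 0 ∈ D.pE (c.expK 2 0 + 2) := D.P_mono (by cases c <;> decide) (h2 2)
  have hmI : m ∈ D.Iw c := D.mem_Iw_of_column c hmK (D.P_mono (by cases c <;> decide) h10)
    (D.P_mono (by cases c <;> decide) h20)
  have h00 := D.congSub_norm_diag c.triangular_expI hmI 0
  have h21 : D.mat m 2 1 ∈ D.pE (c.expK 2 1 + 1) := by
    have h3 := D.column_herm m 0 1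
    have h4 : D.mat m 0 0 * D.conj (D.mat m 2 1) =
        -(D.mat m 1 0 * D.conj (D.mat m 1 1) + D.mat m 2 0 * D.conj (D.mat m 0 1)) := by
      simp [betaMat] at h3
      linear_combination h3
    rw [← D.conj_mem_P_iff, ← D.norm_one_mul_mem_P h00, h4]
    exact neg_mem (add_mem
      (D.P_mono (by cases c <;> decide) (D.mul_mem_P h10 (D.conj_mem_P (hmK 1 1))))
      (D.P_mono (by cases c <;> decide) (D.mul_mem_P h20 (D.conj_mem_P (hmK 0 1)))))
  -- This suffices because $\alpha^{-1}y=(\alpha^{-1}m\alpha)^{-1}k'$ when $y=k\alpha k'$ and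
  -- $m=k^{-1}$.
  have h3 : D.alpha ^ (-1 : ℤ) * m * D.alpha ^ (-(-1) : ℤ) ∈ D.K c := by
    intro i j
    rw [mat_alpha_conj, zpow_mul_mem_P]
    fin_cases i <;> fin_cases j
    · exact D.P_mono (by cases c <;> decide) (hmK 0 0)
    · exact D.P_mono (by cases c <;> decide) (hmK 0 1)
    · exact D.P_mono (by cases c <;> decide) (hmK 0 2)
    · exact D.P_mono (by cases c <;> decide) h10
    · exact D.P_mono (by cases c <;> decide) (hmK 1 1)
    · exact D.P_mono (by cases c <;> decide) (hmK 1 2)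
    · exact D.P_mono (by cases c <;> decide) h20
    · exact D.P_mono (by cases c <;> decide) h21
    · exact D.P_mono (by cases c <;> decide) (hmK 2 2)
  have h4 := mul_mem (inv_mem h3) hk'
  have h5 : (D.alpha ^ (-1 : ℤ) * m * D.alpha ^ (-(-1) : ℤ))⁻¹ * k' =
      D.alpha⁻¹ * (k * D.alpha * k') := by rw [hm]; group
  rwa [h5] at h4

variable {D} in
-- Conjugation by $\alpha^{-n}$ multiplies the corner by $\varpi^{2n}$.
theorem IsUpperUnip.alpha_conj_mem_Iw1 {c : MaxCompact} {u : D.G} (h : D.IsUpperUnip u)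
    (hu : u ∈ D.Iw1 c) (n : ℕ) :
    D.alpha ^ (-(n : ℤ)) * u * D.alpha ^ (n : ℤ) ∈ D.Iw1 c := by
  have h1 := h.alpha_conj (-(n : ℤ))
  rw [neg_neg] at h1
  refine h1.mem_Iw1 ?_
  have h2 := D.mat_alpha_conj (-(n : ℤ)) u 0 2
  rw [neg_neg] at h2
  rw [h2, zpow_mul_mem_P]
  refine D.P_mono ?_ (D.Iw1_le_K c hu 0 2)
  have h3 : alphaExp 0 - alphaExp 2 = -2 := by decide
  rw [h3]
  have := Int.natCast_nonneg n
  linarith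

variable {D} in
theorem IsLowerUnip.betaK_conj {c : MaxCompact} {u : D.G} (h : D.IsLowerUnip u) :
    D.IsUpperUnip (D.betaK c * u * D.betaK c) := by
  refine ⟨⟨?_, ?_, ?_⟩, fun i => ?_⟩ <;> rw [mat_betaK_conj]
  · exact mul_eq_zero_of_right _ h.h12
  · exact mul_eq_zero_of_right _ h.h02
  · exact mul_eq_zero_of_right _ h.h01
  · rw [h.diag, sub_self, zpow_zero, one_mul]

theorem betaK_conj_mem_Iw1 {c : MaxCompact} {u : D.G} (h : D.IsLowerUnip u) (hu : u ∈ D.Iw1 c) :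
    D.betaK c * u * D.betaK c ∈ D.Iw1 c :=
  D.betaK_mul_mul_mem_Iw1 c (h.mem_Iw1' (D.Iw1_le_K c hu 2 0))

theorem isClopen_doubleCoset_Iw [ProperSpace F] (c : MaxCompact) (a : D.G) :
    IsClopen (DoubleCoset.doubleCoset a (D.K c : Set D.G) (D.Iw c : Set D.G)) :=
  ⟨(isCompact_doubleCoset (D.isCompact_K c) (D.isCompact_congSub _ _) a).isClosed,
    isOpen_doubleCoset (D.isOpen_congSub _ _) a⟩

theorem mul_mem_doubleCoset_iff {G : Type*} [Group G] {K I : Subgroup G} (a : G) (x : K) (g : G) :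
    (x : G) * g ∈ DoubleCoset.doubleCoset a (K : Set G) (I : Set G) ↔
      g ∈ DoubleCoset.doubleCoset a (K : Set G) (I : Set G) := by
  have key : ∀ (x : K) (g : G), g ∈ DoubleCoset.doubleCoset a (K : Set G) (I : Set G) →
      (x : G) * g ∈ DoubleCoset.doubleCoset a (K : Set G) (I : Set G) := by
    intro x g h
    obtain ⟨k, hk, i, hi, rfl⟩ := DoubleCoset.mem_doubleCoset.1 h
    exact DoubleCoset.mem_doubleCoset.2 ⟨x * k, K.mul_mem x.2 hk, i, hi, by group⟩
  refine ⟨fun h => ?_, key x g⟩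
  have := key x⁻¹ _ h
  simpa using this

end Lattice

/-! ### The function $\Phi=P(T)(\alpha^{\deg P}f_0)$ and the corrections of $f_0$ and $f_1$. -/

section Functions

variable {F E : Type*} [NontriviallyNormedField F] [NormedField E] [NormedAlgebra F E]
  (D : UnramifiedQuadratic F E) [IsUltrametricDist E] [CompleteSpace F] [ProperSpace F]
  {k W : Type*} [Field k] [AddCommGroup W] [Module k W] {c : MaxCompact}
  (σ : Representation k (D.K c) W) (v₀ : fixedBy σ (D.Iw1 c))

theorem fFun_apply_alpha (n : ℤ) : (D.fFun σ v₀ n).1 (D.alpha ^ (-n)) = D.fValue σ v₀ n := by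
  have := cosetFun_apply (D.fValue_fixed σ v₀ n) 1 (D.Iw1 c).one_mem
  rwa [map_one, OneMemClass.coe_one, one_mul, mul_one] at this

theorem fFun_mul_right (n : ℤ) (g : D.G) {i : D.G} (hi : i ∈ D.Iw1 c) :
    (D.fFun σ v₀ n).1 (g * i) = (D.fFun σ v₀ n).1 g :=
  cosetFun_mul_right (D.fValue_fixed σ v₀ n) g hi

theorem fFun_support (n : ℤ) (g : D.G) (h : (D.fFun σ v₀ n).1 g ≠ 0) :
    g ∈ DoubleCoset.doubleCoset (D.alpha ^ (-n)) (D.K c : Set D.G) (D.Iw1 c : Set D.G) := by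
  by_contra hg
  exact h (cosetFun_of_notMem hg)

theorem fFun_zero_support (g : D.G) (h : (D.fFun σ v₀ 0).1 g ≠ 0) : g ∈ D.K c := by
  obtain ⟨x, hx, i, hi, rfl⟩ := DoubleCoset.mem_doubleCoset.1 (D.fFun_support σ v₀ 0 g h)
  rw [neg_zero, zpow_zero, mul_one]
  exact mul_mem hx (D.Iw1_le_K c hi)

theorem fFun_zero_one : (D.fFun σ v₀ 0).1 1 = v₀ := by
  have := D.fFun_apply_alpha σ v₀ 0
  rwa [neg_zero, zpow_zero, fValue, if_neg (lt_irrefl _)] at this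

theorem heckeT_support (f : compactInd σ) (g : D.G)
    (h : (D.heckeT σ f).1 g ≠ 0) :
    ∃ y ∈ DoubleCoset.doubleCoset D.alpha (D.K c : Set D.G) (D.K c : Set D.G),
      f.1 (y⁻¹ * g) ≠ 0 := by
  obtain ⟨y, hy, hf⟩ := (D.heckePhi σ).exists_of_operator_ne_zero (D.isOpen_K c) f g h
  refine ⟨y, ?_, hf⟩
  by_contra hy'
  exact hy (doubleFun_of_notMem hy')

/-- Each $T$ adds a factor from $K\alpha K$, which raises the level by at most one, and $f_0$ starts
at level $0$. -/
theorem heckeT_pow_support (r s : ℕ) (g : D.G)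
    (h : (((D.heckeT σ).toLinearMap ^ s)
      (compactIndRep σ (D.alpha ^ (r : ℤ)) (D.fFun σ v₀ 0))).1 g ≠ 0) :
    D.InLattice c s (g * D.alpha ^ (r : ℤ)) := by
  induction s generalizing g with
  | zero =>
    rw [pow_zero, Module.End.one_apply] at h
    exact D.inLattice_of_mem_K (D.fFun_zero_support σ v₀ _ h)
  | succ s ih =>
    rw [pow_succ', Module.End.mul_apply] at h
    obtain ⟨y, hy, hf⟩ := D.heckeT_support σ _ g h
    have h1 := ih _ hf
    have hy' : D.InLattice c 1 y :=
      D.inLattice_of_mem_doubleCoset (n := 1) (Or.inl rfl) le_rfl (by rwa [zpow_one])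
    have h2 := hy'.mul h1
    rw [mul_assoc, mul_inv_cancel_left, add_comm] at h2
    exact_mod_cast h2

/-- The point $\alpha^{s-r}$ is extreme for the support bound. In the convolution sum only the coset
$\alpha K$ can contribute there, and it contributes $j_\sigma$, which fixes $v_0$. -/
theorem heckeT_pow_apply (hj : D.jSigma σ v₀ = v₀) (r s : ℕ) :
    (((D.heckeT σ).toLinearMap ^ s)
      (compactIndRep σ (D.alpha ^ (r : ℤ)) (D.fFun σ v₀ 0))).1 (D.alpha ^ ((s : ℤ) - r)) = v₀ := by
  induction s with
  | zero =>
    rw [pow_zero, Module.End.one_apply]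
    change (D.fFun σ v₀ 0).1 (D.alpha ^ (((0 : ℕ) : ℤ) - r) * D.alpha ^ (r : ℤ)) = v₀
    rw [← zpow_add, Nat.cast_zero, sub_add_cancel, zpow_zero, fFun_zero_one]
  | succ s ih =>
    rw [pow_succ', Module.End.mul_apply]
    set f := ((D.heckeT σ).toLinearMap ^ s)
      (compactIndRep σ (D.alpha ^ (r : ℤ)) (D.fFun σ v₀ 0)) with hf
    change (∑ᶠ q, (D.heckePhi σ).term f _ q) = _
    rw [finsum_eq_single _ (QuotientGroup.mk D.alpha)]
    · rw [HeckeFunction.term_mk]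
      have h1 : D.alpha⁻¹ * D.alpha ^ (((s + 1 : ℕ) : ℤ) - r) = D.alpha ^ ((s : ℤ) - r) := by
        rw [← zpow_neg_one, ← zpow_add]
        congr 1
        push_cast; ring
      have h2 : (D.heckePhi σ).toFun D.alpha = D.jSigma σ := by
        have := doubleFun_apply (D.jSigma_alpha σ) 1 1
        rw [map_one, one_mul, mul_one, OneMemClass.coe_one, one_mul, mul_one] at this
        exact this
      rw [h1, ih, h2, hj]
    · intro q hq
      induction q using QuotientGroup.induction_on with
      | H y =>
        by_contra h0
        apply hq
        rw [HeckeFunction.term_mk] at h0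
        have hy : y ∈ DoubleCoset.doubleCoset D.alpha (D.K c : Set D.G) (D.K c : Set D.G) := by
          by_contra hy'
          apply h0
          have : (D.heckePhi σ).toFun y = 0 := doubleFun_of_notMem hy'
          rw [this]; rfl
        have hfy : f.1 (y⁻¹ * D.alpha ^ (((s + 1 : ℕ) : ℤ) - r)) ≠ 0 := fun h => h0 (by
          rw [h, map_zero])
        have h1 := D.heckeT_pow_support σ v₀ r s _ hfy
        rw [mul_assoc, ← zpow_add, sub_add_cancel, Nat.cast_add, Nat.cast_one] at h1
        have h2 := D.alpha_inv_mul_mem_K hy h1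
        exact (QuotientGroup.eq.2 h2).symm

variable (P : Polynomial k)

/-- The function `P(T) α ^ deg P f_0`. -/
def shiftedAeval : compactInd σ :=
  Polynomial.aeval (D.heckeT σ).toLinearMap P
    (compactIndRep σ (D.alpha ^ (P.natDegree : ℤ)) (D.fFun σ v₀ 0))

theorem shiftedAeval_apply (g : D.G) : (D.shiftedAeval σ v₀ P).1 g =
    ∑ s ∈ Finset.range (P.natDegree + 1), P.coeff s • (((D.heckeT σ).toLinearMap ^ s)
      (compactIndRep σ (D.alpha ^ (P.natDegree : ℤ)) (D.fFun σ v₀ 0))).1 g := by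
  let ev : compactInd σ →ₗ[k] W := (LinearMap.proj g) ∘ₗ (compactInd σ).subtype
  have h : ∀ f : compactInd σ, f.1 g = ev f := fun _ => rfl
  simp only [h, shiftedAeval, Polynomial.aeval_eq_sum_range, LinearMap.sum_apply, map_sum,
    LinearMap.smul_apply, map_smul]

/-- A non-zero value would put $\alpha^{n+\deg P}$ at level $s$, contrary to
`le_of_inLattice_alpha_zpow`. -/
theorem shiftedAeval_term_eq_zero (n s : ℕ) (h : s < n + P.natDegree) :
    (((D.heckeT σ).toLinearMap ^ s)
      (compactIndRep σ (D.alpha ^ (P.natDegree : ℤ)) (D.fFun σ v₀ 0))).1 (D.alpha ^ (n : ℤ)) = 0 := by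
  by_contra h0
  have h1 := D.heckeT_pow_support σ v₀ _ s _ h0
  rw [← zpow_add] at h1
  have h2 := (le_abs_self _).trans (D.le_of_inLattice_alpha_zpow h1)
  omega

theorem shiftedAeval_alpha (n : ℕ) (hn : n ≠ 0) :
    (D.shiftedAeval σ v₀ P).1 (D.alpha ^ (n : ℤ)) = 0 := by
  rw [shiftedAeval_apply]
  refine Finset.sum_eq_zero fun s hs => ?_
  rw [Finset.mem_range] at hs
  rw [D.shiftedAeval_term_eq_zero σ v₀ P n s (by omega), smul_zero]

/-- Only the term of top degree reaches $1$. -/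
theorem shiftedAeval_one (hj : D.jSigma σ v₀ = v₀) :
    (D.shiftedAeval σ v₀ P).1 1 = P.leadingCoeff • (v₀ : W) := by
  rw [shiftedAeval_apply, Finset.sum_range_succ, Finset.sum_eq_zero, zero_add]
  · have := D.heckeT_pow_apply σ v₀ hj P.natDegree P.natDegree
    rw [sub_self, zpow_zero] at this
    rw [this]; rfl
  · intro s hs
    rw [Finset.mem_range] at hs
    have := D.shiftedAeval_term_eq_zero σ v₀ P 0 s (by omega)
    rw [Nat.cast_zero, zpow_zero] at this
    rw [this, smul_zero]

/-- `P(T) α ^ deg P f_0` is invariant under the elements which `α ^ deg P` conjugates into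
`I_{1,K}`. -/
theorem shiftedAeval_mul_right (g : D.G) {u : D.G}
    (hu : D.alpha ^ (-(P.natDegree : ℤ)) * u * D.alpha ^ (P.natDegree : ℤ) ∈ D.Iw1 c) :
    (D.shiftedAeval σ v₀ P).1 (g * u) = (D.shiftedAeval σ v₀ P).1 g := by
  have h1 : compactIndRep σ u (D.shiftedAeval σ v₀ P) = D.shiftedAeval σ v₀ P := by
    rw [shiftedAeval, ← aeval_intertwining]
    congr 1
    refine Subtype.ext (funext fun h => ?_)
    change (D.fFun σ v₀ 0).1 (h * u * D.alpha ^ (P.natDegree : ℤ)) =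
      (D.fFun σ v₀ 0).1 (h * D.alpha ^ (P.natDegree : ℤ))
    rw [← D.fFun_mul_right σ v₀ 0 (h * D.alpha ^ (P.natDegree : ℤ)) hu]
    group
  exact congrArg (fun f : compactInd σ => f.1 g) h1

variable {P} {v₀}

/-- Both functions are invariant under the upper unipotent elements of $I_{1,K}$, so vanishing on
$K\alpha^nI_K$ for $n\ge0$ reduces to the point $\alpha^n$. There the values cancel if $n=0$ and
both vanish if $n>0$. -/
theorem fFun_zero_sub_mem_Iminus (hj : D.jSigma σ v₀ = v₀) (hP : P ≠ 0) :
    D.fFun σ v₀ 0 - P.leadingCoeff⁻¹ • D.shiftedAeval σ v₀ P ∈ D.Iminus σ := by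
  have hlead : P.leadingCoeff ≠ 0 := Polynomial.leadingCoeff_ne_zero.2 hP
  set f := D.fFun σ v₀ 0 - P.leadingCoeff⁻¹ • D.shiftedAeval σ v₀ P with hf
  have hfg : ∀ g, f.1 g =
      (D.fFun σ v₀ 0).1 g - P.leadingCoeff⁻¹ • (D.shiftedAeval σ v₀ P).1 g := fun _ => rfl
  have hval : ∀ n : ℕ, f.1 (D.alpha ^ (n : ℤ)) = 0 := by
    intro n
    rw [hfg]
    rcases Nat.eq_zero_or_pos n with rfl | hn
    · rw [Nat.cast_zero, zpow_zero, fFun_zero_one, D.shiftedAeval_one σ v₀ P hj,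
        inv_smul_smul₀ hlead, sub_self]
    · rw [D.shiftedAeval_alpha σ v₀ P n hn.ne', smul_zero, sub_zero]
      by_contra h0
      have h1 := D.le_of_inLattice_alpha_zpow
        (D.inLattice_of_mem_K (D.fFun_zero_support σ v₀ _ h0))
      have h2 := (le_abs_self _).trans h1
      omega
  refine mem_of_support_subset_iUnion (D.Iminus σ)
    (fun n : ℕ => DoubleCoset.doubleCoset (D.alpha ^ (-((n : ℤ) + 1))) (D.K c : Set D.G)
      (D.Iw c : Set D.G))
    (fun n => D.isClopen_doubleCoset_Iw c _) (fun n x g => mul_mem_doubleCoset_iff _ x g)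
    (fun n f' hf' => (le_iSup (D.Rminus σ) n) hf') f fun g hg => ?_
  obtain ⟨x, hx, m, i, hi, rfl⟩ := D.exists_eq_mul_alpha_zpow_mul c g
  rcases lt_or_ge m 0 with hm | hm
  · obtain ⟨n, hn⟩ : ∃ n : ℕ, m = -((n : ℤ) + 1) := ⟨(-m - 1).toNat, by omega⟩
    exact ⟨n, DoubleCoset.mem_doubleCoset.2 ⟨x, hx, i, hi, by rw [hn]⟩⟩
  · exfalso
    apply hg
    obtain ⟨n, rfl⟩ := Int.eq_ofNat_of_zero_le hm
    obtain ⟨y, hy, u, huI, hu, he⟩ := D.exists_alpha_mul_upperUnip c hi n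
    have h1 : x * D.alpha ^ (n : ℤ) * i =
        ((⟨x, hx⟩ * ⟨y, hy⟩ : D.K c) : D.G) * (D.alpha ^ (n : ℤ) * u) := by
      rw [mul_assoc x, he]
      push_cast
      group
    rw [h1, f.2.1, hfg, D.fFun_mul_right σ v₀ 0 _ huI,
      D.shiftedAeval_mul_right σ v₀ P _ (hu.alpha_conj_mem_Iw1 huI _), ← hfg, hval, map_zero]

/-- The mirror image of `fFun_zero_sub_mem_Iminus`. As
$\alpha^{-(n+1)}\alpha\beta_K=\beta_K\alpha^n$, the translate of $\Phi$ takes the value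
$\sigma(\beta_K)\Phi(\alpha^n)$ at $\alpha^{-(n+1)}$. This explains both the index $1$ and the value
$\beta_Kv_0$ of $f_1$. -/
theorem fFun_one_sub_mem_Iplus (hj : D.jSigma σ v₀ = v₀) (hP : 1 ≤ P.natDegree) :
    D.fFun σ v₀ 1 - P.leadingCoeff⁻¹ •
      compactIndRep σ (D.alpha * D.betaK c) (D.shiftedAeval σ v₀ P) ∈ D.Iplus σ := by
  have hlead : P.leadingCoeff ≠ 0 := Polynomial.leadingCoeff_ne_zero.2 fun h => by
    simp [h] at hP
  set f := D.fFun σ v₀ 1 - P.leadingCoeff⁻¹ •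
      compactIndRep σ (D.alpha * D.betaK c) (D.shiftedAeval σ v₀ P) with hf
  have hfg : ∀ g, f.1 g = (D.fFun σ v₀ 1).1 g -
      P.leadingCoeff⁻¹ • (D.shiftedAeval σ v₀ P).1 (g * (D.alpha * D.betaK c)) := fun _ => rfl
  have hmove : ∀ n : ℕ, D.alpha ^ (-((n : ℤ) + 1)) * (D.alpha * D.betaK c) =
      D.betaK c * D.alpha ^ (n : ℤ) := by
    intro n
    have h1 : D.alpha ^ (-((n : ℤ) + 1)) * (D.alpha * D.betaK c) =
      D.alpha ^ (-(n : ℤ)) * D.betaK c := by group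
    rw [h1, alpha_zpow_mul_betaK, neg_neg]
  have hval : ∀ n : ℕ, f.1 (D.alpha ^ (-((n : ℤ) + 1))) = 0 := by
    intro n
    rw [hfg, hmove]
    have h1 := (D.shiftedAeval σ v₀ P).2.1 ⟨D.betaK c, D.betaK_mem_K c⟩ (D.alpha ^ (n : ℤ))
    rw [h1]
    rcases Nat.eq_zero_or_pos n with rfl | hn
    · have h2 := D.fFun_apply_alpha σ v₀ 1
      rw [fValue, if_pos one_pos] at h2
      rw [Nat.cast_zero, zero_add, h2, zpow_zero, D.shiftedAeval_one σ v₀ P hj, map_smul,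
        inv_smul_smul₀ hlead, sub_self]
    · rw [D.shiftedAeval_alpha σ v₀ P n hn.ne', map_zero, smul_zero, sub_zero]
      by_contra h0
      have h2 := D.le_of_inLattice_alpha_zpow (D.inLattice_of_mem_doubleCoset (Or.inr rfl)
        (D.Iw1_le_K c) (D.fFun_support σ v₀ 1 _ h0))
      rw [abs_neg] at h2
      have h3 := (le_abs_self _).trans h2
      omega
  have hinv : ∀ g u, u ∈ D.Iw1 c → D.IsLowerUnip u → f.1 (g * u) = f.1 g := by
    intro g u huI hu
    -- Translation by $\alpha$ uses up one power of the contraction and leaves $\alpha^{\deg P-1}$,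
    -- which still contracts because $\deg P\ge1$.
    have hd : ((P.natDegree - 1 : ℕ) : ℤ) = P.natDegree - 1 := by omega
    have h1 : g * u * (D.alpha * D.betaK c) =
        g * (D.alpha * D.betaK c) * ((D.alpha * D.betaK c)⁻¹ * u * (D.alpha * D.betaK c)) := by
      group
    have hwa : D.betaK c * D.alpha ^ (P.natDegree - 1 : ℤ) =
        D.alpha * D.betaK c * D.alpha ^ (P.natDegree : ℤ) := by
      have h2 := D.alpha_zpow_mul_betaK c 1
      rw [zpow_one] at h2
      rw [h2, mul_assoc, ← zpow_add]
      congr 2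
    rw [hfg, hfg, D.fFun_mul_right σ v₀ 1 g huI, h1, D.shiftedAeval_mul_right]
    have h3 : D.alpha ^ (-(P.natDegree : ℤ)) * ((D.alpha * D.betaK c)⁻¹ * u *
        (D.alpha * D.betaK c)) * D.alpha ^ (P.natDegree : ℤ) =
        D.alpha ^ (-((P.natDegree - 1 : ℕ) : ℤ)) * (D.betaK c * u * D.betaK c) *
          D.alpha ^ ((P.natDegree - 1 : ℕ) : ℤ) := by
      rw [hd]
      calc _ = (D.alpha * D.betaK c * D.alpha ^ (P.natDegree : ℤ))⁻¹ * u *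
            (D.alpha * D.betaK c * D.alpha ^ (P.natDegree : ℤ)) := by group
        _ = D.alpha ^ (-(P.natDegree - 1 : ℤ)) * ((D.betaK c)⁻¹ * u * D.betaK c) *
            D.alpha ^ (P.natDegree - 1 : ℤ) := by rw [← hwa]; group
        _ = _ := by rw [betaK_inv]
    rw [h3]
    exact hu.betaK_conj.alpha_conj_mem_Iw1 (D.betaK_conj_mem_Iw1 hu huI) _
  refine mem_of_support_subset_iUnion (D.Iplus σ)
    (fun n : ℕ => DoubleCoset.doubleCoset (D.alpha ^ n) (D.K c : Set D.G) (D.Iw c : Set D.G))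
    (fun n => D.isClopen_doubleCoset_Iw c _) (fun n x g => mul_mem_doubleCoset_iff _ x g)
    (fun n f' hf' => (le_iSup (D.Rplus σ) n) hf') f fun g hg => ?_
  obtain ⟨x, hx, m, i, hi, rfl⟩ := D.exists_eq_mul_alpha_zpow_mul c g
  rcases lt_or_ge m 0 with hm | hm
  · exfalso
    apply hg
    obtain ⟨n, rfl⟩ : ∃ n : ℕ, m = -((n : ℤ) + 1) := ⟨(-m - 1).toNat, by omega⟩
    obtain ⟨y, hy, u, huI, hu, he⟩ := D.exists_alpha_mul_lowerUnip c hi (n + 1)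
    push_cast at he
    have h1 : x * D.alpha ^ (-((n : ℤ) + 1)) * i =
        ((⟨x, hx⟩ * ⟨y, hy⟩ : D.K c) : D.G) * (D.alpha ^ (-((n : ℤ) + 1)) * u) := by
      rw [mul_assoc x, he]
      push_cast
      group
    rw [h1, f.2.1, hinv _ _ huI hu, hval, map_zero]
  · obtain ⟨n, rfl⟩ := Int.eq_ofNat_of_zero_le hm
    exact ⟨n, DoubleCoset.mem_doubleCoset.2 ⟨x, hx, i, hi, by simp⟩⟩

theorem fFun_zero_mem_Iplus : D.fFun σ v₀ 0 ∈ D.Iplus σ := by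
  refine le_iSup (D.Rplus σ) 0 fun g hg => ?_
  by_contra h0
  exact hg (DoubleCoset.mem_doubleCoset.2
    ⟨g, D.fFun_zero_support σ v₀ g h0, 1, one_mem _, by simp⟩)

/-- The kernel of $\iota$ is $G$-stable, and $f_0$ generates the whole induced representation. -/
theorem apply_fFun_zero_ne_zero (hσ : σ.IsIrreducible) (hv₀ : v₀ ≠ 0) {V : Type*} [AddCommGroup V]
    [Module k V] {π : Representation k D.G V} {ι : Representation.IntertwiningMap (compactIndRep σ) π}
    (hι : ι ≠ 0) : ι (D.fFun σ v₀ 0) ≠ 0 := by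
  intro h
  apply hι
  have htop := compactInd_eq_top hσ (D.isOpen_K c) (LinearMap.ker ι.toLinearMap)
    (fun g f hf => by
      have h1 : ι f = 0 := hf
      change ι (compactIndRep σ g f) = 0
      rw [ι.isIntertwining, h1, map_zero])
    (f₀ := D.fFun σ v₀ 0) h
    (fun g hg => by
      by_contra h0
      exact hg (D.fFun_zero_support σ v₀ g h0))
    (by
      rw [fFun_zero_one]
      exact fun h0 => hv₀ (Subtype.ext h0))
  exact Representation.IntertwiningMap.ext (LinearMap.ker_eq_top.1 htop)

end Functions

end UnramifiedQuadratic
end U21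
end

/-! ### The proposition. -/

theorem proposition3p1
    {p : ℕ} [Fact p.Prime] (hp : p ≠ 2)
    {F : Type*} [NontriviallyNormedField F] [IsUltrametricDist F] [ProperSpace F]
    (hpF : ‖(p : F)‖ < 1)
    {E : Type*} [NormedField E] [NormedAlgebra F E] [IsUltrametricDist E]
    (D : U21.UnramifiedQuadratic F E) (c : U21.MaxCompact)
    {W : Type*} [AddCommGroup W] [Module (AlgebraicClosure (ZMod p)) W]
    (σ : Representation (AlgebraicClosure (ZMod p)) (D.K c) W)
    (hσ : σ.IsIrreducible) (hσ_smooth : U21.IsSmooth σ)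
    (v₀ : U21.fixedBy σ (D.Iw1 c)) (hv₀ : v₀ ≠ 0)
    {V : Type*} [AddCommGroup V] [Module (AlgebraicClosure (ZMod p)) V]
    (π : Representation (AlgebraicClosure (ZMod p)) D.G V) (hπ_smooth : U21.IsSmooth π)
    (ι : Representation.IntertwiningMap (U21.compactIndRep σ) π)
    (hι_ne : ι ≠ 0) (hι_surj : Function.Surjective ι)
    (P : Polynomial (AlgebraicClosure (ZMod p))) (hP : 1 ≤ P.natDegree)
    (hfactor : LinearMap.range (Polynomial.aeval (D.heckeT σ).toLinearMap P) ≤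
      LinearMap.ker ι.toLinearMap) :
    ι (D.fFun σ v₀ 0) ∈ (D.Iminus σ).map ι.toLinearMap ∧
    ι (D.fFun σ v₀ 1) ∈ (D.Iplus σ).map ι.toLinearMap ∧
    ι (D.fFun σ v₀ 0) ≠ 0 ∧
    (D.Iplus σ).map ι.toLinearMap ⊓ (D.Iminus σ).map ι.toLinearMap ≠ ⊥ := by
  have : CharP (AlgebraicClosure (ZMod p)) p :=
    charP_of_injective_algebraMap (algebraMap (ZMod p) _).injective p
  have hj : D.jSigma σ v₀ = v₀ := D.jSigma_apply hp hpF hσ v₀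
  have hP0 : P ≠ 0 := fun h => by simp [h] at hP
  -- The factorization through $P(T)$ is used only here; equivariance of $\iota$ then disposes of
  -- the translate needed for $f_1$.
  have hΦ : ι (D.shiftedAeval σ v₀ P) = 0 := hfactor ⟨_, rfl⟩
  have h1 : ι (D.fFun σ v₀ 0) ∈ (D.Iminus σ).map ι.toLinearMap := by
    refine ⟨_, D.fFun_zero_sub_mem_Iminus σ hj hP0, ?_⟩
    change ι _ = _
    rw [map_sub, map_smul, hΦ, smul_zero, sub_zero]
  have h2 : ι (D.fFun σ v₀ 1) ∈ (D.Iplus σ).map ι.toLinearMap := by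
    refine ⟨_, D.fFun_one_sub_mem_Iplus σ hj hP, ?_⟩
    change ι _ = _
    rw [map_sub, map_smul, ι.isIntertwining, hΦ, map_zero, smul_zero, sub_zero]
  have h3 := D.apply_fFun_zero_ne_zero σ hσ hv₀ hι_ne
  refine ⟨h1, h2, h3, (Submodule.ne_bot_iff _).2 ⟨_, ⟨⟨_, D.fFun_zero_mem_Iplus σ, rfl⟩, h1⟩, h3⟩⟩
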